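/- Consider the system $\mathbf U_t + A\mathbf U_x = 0$, $\mathbf U=[U,V]^\top$, $A = \begin{bmatrix}0&1\\1&0\end{bmatrix}$, for $x\in[0,1]$, $t\in[0,T]$ with a final time $T>0$, with boundary conditions $U+\alpha_0V=g_1$ at $x=0$ and $U+\alpha_1V=g_n$ at $x=1$, where $\alpha_0\ge 0$ and $\alpha_1\le 0$. On the grid $x_j=(j-1)h$, $j=1,\dots,n$, $h=1/(n-1)$, $n\ge 4$, let $H=h\,\mathrm{diag}(\tfrac5{12},\tfrac{13}{12},1,\dots,1,\tfrac{13}{12},\tfrac5{12})$ and $B=\mathrm{diag}(-1,0,\dots,0,1)$, and let \[ D_m=H^{-1}\bigl(Q_m+\tfrac B2\bigr),\qquad D_p=H^{-1}\bigl(Q_p+\tfrac B2\bigr),\qquad Q_p=-Q_m^\top , \] be the upwind summation-by-parts pair with third order interior stencil and first order boundary closure, in which row $i$ of $Q_m$ has the entries $\tfrac16,-1,\tfrac12,\tfrac13$ in columns $i-2,\dots,i+1$, except that its upper left and lower right $2\times2$ blocks are \[ \begin{bmatrix}\tfrac1{12}&\tfrac5{12}\\-\tfrac34&\tfrac5{12}\end{bmatrix}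 \quad\text{and}\quad \begin{bmatrix}\tfrac5{12}&\tfrac5{12}\\-\tfrac34&\tfrac1{12}\end{bmatrix}. \] With $A_m=\tfrac12\begin{bmatrix}1&1\\1&1\end{bmatrix}$, $A_p=\tfrac12\begin{bmatrix}-1&1\\1&-1\end{bmatrix}$, $\mathbf w=[\mathbf u,\mathbf v]^\top$, and $\mathbf e_1,\mathbf e_n$ the first and the last unit vector, consider the semidiscretization \[ \mathbf w_t+(A_p\otimes D_p)\mathbf w+(A_m\otimes D_m)\mathbf w= \begin{bmatrix}\tau_1H^{-1}\mathbf e_1(u_1+\alpha_0v_1-g_1)\\ \tau_2H^{-1}\mathbf e_1(u_1+\alpha_0v_1-g_1)\end{bmatrix}+ \begin{bmatrix}\tau_3H^{-1}\mathbf e_n(u_n+\alpha_1v_n-g_n)\\ \tau_4H^{-1}\mathbf e_n(u_n+\alpha_1v_n-g_n)\end{bmatrix} \] with initial values $u_j(0)=U(x_j,0)$, $v_j(0)=V(x_j,0)$. Assume that it is energy stable: for $g_1=g_n=0$ it satisfies $\frac{d}{dt}\|\mathbf w\|_H^2\le 0$ for all $n\ge 4$, where $\|\mathbf w\|_H^2=\mathbf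 u^\top H\mathbf u+\mathbf v^\top H\mathbf v$. Measure the error by \[ E_n=\Bigl(\int_0^T h\sum_{j=1}^n\bigl(|U(x_j,t)-u_j(t)|^2+|V(x_j,t)-v_j(t)|^2\bigr)\,dt\Bigr)^{1/2}. \] Then the convergence rate is $r=2.5$ if \[ \alpha_0\tau_1+\tau_2+1=0\quad\text{and}\quad\alpha_1\tau_3+\tau_4-1=0, \] and $r=2$ otherwise. That is: for every sufficiently smooth solution $(U,V)$ of the boundary value problem there is a constant $C$ independent of $n$ such that $E_n\le Ch^{r}$ for all $n\ge4$; and the exponent $r$ is sharp: there are a smooth solution and a constant $c>0$ such that $E_n\ge ch^{r}$ for all sufficiently large $n$. -/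

import Mathlib

open scoped Matrix ContDiff

noncomputable section

namespace UpwindSBP

/-- Grid spacing `h = 1 / (n - 1)` of the uniform grid with `n` points on `[0, 1]`. -/
def step (n : ℕ) : ℝ := 1 / ((n : ℝ) - 1)

/-- The grid point with (zero-based) index `j`, that is `j * h`. -/
def node (n : ℕ) (j : Fin n) : ℝ := (j : ℝ) * step n

/-- Diagonal entries of the norm matrix `H = h * diag(5/12, 13/12, 1, …, 1, 13/12, 5/12)`. -/
def weight (n : ℕ) (i : Fin n) : ℝ :=
  step n *
    (if i.val = 0 ∨ i.val + 1 = n then 5 / 12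
      else if i.val = 1 ∨ i.val + 2 = n then 13 / 12
      else 1)

/-- The inverse of the (diagonal) norm matrix `H`. -/
def Hinv (n : ℕ) : Matrix (Fin n) (Fin n) ℝ := Matrix.diagonal fun i => (weight n i)⁻¹

/-- The grid vector `[1, 0, …, 0]`. -/
def eFirst (n : ℕ) : Fin n → ℝ := fun i => if i.val = 0 then 1 else 0

/-- The grid vector `[0, …, 0, 1]`. -/
def eLast (n : ℕ) : Fin n → ℝ := fun i => if i.val + 1 = n then 1 else 0

/-- `B = diag(-1, 0, …, 0, 1)`. -/
def Bmat (n : ℕ) : Matrix (Fin n) (Fin n) ℝ := Matrix.diagonal fun i => eLast n i - eFirst n i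

/-- The matrix `Q_m` of the upwind pair with third order interior: the interior stencil is
`(1/6, -1, 1/2, 1/3)` in columns `i - 2, …, i + 1`, and it is modified only in the `2 × 2` blocks
at the upper left and at the lower right corner. -/
def Qm (n : ℕ) : Matrix (Fin n) (Fin n) ℝ := fun i j =>
  if i.val = 0 ∧ j.val = 0 then 1 / 12
  else if i.val = 0 ∧ j.val = 1 then 5 / 12
  else if i.val = 1 ∧ j.val = 0 then -3 / 4
  else if i.val = 1 ∧ j.val = 1 then 5 / 12
  else if i.val + 2 = n ∧ j.val + 2 = n then 5 / 12
  else if i.val + 2 = n ∧ j.val + 1 = n then 5 / 12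
  else if i.val + 1 = n ∧ j.val + 2 = n then -3 / 4
  else if i.val + 1 = n ∧ j.val + 1 = n then 1 / 12
  else if i.val = j.val + 2 then 1 / 6
  else if i.val = j.val + 1 then -1
  else if i.val = j.val then 1 / 2
  else if i.val + 1 = j.val then 1 / 3
  else 0

/-- `Q_p = -Q_mᵀ`. -/
def Qp (n : ℕ) : Matrix (Fin n) (Fin n) ℝ := -(Qm n)ᵀ

/-- `D_m = H⁻¹ (Q_m + B / 2)`: third order accurate in the interior, first order accurate on the
first two and the last two grid points. -/
def Dm (n : ℕ) : Matrix (Fin n) (Fin n) ℝ := Hinv n * (Qm n + (1 / 2 : ℝ) • Bmat n)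

/-- `D_p = H⁻¹ (Q_p + B / 2)`. -/
def Dp (n : ℕ) : Matrix (Fin n) (Fin n) ℝ := Hinv n * (Qp n + (1 / 2 : ℝ) • Bmat n)

/-- The coefficients of the boundary conditions and of the penalty terms. -/
structure Params where
  α₀ : ℝ
  α₁ : ℝ
  τ₁ : ℝ
  τ₂ : ℝ
  τ₃ : ℝ
  τ₄ : ℝ

/-- First component of the right-hand side `F` of the semidiscretization `w_t = F(w)`,
`w = [u, v]`, with boundary data `g₁, gₙ`. The flux splitting `A = A_p + A_m` has
`A_p = ½ [[-1, 1], [1, -1]]` and `A_m = ½ [[1, 1], [1, 1]]`, so that the first component of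
`(A_p ⊗ D_p) w + (A_m ⊗ D_m) w` is `½ D_p (v - u) + ½ D_m (u + v)`. -/
def rhsU (P : Params) (n : ℕ) (g₁ gₙ : ℝ) (u v : Fin n → ℝ) : Fin n → ℝ :=
  -((1 / 2 : ℝ) • (Dp n *ᵥ (v - u)) + (1 / 2 : ℝ) • (Dm n *ᵥ (u + v)))
    + (P.τ₁ * (eFirst n ⬝ᵥ u + P.α₀ * (eFirst n ⬝ᵥ v) - g₁)) • (Hinv n *ᵥ eFirst n)
    + (P.τ₃ * (eLast n ⬝ᵥ u + P.α₁ * (eLast n ⬝ᵥ v) - gₙ)) • (Hinv n *ᵥ eLast n)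

/-- Second component of the right-hand side of the semidiscretization; here the flux terms are
`½ D_p (u - v) + ½ D_m (u + v)`. -/
def rhsV (P : Params) (n : ℕ) (g₁ gₙ : ℝ) (u v : Fin n → ℝ) : Fin n → ℝ :=
  -((1 / 2 : ℝ) • (Dp n *ᵥ (u - v)) + (1 / 2 : ℝ) • (Dm n *ᵥ (u + v)))
    + (P.τ₂ * (eFirst n ⬝ᵥ u + P.α₀ * (eFirst n ⬝ᵥ v) - g₁)) • (Hinv n *ᵥ eFirst n)
    + (P.τ₄ * (eLast n ⬝ᵥ u + P.α₁ * (eLast n ⬝ᵥ v) - gₙ)) • (Hinv n *ᵥ eLast n)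

/-- The rate `d/dt ‖w‖_H² = 2 (w, F(w))_H` at which the squared discrete norm
`‖w‖_H² = uᵀ H u + vᵀ H v` changes along the semidiscretization with homogeneous boundary data,
at the state `w = [u, v]`. -/
def energyRate (P : Params) (n : ℕ) (u v : Fin n → ℝ) : ℝ :=
  2 * ∑ i, weight n i * (u i * rhsU P n 0 0 u v i + v i * rhsV P n 0 0 u v i)

/-- The semidiscretization is (energy) stable: with homogeneous boundary data it satisfies
`d/dt ‖w‖_H² ≤ 0` on every grid on which the two boundary closures do not overlap. -/
def EnergyStable (P : Params) : Prop :=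
  ∀ n : ℕ, 4 ≤ n → ∀ u v : Fin n → ℝ, energyRate P n u v ≤ 0

/-- `(U, V)` (functions of `x` and `t`) is of class `C^k` on `[0, 1] × [0, T]` and solves
`U_t + V_x = 0`, `V_t + U_x = 0` with `U + α₀ V = g₁` at `x = 0` and `U + α₁ V = gₙ` at `x = 1`. -/
structure IsExactSolution (P : Params) (T : ℝ) (k : WithTop ℕ∞) (g₁ gₙ : ℝ → ℝ)
    (U V : ℝ → ℝ → ℝ) : Prop where
  smooth_U : ContDiffOn ℝ k (fun p : ℝ × ℝ => U p.1 p.2) (Set.Icc 0 1 ×ˢ Set.Icc 0 T)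
  smooth_V : ContDiffOn ℝ k (fun p : ℝ × ℝ => V p.1 p.2) (Set.Icc 0 1 ×ˢ Set.Icc 0 T)
  eq_U : ∀ x ∈ Set.Icc (0 : ℝ) 1, ∀ t ∈ Set.Icc (0 : ℝ) T,
    derivWithin (fun s => U x s) (Set.Icc 0 T) t
      + derivWithin (fun y => V y t) (Set.Icc 0 1) x = 0
  eq_V : ∀ x ∈ Set.Icc (0 : ℝ) 1, ∀ t ∈ Set.Icc (0 : ℝ) T,
    derivWithin (fun s => V x s) (Set.Icc 0 T) t
      + derivWithin (fun y => U y t) (Set.Icc 0 1) x = 0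
  bc_left : ∀ t ∈ Set.Icc (0 : ℝ) T, U 0 t + P.α₀ * V 0 t = g₁ t
  bc_right : ∀ t ∈ Set.Icc (0 : ℝ) T, U 1 t + P.α₁ * V 1 t = gₙ t

/-- `(u, v)` is the finite difference solution on the grid with `n` points, on the time interval
`[0, T]`, with boundary data `g₁, gₙ` and with the initial values of `(U, V)` on the grid. -/
structure IsSemidiscreteSolution (P : Params) (T : ℝ) (g₁ gₙ : ℝ → ℝ) (U V : ℝ → ℝ → ℝ) (n : ℕ)
    (u v : ℝ → Fin n → ℝ) : Prop where
  init_u : ∀ j, u 0 j = U (node n j) 0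
  init_v : ∀ j, v 0 j = V (node n j) 0
  eq_u : ∀ t ∈ Set.Icc (0 : ℝ) T,
    HasDerivWithinAt u (rhsU P n (g₁ t) (gₙ t) (u t) (v t)) (Set.Icc 0 T) t
  eq_v : ∀ t ∈ Set.Icc (0 : ℝ) T,
    HasDerivWithinAt v (rhsV P n (g₁ t) (gₙ t) (u t) (v t)) (Set.Icc 0 T) t

/-- The space-time error `(∫₀ᵀ ‖ζ(t)‖_h² dt)^{1/2}` of the finite difference solution, where
`‖ζ‖_h² = h ∑ⱼ |ζⱼ|²` and `ζ` is the pointwise error of both components. -/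
def errorNorm (T : ℝ) (U V : ℝ → ℝ → ℝ) (n : ℕ) (u v : ℝ → Fin n → ℝ) : ℝ :=
  Real.sqrt (∫ t in (0 : ℝ)..T,
    step n * ∑ j, ((U (node n j) t - u t j) ^ 2 + (V (node n j) t - v t j) ^ 2))

/-- The semidiscretization converges with rate (exactly) `r` on `[0, T]`: for all sufficiently
smooth solutions of the boundary value problem the error is at most `C h^r`, with `C` independent
of `h`; and the exponent cannot be improved, as for some smooth solution the error is at least
`c h^r` with `c > 0`, on all fine enough grids. -/
def HasConvergenceRate (P : Params) (T r : ℝ) : Prop :=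
  (∃ k : ℕ, ∀ (g₁ gₙ : ℝ → ℝ) (U V : ℝ → ℝ → ℝ), IsExactSolution P T k g₁ gₙ U V →
    ∃ C : ℝ, ∀ n : ℕ, 4 ≤ n → ∀ u v : ℝ → Fin n → ℝ,
      IsSemidiscreteSolution P T g₁ gₙ U V n u v → errorNorm T U V n u v ≤ C * step n ^ r) ∧
  (∃ (g₁ gₙ : ℝ → ℝ) (U V : ℝ → ℝ → ℝ), IsExactSolution P T ∞ g₁ gₙ U V ∧
    ∃ u v : (n : ℕ) → ℝ → Fin n → ℝ,
      (∀ n : ℕ, 4 ≤ n → IsSemidiscreteSolution P T g₁ gₙ U V n (u n) (v n)) ∧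
      ∃ c : ℝ, 0 < c ∧ ∃ N : ℕ, ∀ n : ℕ, N ≤ n →
        c * step n ^ r ≤ errorNorm T U V n (u n) (v n))

end UpwindSBP

end

/-! In the variables `u + v` and `u - v` the scheme decouples, up to the penalties, into `D_m`
acting on the right-going and `D_p` on the left-going wave. The reflection `x ↦ 1 - x`, `V ↦ -V`
exchanges the two, so one-sided arguments are needed at the left end only.

Multiplied by `H`, the truncation error is `h²/24` times multiples of `e₁ - e₂` and of its mirror
image, with second derivatives of the travelling waves as amplitudes, up to `O(h³)` near the ends
and `O(h⁴)` inside (`truncation_error`). Estimating this directly gives only `h^{3/2}`.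

Upper bound: subtract from the error `h²` times a grid function that the steady scheme maps to minus
the leading truncation error (`exists_corrector_left`). It consists of geometrically decaying layers
and a linear profile in `u + v`. The first rows of the two components and the value of the penalty
form a small linear system; it is solvable because stability forces `τ₁ + τ₂ ≠ 0`, and it makes the
amplitude of the profile a multiple of `α₀τ₁ + τ₂ + 1`. Layers have norm `O(√h)`, a profile has norm
`O(1)`: this is the difference between the rates `5/2` and `2`. The remainder is controlled by the
energy estimate (`exists_error_bound`).

Sharpness: a quadratic solution has a truncation error constant in time. Let a linear functional and
its composition with the scheme both be bounded by `√κ` times the norm (`IsDual`), and let it take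
the value `a` on the truncation error. Along the error `e` it satisfies `y' = z + a`, with `y` and
`z` bounded by `√κ ‖e‖`, so that `∫ ‖e‖² ≥ c a²/κ` (`IsDual.le_integral`). If a rate condition
fails, an approximate solution of the adjoint steady problem gives bounded `κ` and `a ~ h²`
(`exists_dual`). In any case the second grid value gives `a ~ h²` with `κ ~ 1/h` (`isDual_second`).
-/

noncomputable section

namespace UpwindSBP

/-! ### Explicit rows of the difference operators -/

/-- The rows of `H * D_m`, applied to a grid function. -/
def fluxM (n : ℕ) (φ : ℕ → ℝ) (i : ℕ) : ℝ :=
  if i = 0 then 5 / 12 * (φ 1 - φ 0)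
  else if i = 1 then -3 / 4 * φ 0 + 5 / 12 * φ 1 + 1 / 3 * φ 2
  else if i + 2 = n then
    1 / 6 * φ (i - 2) - φ (i - 1) + 5 / 12 * φ i + 5 / 12 * φ (i + 1)
  else if i + 1 = n then 1 / 6 * φ (i - 2) - 3 / 4 * φ (i - 1) + 7 / 12 * φ i
  else 1 / 6 * φ (i - 2) - φ (i - 1) + 1 / 2 * φ i + 1 / 3 * φ (i + 1)

/-- The rows of `H * D_p`, applied to a grid function. -/
def fluxP (n : ℕ) (φ : ℕ → ℝ) (i : ℕ) : ℝ :=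
  if i = 0 then -(7 / 12 * φ 0 - 3 / 4 * φ 1 + 1 / 6 * φ 2)
  else if i = 1 then -(5 / 12 * φ 0 + 5 / 12 * φ 1 - φ 2 + 1 / 6 * φ 3)
  else if i + 2 = n then
    -(1 / 3 * φ (i - 1) + 5 / 12 * φ i - 3 / 4 * φ (i + 1))
  else if i + 1 = n then -(5 / 12 * (φ (i - 1) - φ i))
  else -(1 / 3 * φ (i - 1) + 1 / 2 * φ i - φ (i + 1) + 1 / 6 * φ (i + 2))

lemma step_pos {n : ℕ} (hn : 4 ≤ n) : 0 < step n := by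
  have : (4 : ℝ) ≤ n := by exact_mod_cast hn
  unfold step; apply div_pos one_pos; linarith

lemma step_le {n : ℕ} (hn : 4 ≤ n) : step n ≤ 1 / 3 := by
  have : (4 : ℝ) ≤ n := by exact_mod_cast hn
  unfold step; apply one_div_le_one_div_of_le <;> linarith

lemma step_mul {n : ℕ} (hn : 4 ≤ n) : ((n : ℝ) - 1) * step n = 1 := by
  have : (4 : ℝ) ≤ n := by exact_mod_cast hn
  unfold step; field_simp [show (n : ℝ) - 1 ≠ 0 by linarith]

lemma weight_ge {n : ℕ} (hn : 4 ≤ n) (i : Fin n) : 5 / 12 * step n ≤ weight n i := by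
  have := step_pos hn
  unfold weight; split_ifs <;> linarith

lemma weight_le {n : ℕ} (hn : 4 ≤ n) (i : Fin n) : weight n i ≤ 13 / 12 * step n := by
  have := step_pos hn
  unfold weight; split_ifs <;> linarith

lemma weight_pos {n : ℕ} (hn : 4 ≤ n) (i : Fin n) : 0 < weight n i := by
  have := step_pos hn
  have := weight_ge hn i
  linarith

lemma weight_mul_Hinv {n : ℕ} (hn : 4 ≤ n) (M : Matrix (Fin n) (Fin n) ℝ) (x : Fin n → ℝ)
    (i : Fin n) : weight n i * ((Hinv n * M) *ᵥ x) i = (M *ᵥ x) i := by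
  rw [← Matrix.mulVec_mulVec, Hinv, Matrix.mulVec_diagonal, ← mul_assoc,
    mul_inv_cancel₀ (weight_pos hn i).ne', one_mul]

lemma weight_mul_Hinv_mulVec {n : ℕ} (hn : 4 ≤ n) (x : Fin n → ℝ)
    (i : Fin n) : weight n i * (Hinv n *ᵥ x) i = x i := by
  rw [Hinv, Matrix.mulVec_diagonal, ← mul_assoc,
    mul_inv_cancel₀ (weight_pos hn i).ne', one_mul]

lemma sum_fin_eq_sum_of_support {n : ℕ} (s : Finset ℕ) (hs : ∀ j ∈ s, j < n) (F : ℕ → ℝ)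
    (hF : ∀ j, j < n → j ∉ s → F j = 0) : ∑ j : Fin n, F j = ∑ j ∈ s, F j := by
  rw [Fin.sum_univ_eq_sum_range]
  refine (Finset.sum_subset (fun j hj => Finset.mem_range.2 (hs j hj)) ?_).symm
  intro j hj hjs
  exact hF j (Finset.mem_range.1 hj) hjs

/-- The entries of `H * D_m` as a function of natural numbers. -/
def entryM (n i j : ℕ) : ℝ :=
  (if i = 0 ∧ j = 0 then 1 / 12
  else if i = 0 ∧ j = 1 then 5 / 12
  else if i = 1 ∧ j = 0 then -3 / 4
  else if i = 1 ∧ j = 1 then 5 / 12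
  else if i + 2 = n ∧ j + 2 = n then 5 / 12
  else if i + 2 = n ∧ j + 1 = n then 5 / 12
  else if i + 1 = n ∧ j + 2 = n then -3 / 4
  else if i + 1 = n ∧ j + 1 = n then 1 / 12
  else if i = j + 2 then 1 / 6
  else if i = j + 1 then -1
  else if i = j then 1 / 2
  else if i + 1 = j then 1 / 3
  else 0)

lemma entryM_interior {n i j : ℕ} (h : 1 < i ∨ 1 < j) (h' : i + 2 < n ∨ j + 2 < n) :
    entryM n i j = if i = j + 2 then 1 / 6 else if i = j + 1 then -1 else
      if i = j then 1 / 2 else if i + 1 = j then 1 / 3 else 0 := by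
  unfold entryM
  rw [if_neg (by omega), if_neg (by omega), if_neg (by omega), if_neg (by omega),
    if_neg (by omega), if_neg (by omega), if_neg (by omega), if_neg (by omega)]

lemma entryM_eq_zero {n i j : ℕ} (hn : 4 ≤ n) (hi : i < n) (hj : j < n)
    (h : i + 1 < j ∨ j + 2 < i) : entryM n i j = 0 := by
  rw [entryM_interior (by omega) (by omega), if_neg (by omega), if_neg (by omega),
    if_neg (by omega), if_neg (by omega)]

lemma entryM_sub_two {n i j : ℕ} (hn : 4 ≤ n) (h : i < n) (hj : i = j + 2) :
    entryM n i j = 1 / 6 := by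
  rw [entryM_interior (by omega) (by omega), if_pos hj]

lemma entryM_sub_one {n i j : ℕ} (h0 : 0 < j) (h : i + 1 < n) (hj : i = j + 1) :
    entryM n i j = -1 := by
  rw [entryM_interior (by omega) (by omega), if_neg (by omega), if_pos hj]

lemma entryM_diag {n i : ℕ} (h0 : 1 < i) (h : i + 2 < n) : entryM n i i = 1 / 2 := by
  rw [entryM_interior (by omega) (by omega), if_neg (by omega), if_neg (by omega), if_pos rfl]

lemma entryM_add_one {n i j : ℕ} (h0 : 0 < i) (h : j + 1 < n) (hj : j = i + 1) :
    entryM n i j = 1 / 3 := by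
  rw [entryM_interior (by omega) (by omega), if_neg (by omega), if_neg (by omega),
    if_neg (by omega), if_pos hj.symm]

lemma entryM_corner {n i j : ℕ} (hn : 4 ≤ n) (hi : n ≤ i + 2) :
    entryM n i j = if i + 2 = n ∧ j + 2 = n then 5 / 12
      else if i + 2 = n ∧ j + 1 = n then 5 / 12
      else if i + 1 = n ∧ j + 2 = n then -3 / 4
      else if i + 1 = n ∧ j + 1 = n then 1 / 12
      else if i = j + 2 then 1 / 6
      else if i = j + 1 then -1
      else if i = j then 1 / 2
      else if i + 1 = j then 1 / 3
      else 0 := by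
  unfold entryM
  rw [if_neg (by omega), if_neg (by omega), if_neg (by omega), if_neg (by omega)]

lemma entryM_corner₀₀ {n i : ℕ} (hn : 4 ≤ n) (hi : n = i + 2) : entryM n i i = 5 / 12 := by
  rw [entryM_corner hn (by omega), if_pos (by omega)]

lemma entryM_corner₀₁ {n i j : ℕ} (hn : 4 ≤ n) (hi : n = i + 2) (hj : j = i + 1) :
    entryM n i j = 5 / 12 := by
  rw [entryM_corner hn (by omega), if_neg (by omega), if_pos (by omega)]

lemma entryM_corner₁₀ {n i j : ℕ} (hn : 4 ≤ n) (hj : n = j + 2) (hi : i = j + 1) :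
    entryM n i j = -3 / 4 := by
  rw [entryM_corner hn (by omega), if_neg (by omega), if_neg (by omega), if_pos (by omega)]

lemma entryM_corner₁₁ {n i : ℕ} (hn : 4 ≤ n) (hi : n = i + 1) : entryM n i i = 1 / 12 := by
  rw [entryM_corner hn (by omega), if_neg (by omega), if_neg (by omega), if_neg (by omega),
    if_pos (by omega)]

lemma Dm_row_aux {n : ℕ} (φ : ℕ → ℝ) (i : Fin n) :
    ((Qm n + (1 / 2 : ℝ) • Bmat n) *ᵥ fun j => φ j) i =
      ∑ j : Fin n, entryM n i j * φ j +
        1 / 2 * ((if i.val + 1 = n then 1 else 0) - if i.val = 0 then 1 else 0) * φ i := by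
  rw [Matrix.add_mulVec, Matrix.smul_mulVec, Bmat, Pi.add_apply, Pi.smul_apply,
    Matrix.mulVec_diagonal, smul_eq_mul, eLast, eFirst, ← mul_assoc]
  rfl

lemma Dp_row_aux {n : ℕ} (φ : ℕ → ℝ) (i : Fin n) :
    ((Qp n + (1 / 2 : ℝ) • Bmat n) *ᵥ fun j => φ j) i =
      -∑ j : Fin n, entryM n j i * φ j +
        1 / 2 * ((if i.val + 1 = n then 1 else 0) - if i.val = 0 then 1 else 0) * φ i := by
  rw [Matrix.add_mulVec, Matrix.smul_mulVec, Bmat, Pi.add_apply, Pi.smul_apply,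
    Matrix.mulVec_diagonal, smul_eq_mul, eLast, eFirst, ← mul_assoc, Qp, Matrix.neg_mulVec]
  rfl

lemma weight_mul_Dm {n : ℕ} (hn : 4 ≤ n) (φ : ℕ → ℝ) (i : Fin n) :
    weight n i * (Dm n *ᵥ fun j => φ j) i = fluxM n φ i := by
  rw [Dm, weight_mul_Hinv hn, Dm_row_aux]
  obtain ⟨i, hi⟩ := i
  dsimp only
  rcases Nat.lt_or_ge i 2 with h2 | h2
  · rw [sum_fin_eq_sum_of_support {0, 1, 2} (by intro j; simp; omega) (fun j => entryM n i j * φ j)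
      (by
        intro j hj hs
        have : entryM n i j = 0 := entryM_eq_zero hn hi hj (by simp at hs; omega)
        simp [this])]
    interval_cases i
    · have e0 : entryM n 0 0 = 1 / 12 := by simp [entryM]
      have e1 : entryM n 0 1 = 5 / 12 := by simp [entryM]
      have e2 : entryM n 0 2 = 0 := entryM_eq_zero hn (by omega) (by omega) (by omega)
      simp [e0, e1, e2, fluxM, show ¬ 1 = n by omega]
      ring
    · have e0 : entryM n 1 0 = -3 / 4 := by simp [entryM]
      have e1 : entryM n 1 1 = 5 / 12 := by simp [entryM]
      have e2 : entryM n 1 2 = 1 / 3 := entryM_add_one (by omega) (by omega) rfl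
      simp [e0, e1, e2, fluxM, show ¬ 2 = n by omega]
      ring
  · obtain ⟨a, rfl⟩ : ∃ a, i = a + 2 := ⟨i - 2, by omega⟩
    rcases Nat.lt_or_ge (a + 3) n with h3 | h3
    · rw [sum_fin_eq_sum_of_support {a, a + 1, a + 2, a + 3} (by intro j; simp; omega)
        (fun j => entryM n (a + 2) j * φ j)
        (by
          intro j hj hs
          have : entryM n (a + 2) j = 0 := entryM_eq_zero hn hi hj (by simp at hs; omega)
          simp [this])]
      have e0 : entryM n (a + 2) a = 1 / 6 := entryM_sub_two hn hi rfl
      have e1 : entryM n (a + 2) (a + 1) = -1 := entryM_sub_one (by omega) (by omega) rfl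
      by_cases h4 : a + 4 = n
      · have e2 : entryM n (a + 2) (a + 2) = 5 / 12 := entryM_corner₀₀ hn (by omega)
        have e3 : entryM n (a + 2) (a + 3) = 5 / 12 := entryM_corner₀₁ hn (by omega) rfl
        simp [e0, e1, e2, e3, fluxM, h4, show ¬ a + 2 + 1 = n by omega, add_assoc]
        ring
      · have e2 : entryM n (a + 2) (a + 2) = 1 / 2 := entryM_diag (by omega) (by omega)
        have e3 : entryM n (a + 2) (a + 3) = 1 / 3 := entryM_add_one (by omega) (by omega) rfl
        simp [e0, e1, e2, e3, fluxM, h4, show ¬ a + 3 = n by omega, add_assoc]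
        ring
    · obtain rfl : n = a + 3 := by omega
      rw [sum_fin_eq_sum_of_support {a, a + 1, a + 2} (by intro j; simp; omega)
        (fun j => entryM (a + 3) (a + 2) j * φ j)
        (by
          intro j hj hs
          have : entryM (a + 3) (a + 2) j = 0 := entryM_eq_zero hn hi hj (by simp at hs; omega)
          simp [this])]
      have e0 : entryM (a + 3) (a + 2) a = 1 / 6 := entryM_sub_two hn hi rfl
      have e1 : entryM (a + 3) (a + 2) (a + 1) = -3 / 4 := entryM_corner₁₀ hn rfl rfl
      have e2 : entryM (a + 3) (a + 2) (a + 2) = 1 / 12 := entryM_corner₁₁ hn rfl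
      simp [e0, e1, e2, fluxM]
      ring

lemma weight_mul_Dp {n : ℕ} (hn : 4 ≤ n) (φ : ℕ → ℝ) (i : Fin n) :
    weight n i * (Dp n *ᵥ fun j => φ j) i = fluxP n φ i := by
  rw [Dp, weight_mul_Hinv hn, Dp_row_aux]
  obtain ⟨i, hi⟩ := i
  dsimp only
  rcases Nat.eq_zero_or_pos i with h1 | h1
  · subst h1
    rw [sum_fin_eq_sum_of_support {0, 1, 2} (by intro j; simp; omega) (fun j => entryM n j 0 * φ j)
      (by
        intro j hj hs
        have : entryM n j 0 = 0 := entryM_eq_zero hn hj hi (by simp at hs; omega)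
        simp [this])]
    have e0 : entryM n 0 0 = 1 / 12 := by simp [entryM]
    have e1 : entryM n 1 0 = -3 / 4 := by simp [entryM]
    have e2 : entryM n 2 0 = 1 / 6 := entryM_sub_two hn (by omega) rfl
    simp [e0, e1, e2, fluxP, show ¬ 1 = n by omega]
    ring
  obtain ⟨a, rfl⟩ : ∃ a, i = a + 1 := ⟨i - 1, by omega⟩
  rcases Nat.lt_or_ge (a + 3) n with h3 | h3
  · rw [sum_fin_eq_sum_of_support {a, a + 1, a + 2, a + 3} (by intro j; simp; omega)
      (fun j => entryM n j (a + 1) * φ j)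
      (by
        intro j hj hs
        have : entryM n j (a + 1) = 0 := entryM_eq_zero hn hj hi (by simp at hs; omega)
        simp [this])]
    have e2 : entryM n (a + 2) (a + 1) = -1 := entryM_sub_one (by omega) (by omega) rfl
    have e3 : entryM n (a + 3) (a + 1) = 1 / 6 := entryM_sub_two hn (by omega) rfl
    by_cases h4 : a = 0
    · subst h4
      have e0 : entryM n 0 1 = 5 / 12 := by simp [entryM]
      have e1 : entryM n 1 1 = 5 / 12 := by simp [entryM]
      simp at e2 e3
      simp [e0, e1, e2, e3, fluxP, show ¬ 2 = n by omega]
      ring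
    · have e0 : entryM n a (a + 1) = 1 / 3 := entryM_add_one (by omega) (by omega) rfl
      have e1 : entryM n (a + 1) (a + 1) = 1 / 2 := entryM_diag (by omega) (by omega)
      simp [e0, e1, e2, e3, fluxP, h4, show ¬ a + 3 = n by omega, show ¬ a + 2 = n by omega,
        add_assoc]
      ring
  · rcases (show n = a + 3 ∨ n = a + 2 by omega) with rfl | rfl
    · rw [sum_fin_eq_sum_of_support {a, a + 1, a + 2} (by intro j; simp; omega)
        (fun j => entryM (a + 3) j (a + 1) * φ j)
        (by
          intro j hj hs
          have : entryM (a + 3) j (a + 1) = 0 := entryM_eq_zero hn hj hi (by simp at hs; omega)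
          simp [this])]
      have e0 : entryM (a + 3) a (a + 1) = 1 / 3 := entryM_add_one (by omega) (by omega) rfl
      have e1 : entryM (a + 3) (a + 1) (a + 1) = 5 / 12 := entryM_corner₀₀ hn rfl
      have e2 : entryM (a + 3) (a + 2) (a + 1) = -3 / 4 := entryM_corner₁₀ hn rfl rfl
      simp [e0, e1, e2, fluxP, show a ≠ 0 by omega, add_assoc]
      ring
    · rw [sum_fin_eq_sum_of_support {a, a + 1} (by intro j; simp; omega)
        (fun j => entryM (a + 2) j (a + 1) * φ j)
        (by
          intro j hj hs
          have : entryM (a + 2) j (a + 1) = 0 := entryM_eq_zero hn hj hi (by simp at hs; omega)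
          simp [this])]
      have e0 : entryM (a + 2) a (a + 1) = 5 / 12 := entryM_corner₀₁ hn rfl rfl
      have e1 : entryM (a + 2) (a + 1) (a + 1) = 1 / 12 := entryM_corner₁₁ hn rfl
      simp [e0, e1, fluxP, show a ≠ 0 by omega]
      ring

/-! ### Reflection symmetry, summation by parts and characteristic variables -/

/-- Persymmetry of `Q_m`. Together with `Q_p = -Q_mᵀ` it makes the reversal of the grid exchange
`D_m` and `-D_p`. -/
lemma entryM_rev {n : ℕ} (hn : 4 ≤ n) (i j : Fin n) :
    entryM n i.rev j.rev = entryM n j i := by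
  obtain ⟨i, hi⟩ := i
  obtain ⟨j, hj⟩ := j
  obtain ⟨i', h1⟩ : ∃ i', i' = n - (i + 1) := ⟨_, rfl⟩
  obtain ⟨j', h2⟩ : ∃ j', j' = n - (j + 1) := ⟨_, rfl⟩
  simp only [Fin.val_rev, ← h1, ← h2]
  have h1 : i' + i + 1 = n := by omega
  have h2 : j' + j + 1 = n := by omega
  rcases Nat.lt_or_ge 1 i with hi1 | hi1
  all_goals rcases Nat.lt_or_ge 1 j with hj1 | hj1
  case inr.inr =>
    interval_cases i <;> interval_cases j <;>
      (rw [entryM_corner hn (by omega)]; simp [entryM]; grind)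
  all_goals
    rcases Nat.lt_or_ge (i + 2) n with hi2 | hi2
    all_goals rcases Nat.lt_or_ge (j + 2) n with hj2 | hj2
    case inr.inr =>
      rw [entryM_corner hn hj2]
      have : i' = 0 ∨ i' = 1 := by omega
      have : j' = 0 ∨ j' = 1 := by omega
      grind [entryM]
    all_goals
      rw [entryM_interior (by omega) (by omega), entryM_interior (by omega) (by omega)]
      grind

lemma weight_rev {n : ℕ} (i : Fin n) : weight n i.rev = weight n i := by
  unfold weight
  have := i.2
  have h0 : n - (i + 1) = 0 ↔ i.val + 1 = n := by omega
  have h1 : n - (i + 1) + 1 = n ↔ i.val = 0 := by omega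
  have h2 : n - (i + 1) = 1 ↔ i.val + 2 = n := by omega
  have h3 : n - (i + 1) + 2 = n ↔ i.val = 1 := by omega
  simp only [Fin.val_rev, h0, h1, h2, h3, or_comm]

lemma Dm_mulVec_rev {n : ℕ} (hn : 4 ≤ n) (x : Fin n → ℝ) (i : Fin n) :
    (Dm n *ᵥ fun j => x j.rev) i = -(Dp n *ᵥ x) i.rev := by
  have hQ : ∀ i j : Fin n, Qm n i j = Qm n j.rev i.rev := fun i j => (entryM_rev hn j i).symm
  have hw : weight n i.rev = weight n i := weight_rev i
  have hB : (Bmat n *ᵥ fun j => x j.rev) i = -(Bmat n *ᵥ x) i.rev := by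
    simp only [Bmat, Matrix.mulVec_diagonal, eLast, eFirst, Fin.val_rev]
    have := i.2
    split_ifs <;> first | omega | simp
  have h1 := weight_mul_Hinv hn (Qm n + (1 / 2 : ℝ) • Bmat n) (fun j => x j.rev) i
  have h2 := weight_mul_Hinv hn (Qp n + (1 / 2 : ℝ) • Bmat n) x i.rev
  have h3 : (Qm n *ᵥ fun j => x j.rev) i = -(Qp n *ᵥ x) i.rev := by
    rw [Qp, Matrix.neg_mulVec, Pi.neg_apply, neg_neg]
    simp only [Matrix.mulVec, dotProduct, Matrix.transpose_apply]
    rw [← Equiv.sum_comp Fin.revPerm]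
    refine Finset.sum_congr rfl fun j _ => ?_
    simp [hQ i j.rev]
  have h4 : weight n i * ((Dm n *ᵥ fun j => x j.rev) i) = weight n i * -(Dp n *ᵥ x) i.rev := by
    rw [mul_neg, ← hw, Dp, h2, hw, Dm, h1]
    simp only [Matrix.add_mulVec, Matrix.smul_mulVec, Pi.add_apply, Pi.smul_apply, hB, h3,
      smul_eq_mul]
    ring
  exact mul_left_cancel₀ (weight_pos hn i).ne' h4

/-- Summation by parts: the `Q` parts cancel because `Q_p = -Q_mᵀ`, and the two halves of `B` add up
to the boundary term. -/
lemma dotProduct_weight_mul_Dm {n : ℕ} (hn : 4 ≤ n) (x y : Fin n → ℝ) :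
    ∑ i, y i * (weight n i * (Dm n *ᵥ x) i) =
      -∑ i, x i * (weight n i * (Dp n *ᵥ y) i - (eLast n i - eFirst n i) * y i) := by
  have h1 : ∀ i, weight n i * (Dm n *ᵥ x) i = ((Qm n + (1 / 2 : ℝ) • Bmat n) *ᵥ x) i :=
    fun i => weight_mul_Hinv hn _ _ _
  have h2 : ∀ i, weight n i * (Dp n *ᵥ y) i = ((Qp n + (1 / 2 : ℝ) • Bmat n) *ᵥ y) i :=
    fun i => weight_mul_Hinv hn _ _ _
  simp only [h1, h2, Matrix.add_mulVec, Matrix.smul_mulVec, Pi.add_apply, Pi.smul_apply,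
    Bmat, Matrix.mulVec_diagonal, smul_eq_mul, Qp, Matrix.neg_mulVec, Pi.neg_apply]
  have h3 : ∑ i, y i * (Qm n *ᵥ x) i = ∑ i, x i * ((Qm n)ᵀ *ᵥ y) i := by
    have := Matrix.dotProduct_mulVec y (Qm n) x
    rw [← Matrix.mulVec_transpose, dotProduct_comm ((Qm n)ᵀ *ᵥ y)] at this
    exact this
  rw [← sub_eq_zero, sub_neg_eq_add, ← Finset.sum_add_distrib]
  have h4 : ∀ i, y i * ((Qm n *ᵥ x) i + 1 / 2 * ((eLast n i - eFirst n i) * x i)) +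
      x i * (-((Qm n)ᵀ *ᵥ y) i + 1 / 2 * ((eLast n i - eFirst n i) * y i) -
        (eLast n i - eFirst n i) * y i) = y i * (Qm n *ᵥ x) i - x i * ((Qm n)ᵀ *ᵥ y) i := by
    intro i; ring
  simp only [h4, Finset.sum_sub_distrib, h3, sub_self]

/-- The difference of the first two unit vectors. -/
def patL (n : ℕ) (i : Fin n) : ℝ := eFirst n i - if i.val = 1 then 1 else 0

/-- The difference of the last two unit vectors. -/
def patR (n : ℕ) (i : Fin n) : ℝ := eLast n i - if i.val + 2 = n then 1 else 0

/-- A weight that decays exponentially away from both ends of the grid. -/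
def edge (n i : ℕ) : ℝ := (1 / 2) ^ i + (1 / 2) ^ (n - 1 - i)

lemma edge_pos (n i : ℕ) : 0 < edge n i := by unfold edge; positivity

lemma patL_rev {n : ℕ} (i : Fin n) : patL n i.rev = patR n i := by
  have := i.2
  have h0 : n - (i + 1) = 0 ↔ i.val + 1 = n := by omega
  have h2 : n - (i + 1) = 1 ↔ i.val + 2 = n := by omega
  simp only [patL, patR, eFirst, eLast, Fin.val_rev, h0, h2]

lemma patR_rev {n : ℕ} (i : Fin n) : patR n i.rev = patL n i := by
  rw [← patL_rev, Fin.rev_rev]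

lemma edge_rev {n : ℕ} (i : Fin n) : edge n i.rev = edge n i := by
  have := i.2
  rw [edge, edge, Fin.val_rev, add_comm, show n - 1 - (n - (i.val + 1)) = i by omega,
    show n - (i.val + 1) = n - 1 - i by omega]

lemma eFirst_dotProduct {n : ℕ} (hn : 4 ≤ n) (φ : ℕ → ℝ) :
    (eFirst n ⬝ᵥ fun j => φ j) = φ 0 := by
  have := sum_fin_eq_sum_of_support (n := n) {0} (by simp; omega)
    (fun j => (if j = 0 then 1 else 0) * φ j) (by intro j hj h; simp at h; simp [h])
  simpa [dotProduct, eFirst] using this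

lemma eLast_dotProduct {n : ℕ} (hn : 4 ≤ n) (φ : ℕ → ℝ) :
    (eLast n ⬝ᵥ fun j => φ j) = φ (n - 1) := by
  have := sum_fin_eq_sum_of_support (n := n) {n - 1} (by simp; omega)
    (fun j => (if j + 1 = n then 1 else 0) * φ j)
    (by intro j hj h; simp at h; simp [show j + 1 ≠ n by omega])
  simpa [dotProduct, eLast, show n - 1 + 1 = n by omega] using this

/-- `A_p` and `A_m` have the common eigenvectors `(1, 1)` and `(1, -1)`; on the first one `A_p`
vanishes, so only `D_m` survives in the sum. -/
lemma weight_mul_rhs_add {n : ℕ} (hn : 4 ≤ n) (P : Params) (g₁ gₙ : ℝ) (u v : Fin n → ℝ)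
    (i : Fin n) : weight n i * (rhsU P n g₁ gₙ u v i + rhsV P n g₁ gₙ u v i) =
      -(weight n i * (Dm n *ᵥ (u + v)) i)
        + (P.τ₁ + P.τ₂) * (eFirst n ⬝ᵥ u + P.α₀ * (eFirst n ⬝ᵥ v) - g₁) * eFirst n i
        + (P.τ₃ + P.τ₄) * (eLast n ⬝ᵥ u + P.α₁ * (eLast n ⬝ᵥ v) - gₙ) * eLast n i := by
  have h1 := weight_mul_Hinv_mulVec hn (eFirst n) i
  have h2 := weight_mul_Hinv_mulVec hn (eLast n) i
  rw [← h1, ← h2]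
  simp only [rhsU, rhsV, Pi.add_apply, Pi.neg_apply, Pi.smul_apply, smul_eq_mul,
    Matrix.mulVec_sub, Pi.sub_apply]
  ring

lemma weight_mul_rhs_sub {n : ℕ} (hn : 4 ≤ n) (P : Params) (g₁ gₙ : ℝ) (u v : Fin n → ℝ)
    (i : Fin n) : weight n i * (rhsU P n g₁ gₙ u v i - rhsV P n g₁ gₙ u v i) =
      weight n i * (Dp n *ᵥ (u - v)) i
        + (P.τ₁ - P.τ₂) * (eFirst n ⬝ᵥ u + P.α₀ * (eFirst n ⬝ᵥ v) - g₁) * eFirst n i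
        + (P.τ₃ - P.τ₄) * (eLast n ⬝ᵥ u + P.α₁ * (eLast n ⬝ᵥ v) - gₙ) * eLast n i := by
  have h1 := weight_mul_Hinv_mulVec hn (eFirst n) i
  have h2 := weight_mul_Hinv_mulVec hn (eLast n) i
  rw [← h1, ← h2]
  simp only [rhsU, rhsV, Pi.add_apply, Pi.neg_apply, Pi.smul_apply, smul_eq_mul,
    Matrix.mulVec_sub, Pi.sub_apply]
  ring

/-- The parameters of the problem reflected at `x = 1 / 2`, with `V` replaced by `-V`. -/
def Params.reflect (P : Params) : Params := ⟨-P.α₁, -P.α₀, P.τ₃, -P.τ₄, P.τ₁, -P.τ₂⟩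

lemma eFirst_dotProduct_rev {n : ℕ} (u : Fin n → ℝ) :
    (eFirst n ⬝ᵥ fun j => u j.rev) = eLast n ⬝ᵥ u := by
  simp only [dotProduct]
  rw [← Equiv.sum_comp Fin.revPerm]
  refine Finset.sum_congr rfl fun i _ => ?_
  have := i.2
  have h0 : n - (i + 1) = 0 ↔ i.val + 1 = n := by omega
  simp [eFirst, eLast, h0]

lemma eLast_dotProduct_rev {n : ℕ} (u : Fin n → ℝ) :
    (eLast n ⬝ᵥ fun j => u j.rev) = eFirst n ⬝ᵥ u := by
  simpa using (eFirst_dotProduct_rev fun j => u j.rev).symm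

lemma eFirst_rev {n : ℕ} (i : Fin n) : eFirst n i.rev = eLast n i := by
  have := i.2
  have h0 : n - (i + 1) = 0 ↔ i.val + 1 = n := by omega
  simp only [eFirst, eLast, Fin.val_rev, h0]

lemma eLast_rev {n : ℕ} (i : Fin n) : eLast n i.rev = eFirst n i := by
  rw [← eFirst_rev, Fin.rev_rev]

lemma Dp_mulVec_rev {n : ℕ} (hn : 4 ≤ n) (x : Fin n → ℝ) (i : Fin n) :
    (Dp n *ᵥ fun j => x j.rev) i = -(Dm n *ᵥ x) i.rev := by
  have := Dm_mulVec_rev hn (fun j => x j.rev) i.rev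
  simp only [Fin.rev_rev] at this
  rw [this, neg_neg]

/-- Changing the sign of `v` swaps `u + v` and `u - v`, while reversing the grid swaps `D_m` and
`-D_p`: the two effects match, and only the penalty parameters change. -/
lemma rhs_reflect {n : ℕ} (hn : 4 ≤ n) (P : Params) (u v : Fin n → ℝ) (i : Fin n) :
    rhsU P n 0 0 (fun j => u j.rev) (fun j => -v j.rev) i = rhsU P.reflect n 0 0 u v i.rev ∧
    rhsV P n 0 0 (fun j => u j.rev) (fun j => -v j.rev) i = -rhsV P.reflect n 0 0 u v i.rev := by
  have hs := weight_mul_rhs_add hn P 0 0 (fun j => u j.rev) (fun j => -v j.rev) i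
  have hd := weight_mul_rhs_sub hn P 0 0 (fun j => u j.rev) (fun j => -v j.rev) i
  have hs' := weight_mul_rhs_add hn P.reflect 0 0 u v i.rev
  have hd' := weight_mul_rhs_sub hn P.reflect 0 0 u v i.rev
  have e1 : (fun j : Fin n => u j.rev) + (fun j => -v j.rev) = fun j => (u - v) j.rev := by
    ext; simp [sub_eq_add_neg]
  have e2 : (fun j : Fin n => u j.rev) - (fun j => -v j.rev) = fun j => (u + v) j.rev := by
    ext; simp
  have e3 : (fun j : Fin n => -v j.rev) = -fun j => v j.rev := rfl
  rw [e1, Dm_mulVec_rev hn] at hs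
  rw [e2, Dp_mulVec_rev hn] at hd
  rw [e3, dotProduct_neg, dotProduct_neg] at hs hd
  rw [eFirst_dotProduct_rev, eFirst_dotProduct_rev, eLast_dotProduct_rev,
    eLast_dotProduct_rev] at hs hd
  rw [weight_rev, eFirst_rev, eLast_rev] at hs' hd'
  rw [e3]
  simp only [Params.reflect] at hs' hd' ⊢
  have hw := weight_pos hn i
  constructor
  · apply mul_left_cancel₀ hw.ne'
    linear_combination (hs + hd - hs' - hd') / 2
  · apply mul_left_cancel₀ hw.ne'
    linear_combination (hs - hd + hs' - hd') / 2

/-- The homogeneous right-hand side as a linear map. -/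
def rhsLin (P : Params) (n : ℕ) :
    ((Fin n → ℝ) × (Fin n → ℝ)) →ₗ[ℝ] ((Fin n → ℝ) × (Fin n → ℝ)) where
  toFun w := (rhsU P n 0 0 w.1 w.2, rhsV P n 0 0 w.1 w.2)
  map_add' x y := by
    ext i <;>
    · simp only [rhsU, rhsV, Prod.fst_add, Prod.snd_add, Matrix.mulVec_add, Matrix.mulVec_sub,
        dotProduct_add, Pi.add_apply, Pi.sub_apply, Pi.neg_apply, Pi.smul_apply, smul_eq_mul]
      ring
  map_smul' c x := by
    ext i <;>
    · simp only [rhsU, rhsV, Prod.smul_fst, Prod.smul_snd, Matrix.mulVec_add, Matrix.mulVec_sub,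
        Matrix.mulVec_smul, dotProduct_smul, Pi.add_apply, Pi.sub_apply, Pi.neg_apply,
        Pi.smul_apply, smul_eq_mul, RingHom.id_apply]
      ring

lemma rhsU_sub_rhsU (P : Params) (n : ℕ) (g₁ gₙ : ℝ) (u v u' v' : Fin n → ℝ) :
    rhsU P n g₁ gₙ u v - rhsU P n g₁ gₙ u' v' = rhsU P n 0 0 (u - u') (v - v') := by
  ext i
  simp only [rhsU, Matrix.mulVec_add, Matrix.mulVec_sub,
    dotProduct_sub, Pi.add_apply, Pi.sub_apply, Pi.neg_apply, Pi.smul_apply, smul_eq_mul]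
  ring

lemma rhsV_sub_rhsV (P : Params) (n : ℕ) (g₁ gₙ : ℝ) (u v u' v' : Fin n → ℝ) :
    rhsV P n g₁ gₙ u v - rhsV P n g₁ gₙ u' v' = rhsV P n 0 0 (u - u') (v - v') := by
  ext i
  simp only [rhsV, Matrix.mulVec_add, Matrix.mulVec_sub,
    dotProduct_sub, Pi.add_apply, Pi.sub_apply, Pi.neg_apply, Pi.smul_apply, smul_eq_mul]
  ring

lemma half_pow_le_step {n : ℕ} (hn : 4 ≤ n) : (1 / 2 : ℝ) ^ n ≤ step n := by
  have h : (n : ℝ) ≤ 2 ^ n := by exact_mod_cast n.lt_two_pow_self.le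
  have h4 : (4 : ℝ) ≤ n := by exact_mod_cast hn
  rw [step, one_div, inv_pow, inv_eq_one_div]
  apply one_div_le_one_div_of_le <;> linarith

lemma fluxM_linear (n : ℕ) (a : ℝ) (φ ψ : ℕ → ℝ) (i : ℕ) :
    fluxM n (fun j => a * φ j + ψ j) i = a * fluxM n φ i + fluxM n ψ i := by
  unfold fluxM; split_ifs <;> ring

lemma fluxP_linear (n : ℕ) (a : ℝ) (φ ψ : ℕ → ℝ) (i : ℕ) :
    fluxP n (fun j => a * φ j + ψ j) i = a * fluxP n φ i + fluxP n ψ i := by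
  unfold fluxP; split_ifs <;> ring

/-! ### Linear profiles and boundary layers -/

/-- The linear grid function with the values `1` and `0` at the end points. -/
def ramp (n j : ℕ) : ℝ := 1 - j * step n

lemma ramp_last {n : ℕ} (hn : 4 ≤ n) : ramp n (n - 1) = 0 := by
  have := step_mul hn
  rw [ramp, Nat.cast_sub (by omega)]
  push_cast
  linarith

lemma ramp_bound {n : ℕ} (hn : 4 ≤ n) {j : ℕ} (hj : j < n) : |ramp n j| ≤ 1 := by
  have h := step_mul hn
  have hs := step_pos hn
  have h1 : (j : ℝ) + 1 ≤ n := by exact_mod_cast hj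
  have h2 : (j : ℝ) * step n ≤ (n - 1) * step n := by
    apply mul_le_mul_of_nonneg_right _ hs.le; linarith
  have h3 : 0 ≤ (j : ℝ) * step n := by positivity
  rw [ramp, abs_le]
  constructor <;> linarith

/-- All rows, those of the closures included, are exact on linear functions; the slope is `-1`. -/
lemma fluxM_ramp {n : ℕ} (hn : 4 ≤ n) (i : Fin n) : fluxM n (ramp n) i = -weight n i := by
  obtain ⟨i, hi⟩ := i
  rcases Nat.lt_or_ge i 2 with h | h
  · interval_cases i
    · simp [fluxM, weight, ramp]; ring
    · simp [fluxM, weight, ramp, show ¬ 2 = n by omega]; ring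
  · obtain ⟨a, rfl⟩ : ∃ a, i = a + 2 := ⟨i - 2, by omega⟩
    simp only [fluxM, weight, ramp, show ¬ a + 2 = 0 by omega, show ¬ a + 2 = 1 by omega,
      show a + 2 - 1 = a + 1 by omega, show a + 2 - 2 = a by omega, if_false, false_or]
    push_cast
    split_ifs
    · omega
    · ring
    · ring
    · ring

lemma fluxP_ramp {n : ℕ} (hn : 4 ≤ n) (i : Fin n) : fluxP n (ramp n) i = -weight n i := by
  obtain ⟨i, hi⟩ := i
  rcases Nat.lt_or_ge i 2 with h | h
  · interval_cases i
    · simp [fluxP, weight, ramp]; ring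
    · simp [fluxP, weight, ramp, show ¬ 2 = n by omega]; ring
  · obtain ⟨a, rfl⟩ : ∃ a, i = a + 2 := ⟨i - 2, by omega⟩
    simp only [fluxP, weight, ramp, show ¬ a + 2 = 0 by omega, show ¬ a + 2 = 1 by omega,
      show a + 2 - 1 = a + 1 by omega, if_false, false_or]
    push_cast
    split_ifs
    · omega
    · ring
    · ring
    · ring

/-- On `κ ^ j` the interior row of `D_m` has the factor `(κ - 1) (2κ² + 5κ - 1)`, whose root in `(0,
1)` is the decaying mode. The decaying mode of `D_p` is `-2κ`; the bound `1/4` makes both decay at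
least like `(1/2) ^ j`. -/
lemma exists_layer_root : ∃ κ : ℝ, 0 < κ ∧ κ < 1 / 4 ∧ 2 * κ ^ 2 + 5 * κ = 1 := by
  have h := Real.sq_sqrt (show (0 : ℝ) ≤ 33 by norm_num)
  have h5 : 5 < √33 := by rw [Real.lt_sqrt] <;> norm_num
  have h6 : √33 < 6 := by rw [Real.sqrt_lt'] <;> norm_num
  refine ⟨(√33 - 5) / 4, by linarith, by linarith, by nlinarith⟩

/-- A left layer does not satisfy the closure rows at the right end, but its values there are
`O(2⁻ⁿ)`, hence `O(h)`. -/
lemma far_row_bound {n i : ℕ} (hn : 4 ≤ n) (hi : i < n) (hi2 : n ≤ i + 2) {q : ℕ → ℝ} {K : ℝ}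
    (hq : ∀ j, |q j| ≤ K * (1 / 2) ^ j) {j : ℕ} (hj : n ≤ j + 4) :
    |q j| ≤ 32 * K * (step n * (1 / 2) ^ (n - 1 - i)) := by
  have hK : 0 ≤ K := by simpa using (abs_nonneg _).trans (hq 0)
  have h1 : (1 / 2 : ℝ) ^ j ≤ 16 * (1 / 2) ^ n := by
    calc (1 / 2 : ℝ) ^ j = 16 * (1 / 2) ^ (j + 4) := by rw [pow_add]; ring
      _ ≤ 16 * (1 / 2) ^ n := by
        gcongr 16 * ?_
        exact pow_le_pow_of_le_one (by norm_num) (by norm_num) hj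
  have h2 := half_pow_le_step hn
  have h3 : (1 / 2 : ℝ) ^ 1 ≤ (1 / 2) ^ (n - 1 - i) :=
    pow_le_pow_of_le_one (by norm_num) (by norm_num) (by omega)
  have h4 := step_pos hn
  calc |q j| ≤ K * (1 / 2) ^ j := hq j
    _ ≤ K * (16 * step n) := by gcongr; linarith
    _ = 32 * K * (step n * (1 / 2) ^ 1) := by ring
    _ ≤ _ := by gcongr

/-- The first row fixes the amplitude of the decaying mode, and the second row is then satisfied.
The target has to contain `-q 0`: the rows of `H D_m q` sum to the last minus the first value of
`q`. This term is left for the penalty to cancel. -/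
lemma exists_layerM (β : ℝ) : ∃ (q : ℕ → ℝ) (K : ℝ), (∀ j, |q j| ≤ K * (1 / 2) ^ j) ∧
    ∀ n, 4 ≤ n → ∀ i, i < n →
      |fluxM n q i - ((β - q 0) * (if i = 0 then 1 else 0) - β * (if i = 1 then 1 else 0))| ≤
        K * (step n * (1 / 2) ^ (n - 1 - i)) := by
  obtain ⟨κ, hκ0, hκ1, hκ⟩ := exists_layer_root
  have h7 : 7 + 5 * κ ≠ 0 := by positivity
  set c := 12 * β / (7 + 5 * κ) with hc
  have hcβ : c * (7 + 5 * κ) = 12 * β := by rw [hc]; field_simp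
  have hq : ∀ j, |c * κ ^ j| ≤ |c| * (1 / 2) ^ j := by
    intro j
    rw [abs_mul, abs_pow, abs_of_pos hκ0]
    gcongr
    linarith
  refine ⟨fun j => c * κ ^ j, 96 * |c|, fun j => (hq j).trans ?_, ?_⟩
  · gcongr; linarith [abs_nonneg c]
  intro n hn i hi
  have hs := step_pos hn
  rcases Nat.lt_or_ge i 2 with h | h
  · have h0 : 0 ≤ 96 * |c| * (step n * (1 / 2) ^ (n - 1 - i)) := by positivity
    refine le_of_eq_of_le ?_ h0
    rw [abs_eq_zero]
    interval_cases i
    · simp [fluxM]; linear_combination hcβ / 12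
    · simp [fluxM]; linear_combination -hcβ / 12 + c * hκ / 6
  have hfar := fun (hi2 : n ≤ i + 2) j hj =>
    far_row_bound (q := fun j => c * κ ^ j) hn hi hi2 hq (j := j) hj
  obtain ⟨a, rfl⟩ : ∃ a, i = a + 2 := ⟨i - 2, by omega⟩
  simp only [fluxM, show ¬ a + 2 = 0 by omega, show ¬ a + 2 = 1 by omega,
      show a + 2 - 1 = a + 1 by omega, show a + 2 - 2 = a by omega, if_false, mul_zero, sub_zero]
  set E := step n * (1 / 2 : ℝ) ^ (n - 1 - (a + 2)) with hE
  split_ifs with h3 h4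
  · have h0 := abs_le.1 (hfar (by omega) a (by omega))
    have h1 := abs_le.1 (hfar (by omega) (a + 1) (by omega))
    have h2 := abs_le.1 (hfar (by omega) (a + 2) (by omega))
    have h3 := abs_le.1 (hfar (by omega) (a + 2 + 1) (by omega))
    rw [abs_le]
    constructor <;> linarith
  · have h0 := abs_le.1 (hfar (by omega) a (by omega))
    have h1 := abs_le.1 (hfar (by omega) (a + 1) (by omega))
    have h2 := abs_le.1 (hfar (by omega) (a + 2) (by omega))
    rw [abs_le]
    constructor <;> linarith
  · refine le_of_eq_of_le (abs_eq_zero.2 ?_) (by positivity)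
    linear_combination c * κ ^ a * (κ - 1) / 6 * hκ

/-- The value `q 0` enters only the first two rows of `D_p`, so it can be prescribed; the remaining
values are a multiple of the decaying mode `μ ^ j`. The clause on `q 1` makes the layer visible to
`e₁ - e₂`, which the lower bound needs. -/
lemma exists_layerP (z γ : ℝ) : ∃ (q : ℕ → ℝ) (K : ℝ), q 0 = z ∧ (γ = 0 → z ≠ 0 → q 1 ≠ q 0) ∧
    (∀ j, |q j| ≤ K * (1 / 2) ^ j) ∧ ∀ n, 4 ≤ n → ∀ i, i < n →
      |fluxP n q i - ((-γ - z) * (if i = 0 then 1 else 0) + γ * (if i = 1 then 1 else 0))| ≤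
        K * (step n * (1 / 2) ^ (n - 1 - i)) := by
  obtain ⟨κ, hκ0, hκ1, hκ⟩ := exists_layer_root
  set μ := -2 * κ with hμ
  have hμ2 : μ ^ 2 = 5 * μ + 2 := by rw [hμ]; linear_combination 2 * hκ
  have h4 : μ + 4 ≠ 0 := by linarith
  set c := (12 * γ + 5 * z) / (μ + 4) with hc
  have hcγ : c * (μ + 4) = 12 * γ + 5 * z := by rw [hc]; field_simp
  set q : ℕ → ℝ := fun j => if j = 0 then z else c * μ ^ j with hqdef
  have hq0 : q 0 = z := by simp [hqdef]
  have hqs : ∀ j, q (j + 1) = c * μ ^ (j + 1) := fun j => by simp [hqdef]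
  have hq : ∀ j, |q j| ≤ (|c| + |z|) * (1 / 2) ^ j := by
    rintro (_ | j)
    · simp [hq0]
    · rw [hqs, abs_mul, abs_pow]
      gcongr
      · linarith [abs_nonneg z]
      · rw [hμ, abs_of_neg] <;> linarith
  have hK : 0 ≤ |c| + |z| := by positivity
  refine ⟨q, 96 * (|c| + |z|), hq0, ?_, fun j => (hq j).trans ?_, ?_⟩
  · intro h0 hz hne
    rw [hqs 0, hq0] at hne
    have h1 : z * (4 * (μ - 1)) = 0 := by
      linear_combination (μ + 4) * hne - μ * hcγ - 12 * μ * h0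
    have h2 : 4 * (μ - 1) ≠ 0 := by apply ne_of_lt; linarith
    exact (mul_ne_zero hz h2) h1
  · gcongr; linarith
  intro n hn i hi
  have hs := step_pos hn
  have q1 := hqs 0
  have q2 := hqs 1
  have q3 := hqs 2
  norm_num at q1 q2 q3
  rcases Nat.lt_or_ge i 2 with h | h
  · have h0 : 0 ≤ 96 * (|c| + |z|) * (step n * (1 / 2) ^ (n - 1 - i)) := by positivity
    refine le_of_eq_of_le ?_ h0
    rw [abs_eq_zero]
    interval_cases i
    · simp [fluxP, q1, q2, hq0]; linear_combination -hcγ / 12 - c / 6 * hμ2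
    · simp [fluxP, q1, q2, q3, hq0]
      linear_combination hcγ / 12 - c / 6 * (μ - 1) * hμ2
  have hfar := fun (hi2 : n ≤ i + 2) j hj => far_row_bound hn hi hi2 hq (j := j) hj
  obtain ⟨a, rfl⟩ : ∃ a, i = a + 2 := ⟨i - 2, by omega⟩
  simp only [fluxP, show ¬ a + 2 = 0 by omega, show ¬ a + 2 = 1 by omega,
      show a + 2 - 1 = a + 1 by omega, if_false, mul_zero, sub_zero, add_zero]
  set E := step n * (1 / 2 : ℝ) ^ (n - 1 - (a + 2)) with hE
  split_ifs with h3 h4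
  · have h1 := abs_le.1 (hfar (by omega) (a + 1) (by omega))
    have h2 := abs_le.1 (hfar (by omega) (a + 2) (by omega))
    have h3 := abs_le.1 (hfar (by omega) (a + 2 + 1) (by omega))
    have hE0 : 0 ≤ (|c| + |z|) * E := by positivity
    rw [abs_le]
    constructor <;> linarith
  · have h1 := abs_le.1 (hfar (by omega) (a + 1) (by omega))
    have h2 := abs_le.1 (hfar (by omega) (a + 2) (by omega))
    have hE0 : 0 ≤ (|c| + |z|) * E := by positivity
    rw [abs_le]
    constructor <;> linarith
  · refine le_of_eq_of_le (abs_eq_zero.2 ?_) (by positivity)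
    rw [hqs, hqs, hqs (a + 2), hqs (a + 3)]
    linear_combination -c * μ ^ (a + 1) * (μ - 1) / 6 * hμ2

/-! ### Constraints on the penalties from energy stability -/

lemma energyRate_reflect {n : ℕ} (hn : 4 ≤ n) (P : Params) (u v : Fin n → ℝ) :
    energyRate P.reflect n u v =
      energyRate P n (fun j => u j.rev) (fun j => -v j.rev) := by
  unfold energyRate
  rw [← Equiv.sum_comp Fin.revPerm]
  congr 1
  refine Finset.sum_congr rfl fun i _ => ?_
  rw [(rhs_reflect hn P u v i).1, (rhs_reflect hn P u v i).2]
  simp only [Fin.revPerm_apply, weight_rev]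
  ring

lemma EnergyStable.reflect {P : Params} (h : EnergyStable P) : EnergyStable P.reflect := by
  intro n hn u v
  rw [energyRate_reflect hn]
  exact h n hn _ _

/-- Test stability on four points with `u = v` a ramp: the left-going wave is absent, the right
penalty sees zero, and the energy rate is twice the left-hand side. In particular `τ₁ + τ₂ ≠ 0`. -/
lemma EnergyStable.penalty_left {P : Params} (h : EnergyStable P) :
    (1 + P.α₀) * (P.τ₁ + P.τ₂) + 1 ≤ 0 := by
  have hr := h 4 le_rfl (fun j => ramp 4 j) (fun j => ramp 4 j)
  have hrow := weight_mul_rhs_add le_rfl P 0 0 (fun j : Fin 4 => ramp 4 j) (fun j => ramp 4 j)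
  have hD : ∀ i, weight 4 i * (Dm 4 *ᵥ ((fun j : Fin 4 => ramp 4 j) + fun j : Fin 4 => ramp 4 j)) i =
      -2 * weight 4 i := by
    intro i
    have := fluxM_ramp le_rfl i
    rw [Matrix.mulVec_add, Pi.add_apply, mul_add, weight_mul_Dm le_rfl, this]
    ring
  simp only [hD, eFirst_dotProduct le_rfl, eLast_dotProduct le_rfl] at hrow
  have hr' : energyRate P 4 (fun j => ramp 4 j) (fun j => ramp 4 j) =
      2 * ∑ i : Fin 4, ramp 4 i * (weight 4 i *
        (rhsU P 4 0 0 (fun j => ramp 4 j) (fun j => ramp 4 j) i +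
          rhsV P 4 0 0 (fun j => ramp 4 j) (fun j => ramp 4 j) i)) := by
    unfold energyRate
    congr 1
    refine Finset.sum_congr rfl fun i _ => ?_
    ring
  rw [hr'] at hr
  simp only [hrow, Fin.sum_univ_four] at hr
  simp [ramp, eFirst, eLast, weight, step] at hr
  norm_num at hr
  linarith

lemma EnergyStable.penalty_right {P : Params} (h : EnergyStable P) :
    (1 - P.α₁) * (P.τ₃ - P.τ₄) + 1 ≤ 0 := h.reflect.penalty_left

/-! ### Boundary correctors -/

lemma half_pow_pred_le {n : ℕ} (hn : 4 ≤ n) : (1 / 2 : ℝ) ^ (n - 1) ≤ 2 * step n := by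
  have h : (1 / 2 : ℝ) ^ (n - 1) = 2 * (1 / 2) ^ n := by
    obtain ⟨m, rfl⟩ : ∃ m, n = m + 1 := ⟨n - 1, by omega⟩
    rw [Nat.add_sub_cancel, pow_succ]; ring
  linarith [half_pow_le_step hn]

lemma eLast_le {n : ℕ} (i : Fin n) : |eLast n i| ≤ (1 / 2) ^ (n - 1 - i.val) := by
  unfold eLast
  split_ifs with h
  · simp [show n - 1 - i.val = 0 by omega]
  · simp

set_option maxHeartbeats 800000 in
/-- A grid function which the homogeneous right-hand side maps, up to small terms, to given
multiples of the leading truncation error at the left boundary. -/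
lemma exists_corrector_left (P : Params) (hα : 0 ≤ P.α₀) (hσ : P.τ₁ + P.τ₂ ≠ 0) (ε : ℝ)
    (hε0 : 0 ≤ ε) (hε : P.α₀ * P.τ₁ + P.τ₂ + 1 ≠ 0 → 1 ≤ ε) (β γ : ℝ) :
    ∃ K, 0 ≤ K ∧ ∀ n, 4 ≤ n → ∃ u v : Fin n → ℝ, ∀ i,
      |u i| ≤ K * (edge n i + ε) ∧ |v i| ≤ K * (edge n i + ε) ∧
      |weight n i * (rhsU P n 0 0 u v i + rhsV P n 0 0 u v i) + β * patL n i| ≤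
        K * (step n * (edge n i + ε)) ∧
      |weight n i * (rhsU P n 0 0 u v i - rhsV P n 0 0 u v i) + γ * patL n i| ≤
        K * (step n * (edge n i + ε)) := by
  obtain ⟨qp, Kp, hqp, hqp'⟩ := exists_layerM β
  -- `D` is the value of `u₁ + α₀ v₁` on the corrector. The first row for `u + v` leaves `qp 0 + (τ₁
  -- + τ₂) D`, which has to vanish.
  set D := -qp 0 / (P.τ₁ + P.τ₂) with hD
  have hDσ : (P.τ₁ + P.τ₂) * D = -qp 0 := by rw [hD]; field_simp
  -- The amplitude of the linear profile is what makes `u₁ + α₀ v₁` equal to `D`. It vanishes under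
  -- the rate condition, so that `ε = 0` is admissible exactly when no profile is needed.
  set c := 2 * D * (P.α₀ * P.τ₁ + P.τ₂ + 1) / (1 + P.α₀) with hc
  have hcα : (1 + P.α₀) * c = 2 * D * (P.α₀ * P.τ₁ + P.τ₂ + 1) := by
    rw [hc]; field_simp
  have hcε : |c| ≤ |c| * ε := by
    by_cases h : P.α₀ * P.τ₁ + P.τ₂ + 1 = 0
    · simp [hc, h]
    · have := hε h
      nlinarith [abs_nonneg c]
  -- This first value cancels the penalty in the first row for `u - v`.
  obtain ⟨qm, Km, hqm0, -, hqm, hqm'⟩ := exists_layerP ((P.τ₁ - P.τ₂) * D) γ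
  have hKp : 0 ≤ Kp := by simpa using (abs_nonneg _).trans (hqp 0)
  have hKm : 0 ≤ Km := by simpa using (abs_nonneg _).trans (hqm 0)
  set K₁ := (1 + |P.α₁|) * (Kp + Km) * 2 with hK₁
  have hK₁0 : 0 ≤ K₁ := by positivity
  refine ⟨2 * |c| + Kp + Km + (|P.τ₃ + P.τ₄| + |P.τ₃ - P.τ₄|) * K₁, by positivity, ?_⟩
  intro n hn
  have hs := step_pos hn
  refine ⟨fun j => (c * ramp n j + qp j + qm j) / 2, fun j => (c * ramp n j + qp j - qm j) / 2, ?_⟩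
  intro i
  set b := (1 / 2 : ℝ) ^ i.val with hb
  set b' := (1 / 2 : ℝ) ^ (n - 1 - i.val) with hb'
  have hb0 : 0 ≤ b := by positivity
  have hb0' : 0 ≤ b' := by positivity
  have hedge : edge n i = b + b' := rfl
  have hadd := weight_mul_rhs_add hn P 0 0 (fun j : Fin n => (c * ramp n j + qp j + qm j) / 2)
    (fun j => (c * ramp n j + qp j - qm j) / 2) i
  have hsub := weight_mul_rhs_sub hn P 0 0 (fun j : Fin n => (c * ramp n j + qp j + qm j) / 2)
    (fun j => (c * ramp n j + qp j - qm j) / 2) i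
  have e1 : ((fun j : Fin n => (c * ramp n j + qp j + qm j) / 2) +
      fun j : Fin n => (c * ramp n j + qp j - qm j) / 2) = fun j : Fin n => c * ramp n j + qp j := by
    ext j; simp only [Pi.add_apply]; ring
  have e2 : ((fun j : Fin n => (c * ramp n j + qp j + qm j) / 2) -
      fun j : Fin n => (c * ramp n j + qp j - qm j) / 2) = fun j : Fin n => qm j := by
    ext j; simp only [Pi.sub_apply]; ring
  have f1 := eFirst_dotProduct hn (fun j => (c * ramp n j + qp j + qm j) / 2)
  have f2 := eFirst_dotProduct hn (fun j => (c * ramp n j + qp j - qm j) / 2)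
  have f3 := eLast_dotProduct hn (fun j => (c * ramp n j + qp j + qm j) / 2)
  have f4 := eLast_dotProduct hn (fun j => (c * ramp n j + qp j - qm j) / 2)
  rw [e1, f1, f2, f3, f4, weight_mul_Dm hn (fun j => c * ramp n j + qp j), fluxM_linear,
    fluxM_ramp hn] at hadd
  rw [e2, f1, f2, f3, f4, weight_mul_Dp hn qm] at hsub
  have hr0 : ramp n 0 = 1 := by simp [ramp]
  have hδ0 : (c * ramp n 0 + qp 0 + qm 0) / 2 + P.α₀ * ((c * ramp n 0 + qp 0 - qm 0) / 2) - 0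
      = D := by
    rw [hqm0, hr0]
    linear_combination hcα / 2 + (1 + P.α₀) / 2 * hDσ
  set δ := (c * ramp n (n - 1) + qp (n - 1) + qm (n - 1)) / 2 +
    P.α₁ * ((c * ramp n (n - 1) + qp (n - 1) - qm (n - 1)) / 2) - 0 with hδ
  rw [hδ0] at hadd hsub
  -- The right penalty sees only the exponentially small tails of the layers, since the ramp
  -- vanishes at the last point.
  have hδ1 : |δ| ≤ K₁ * step n := by
    have h1 := (hqp (n - 1)).trans (mul_le_mul_of_nonneg_left (half_pow_pred_le hn) hKp)
    have h2 := (hqm (n - 1)).trans (mul_le_mul_of_nonneg_left (half_pow_pred_le hn) hKm)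
    rw [hδ, ramp_last hn, mul_zero, zero_add, sub_zero]
    calc _ ≤ |(qp (n - 1) + qm (n - 1)) / 2| + |P.α₁| * |(qp (n - 1) - qm (n - 1)) / 2| := by
          rw [← abs_mul]; exact abs_add_le _ _
      _ ≤ (Kp + Km) * (2 * step n) + |P.α₁| * ((Kp + Km) * (2 * step n)) := by
          have h3 := abs_le.1 h1
          have h4 := abs_le.1 h2
          have h5 : 0 ≤ Kp * step n := by positivity
          have h6 : 0 ≤ Km * step n := by positivity
          gcongr <;>
          · rw [abs_le]; constructor <;> linarith
      _ = _ := by rw [hK₁]; ring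
  have hpen : ∀ τ : ℝ, |τ * δ * eLast n i| ≤ |τ| * K₁ * (step n * b') := by
    intro τ
    rw [abs_mul, abs_mul]
    calc |τ| * |δ| * |eLast n i| ≤ |τ| * (K₁ * step n) * b' := by
          gcongr; exact eLast_le i
      _ = _ := by ring
  have hwc : |c * weight n i| ≤ 2 * |c| * (step n * ε) := by
    have hw := weight_le hn i
    rw [abs_mul, abs_of_pos (weight_pos hn i)]
    calc |c| * weight n i ≤ (|c| * ε) * (2 * step n) := by
          have := weight_pos hn i
          gcongr
          linarith
      _ = _ := by ring
  have hrp := hqp' n hn i i.2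
  have hrm := hqm' n hn i i.2
  have hsb : 0 ≤ step n * b := by positivity
  have hsb' : 0 ≤ step n * b' := by positivity
  have hsε : 0 ≤ step n * ε := by positivity
  set τs := |P.τ₃ + P.τ₄| with hτs
  set τd := |P.τ₃ - P.τ₄| with hτd
  have hA : 0 ≤ τs * K₁ := by positivity
  have hB : 0 ≤ τd * K₁ := by positivity
  have hc0 := abs_nonneg c
  have hval : ∀ x, x = qm i ∨ x = -qm i → |(c * ramp n i + qp i + x) / 2| ≤
      (2 * |c| + Kp + Km + (τs + τd) * K₁) * (b + b' + ε) := by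
    intro x hx
    have hx : |x| ≤ Km * b := by
      rcases hx with rfl | rfl
      · exact hqm i
      · rw [abs_neg]; exact hqm i
    have hcr : |c * ramp n i| ≤ |c| * ε := by
      rw [abs_mul]
      calc |c| * |ramp n i| ≤ |c| * 1 := by gcongr; exact ramp_bound hn i.2
        _ ≤ _ := by simpa using hcε
    have h1 := abs_le.1 (hqp i)
    have h2 := abs_le.1 hx
    have h3 := abs_le.1 hcr
    have h4 : |(c * ramp n i + qp i + x) / 2| ≤ |c| * ε + Kp * b + Km * b := by
      have : 0 ≤ |c| * ε := by positivity
      have : 0 ≤ Kp * b := by positivity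
      have : 0 ≤ Km * b := by positivity
      rw [abs_le]; constructor <;> linarith
    refine h4.trans ?_
    have h5 : 0 ≤ |c| * ε := by positivity
    have h6 : 0 ≤ |c| * (b + b') := by positivity
    have h7 : 0 ≤ (Kp + Km) * (b' + ε) := by positivity
    have h8 : 0 ≤ (τs + τd) * K₁ * (b + b' + ε) := by positivity
    linarith
  refine ⟨hval _ (Or.inl rfl), ?_, ?_, ?_⟩
  · simpa only [sub_eq_add_neg, hedge] using hval _ (Or.inr rfl)
  · rw [hadd, hedge]
    have e : -(c * -weight n i + fluxM n qp i) + (P.τ₁ + P.τ₂) * D * eFirst n i +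
        (P.τ₃ + P.τ₄) * δ * eLast n i + β * patL n i = c * weight n i -
        (fluxM n qp i - ((β - qp 0) * (if (i : ℕ) = 0 then 1 else 0) -
          β * (if (i : ℕ) = 1 then 1 else 0))) + (P.τ₃ + P.τ₄) * δ * eLast n i := by
      rw [patL, eFirst]
      linear_combination (if (i : ℕ) = 0 then 1 else 0) * hDσ
    rw [e]
    refine (abs_add_le _ _).trans ((add_le_add (abs_sub _ _) le_rfl).trans
      ((add_le_add (add_le_add hwc hrp) (hpen _)).trans ?_))
    have h1 : 0 ≤ |c| * (step n * b + step n * b') := by positivity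
    have h2 : 0 ≤ Kp * (step n * b + step n * ε) := by positivity
    have h3 : 0 ≤ Km * (step n * b + step n * b' + step n * ε) := by positivity
    have h4 : 0 ≤ τs * K₁ * (step n * b + step n * ε) := by positivity
    have h5 : 0 ≤ τd * K₁ * (step n * b + step n * b' + step n * ε) := by positivity
    linarith
  · rw [hsub, hedge]
    have e : fluxP n qm i + (P.τ₁ - P.τ₂) * D * eFirst n i +
        (P.τ₃ - P.τ₄) * δ * eLast n i + γ * patL n i =
        (fluxP n qm i - ((-γ - (P.τ₁ - P.τ₂) * D) * (if (i : ℕ) = 0 then 1 else 0) +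
          γ * (if (i : ℕ) = 1 then 1 else 0))) + (P.τ₃ - P.τ₄) * δ * eLast n i := by
      rw [patL, eFirst]
      ring
    rw [e]
    refine (abs_add_le _ _).trans ((add_le_add hrm (hpen _)).trans ?_)
    have h1 : 0 ≤ |c| * (step n * b + step n * b' + step n * ε) := by positivity
    have h2 : 0 ≤ Kp * (step n * b + step n * b' + step n * ε) := by positivity
    have h3 : 0 ≤ Km * (step n * b + step n * ε) := by positivity
    have h4 : 0 ≤ τs * K₁ * (step n * b + step n * b' + step n * ε) := by positivity
    have h5 : 0 ≤ τd * K₁ * (step n * b + step n * ε) := by positivity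
    linarith

/-- The reflection exchanges the two components, hence the swapped arguments `γ β`. -/
lemma exists_corrector_right (P : Params) (hα : P.α₁ ≤ 0) (hσ : P.τ₃ - P.τ₄ ≠ 0) (ε : ℝ)
    (hε0 : 0 ≤ ε) (hε : P.α₁ * P.τ₃ + P.τ₄ - 1 ≠ 0 → 1 ≤ ε) (β γ : ℝ) :
    ∃ K, 0 ≤ K ∧ ∀ n, 4 ≤ n → ∃ u v : Fin n → ℝ, ∀ i,
      |u i| ≤ K * (edge n i + ε) ∧ |v i| ≤ K * (edge n i + ε) ∧
      |weight n i * (rhsU P n 0 0 u v i + rhsV P n 0 0 u v i) + β * patR n i| ≤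
        K * (step n * (edge n i + ε)) ∧
      |weight n i * (rhsU P n 0 0 u v i - rhsV P n 0 0 u v i) + γ * patR n i| ≤
        K * (step n * (edge n i + ε)) := by
  obtain ⟨K, hK, h⟩ := exists_corrector_left P.reflect (by simpa [Params.reflect] using hα)
    (by simpa [Params.reflect, ← sub_eq_add_neg] using hσ) ε hε0
    (by
      intro h
      refine hε fun h' => h ?_
      simp only [Params.reflect]
      linarith) γ β
  refine ⟨K, hK, fun n hn => ?_⟩
  obtain ⟨u, v, huv⟩ := h n hn
  refine ⟨fun j => u j.rev, fun j => -v j.rev, fun i => ?_⟩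
  obtain ⟨h1, h2, h3, h4⟩ := huv i.rev
  obtain ⟨r1, r2⟩ := rhs_reflect hn P u v i
  rw [r1, r2]
  rw [weight_rev, patL_rev] at h3 h4
  rw [edge_rev] at h1 h2 h3 h4
  refine ⟨h1, by simpa using h2, ?_, ?_⟩
  · simpa [sub_eq_add_neg] using h4
  · simpa [sub_eq_add_neg] using h3

/-! ### Energy estimate and discrete norms -/

/-- Grönwall's argument: by stability and Young's inequality the squared `H`-norm grows at most at
the rate `N + ρ`, with `ρ` bounding both the forcing and the initial value. -/
lemma EnergyStable.energy_estimate {P : Params} (hP : EnergyStable P) {n : ℕ} (hn : 4 ≤ n) {T : ℝ}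
    {du dv Ru Rv : ℝ → Fin n → ℝ} {s : Fin n → ℝ}
    (hdu : ∀ t ∈ Set.Icc 0 T,
      HasDerivWithinAt du (rhsU P n 0 0 (du t) (dv t) + Ru t) (Set.Icc 0 T) t)
    (hdv : ∀ t ∈ Set.Icc 0 T,
      HasDerivWithinAt dv (rhsV P n 0 0 (du t) (dv t) + Rv t) (Set.Icc 0 T) t)
    (hRu : ∀ t ∈ Set.Icc 0 T, ∀ i, |Ru t i| ≤ s i) (hRv : ∀ t ∈ Set.Icc 0 T, ∀ i, |Rv t i| ≤ s i)
    (h0u : ∀ i, |du 0 i| ≤ s i) (h0v : ∀ i, |dv 0 i| ≤ s i) :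
    ∀ t ∈ Set.Icc 0 T, step n * ∑ i, (du t i ^ 2 + dv t i ^ 2) ≤
      12 * Real.exp T * (step n * ∑ i, s i ^ 2) := by
  intro t ht
  have hT : 0 ≤ T := ht.1.trans ht.2
  set ρ := ∑ i, weight n i * (2 * s i ^ 2) with hρ
  have hρ0 : 0 ≤ ρ := Finset.sum_nonneg fun i _ => by have := weight_pos hn i; positivity
  set N : ℝ → ℝ := fun t => ∑ i, weight n i * (du t i ^ 2 + dv t i ^ 2) with hN
  have hsq : ∀ {x y : ℝ}, |x| ≤ y → x ^ 2 ≤ y ^ 2 := fun {x y} h => by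
    rw [← sq_abs]; gcongr
  have hNd : ∀ t ∈ Set.Icc 0 T, HasDerivWithinAt N
      (energyRate P n (du t) (dv t) +
        ∑ i, weight n i * (2 * du t i * Ru t i + 2 * dv t i * Rv t i)) (Set.Icc 0 T) t := by
    intro t ht
    have h1 := hasDerivWithinAt_pi.1 (hdu t ht)
    have h2 := hasDerivWithinAt_pi.1 (hdv t ht)
    have := HasDerivWithinAt.fun_sum (u := Finset.univ) fun i _ =>
      (((h1 i).fun_pow 2).fun_add ((h2 i).fun_pow 2)).const_mul (weight n i)
    refine this.congr_deriv ?_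
    rw [energyRate, Finset.mul_sum, ← Finset.sum_add_distrib]
    refine Finset.sum_congr rfl fun i _ => ?_
    simp only [Pi.add_apply]
    push_cast
    ring
  have hrate : ∀ t ∈ Set.Icc 0 T, energyRate P n (du t) (dv t) +
      ∑ i, weight n i * (2 * du t i * Ru t i + 2 * dv t i * Rv t i) ≤ N t + ρ := by
    intro t ht
    have h1 := hP n hn (du t) (dv t)
    have h2 : ∑ i, weight n i * (2 * du t i * Ru t i + 2 * dv t i * Rv t i) ≤ N t + ρ := by
      rw [hN, hρ]
      simp only
      rw [← Finset.sum_add_distrib]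
      refine Finset.sum_le_sum fun i _ => ?_
      rw [← mul_add]
      refine mul_le_mul_of_nonneg_left ?_ (weight_pos hn i).le
      have h3 := hsq (hRu t ht i)
      have h4 := hsq (hRv t ht i)
      nlinarith [sq_nonneg (du t i - Ru t i), sq_nonneg (dv t i - Rv t i)]
    linarith
  have hanti : AntitoneOn (fun t => Real.exp (-t) * (N t + ρ)) (Set.Icc 0 T) := by
    have hd : ∀ t ∈ Set.Icc 0 T, HasDerivWithinAt (fun t => Real.exp (-t) * (N t + ρ))
        (Real.exp (-t) * -1 * (N t + ρ) + Real.exp (-t) * (energyRate P n (du t) (dv t) +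
          ∑ i, weight n i * (2 * du t i * Ru t i + 2 * dv t i * Rv t i))) (Set.Icc 0 T) t :=
      fun t ht => ((hasDerivWithinAt_id t _).fun_neg.exp).fun_mul ((hNd t ht).add_const ρ)
    refine antitoneOn_of_hasDerivWithinAt_nonpos (convex_Icc 0 T)
      (fun t ht => (hd t ht).continuousWithinAt)
      (fun t ht => (hd t (interior_subset ht)).mono interior_subset) fun t ht => ?_
    have := hrate t (interior_subset ht)
    have he := Real.exp_pos (-t)
    nlinarith
  have hfin := hanti (Set.left_mem_Icc.2 hT) ht ht.1
  simp only [neg_zero, Real.exp_zero, one_mul] at hfin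
  have hN0 : N 0 ≤ ρ := by
    rw [hN, hρ]
    refine Finset.sum_le_sum fun i _ => mul_le_mul_of_nonneg_left ?_ (weight_pos hn i).le
    linarith [hsq (h0u i), hsq (h0v i)]
  have h1 : N t ≤ 2 * Real.exp T * ρ := by
    have h2 : N t + ρ ≤ Real.exp t * (2 * ρ) := by
      calc N t + ρ = Real.exp t * (Real.exp (-t) * (N t + ρ)) := by
            rw [← mul_assoc, ← Real.exp_add]; simp
        _ ≤ _ := mul_le_mul_of_nonneg_left (by linarith) (Real.exp_pos t).le
    have h3 : Real.exp t ≤ Real.exp T := Real.exp_le_exp.2 ht.2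
    nlinarith
  -- The constant `12` covers `2 · (13/6) / (5/12)`, from comparing `H` with `h` times the identity.
  have h2 : 5 / 12 * (step n * ∑ i, (du t i ^ 2 + dv t i ^ 2)) ≤ N t := by
    rw [← mul_assoc, Finset.mul_sum]
    refine Finset.sum_le_sum fun i _ => mul_le_mul_of_nonneg_right (weight_ge hn i) (by positivity)
  have h3 : ρ ≤ 13 / 6 * (step n * ∑ i, s i ^ 2) := by
    rw [hρ, ← mul_assoc, Finset.mul_sum]
    refine Finset.sum_le_sum fun i _ => ?_
    have := weight_le hn i
    nlinarith [sq_nonneg (s i)]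
  have hS : 0 ≤ step n * ∑ i, s i ^ 2 :=
    mul_nonneg (step_pos hn).le (Finset.sum_nonneg fun i _ => sq_nonneg _)
  have h4 : 2 * Real.exp T * ρ ≤ 2 * Real.exp T * (13 / 6 * (step n * ∑ i, s i ^ 2)) := by gcongr
  have h5 : 0 ≤ Real.exp T * (step n * ∑ i, s i ^ 2) := by positivity
  linarith

lemma sum_half_pow_le (n : ℕ) : ∑ i ∈ Finset.range n, (1 / 2 : ℝ) ^ i ≤ 2 := by
  have : ∑ i ∈ Finset.range n, (1 / 2 : ℝ) ^ i = 2 - 2 * (1 / 2) ^ n := by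
    induction n with
    | zero => simp
    | succ k ih => rw [Finset.sum_range_succ, ih, pow_succ]; ring
  rw [this]
  have : (0 : ℝ) < (1 / 2) ^ n := by positivity
  linarith

lemma sum_edge_sq_le (n : ℕ) : ∑ i : Fin n, edge n i ^ 2 ≤ 8 := by
  have h1 : ∀ k : ℕ, ((1 / 2 : ℝ) ^ k) ^ 2 ≤ (1 / 2) ^ k := fun k => by
    have h0 : (0 : ℝ) ≤ (1 / 2) ^ k := by positivity
    have h1 : (1 / 2 : ℝ) ^ k ≤ 1 := pow_le_one₀ (by norm_num) (by norm_num)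
    nlinarith
  have h2 : ∀ i, edge n i ^ 2 ≤ 2 * (1 / 2) ^ i + 2 * (1 / 2) ^ (n - 1 - i) := fun i => by
    unfold edge
    nlinarith [h1 i, h1 (n - 1 - i), sq_nonneg ((1 / 2 : ℝ) ^ i - (1 / 2) ^ (n - 1 - i))]
  rw [Fin.sum_univ_eq_sum_range (fun i => edge n i ^ 2)]
  refine (Finset.sum_le_sum fun i _ => h2 i).trans ?_
  rw [Finset.sum_add_distrib, ← Finset.mul_sum, ← Finset.mul_sum,
    Finset.sum_range_reflect (fun j => (1 / 2 : ℝ) ^ j)]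
  linarith [sum_half_pow_le n]

lemma natCast_mul_step_le {n : ℕ} (hn : 4 ≤ n) : n * step n ≤ 2 := by
  have h1 := step_mul hn
  have h2 := step_le hn
  linarith

/-- The origin of the extra half power: `edge` has a bounded sum of squares and so gains a factor
`h`, whereas `ε` is present at all `n ~ 1/h` points. -/
lemma step_mul_sum_sq_le {n : ℕ} (hn : 4 ≤ n) (K ε : ℝ) :
    step n * ∑ i : Fin n, (K * (step n ^ 2 * (edge n i + step n + ε))) ^ 2 ≤
      27 * K ^ 2 * step n ^ 4 * (step n + ε ^ 2) := by
  have hs := step_pos hn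
  have hs3 := step_le hn
  set h := step n with hh
  have h1 : ∀ i : Fin n, (K * (h ^ 2 * (edge n i + h + ε))) ^ 2 ≤
      K ^ 2 * h ^ 4 * (3 * edge n i ^ 2 + (3 * h ^ 2 + 3 * ε ^ 2)) := by
    intro i
    have : (K * (h ^ 2 * (edge n i + h + ε))) ^ 2 = K ^ 2 * h ^ 4 * (edge n i + h + ε) ^ 2 := by
      ring
    rw [this]
    gcongr
    nlinarith [sq_nonneg (edge n i - h), sq_nonneg (edge n i - ε), sq_nonneg (h - ε)]
  have h2 : ∑ i : Fin n, (K * (h ^ 2 * (edge n i + h + ε))) ^ 2 ≤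
      K ^ 2 * h ^ 4 * (24 + n * (3 * h ^ 2 + 3 * ε ^ 2)) := by
    refine (Finset.sum_le_sum fun i _ => h1 i).trans ?_
    rw [← Finset.mul_sum, Finset.sum_add_distrib, ← Finset.mul_sum, Finset.sum_const,
      Finset.card_univ, Fintype.card_fin, nsmul_eq_mul]
    gcongr
    linarith [sum_edge_sq_le n]
  have h3 : h * (24 + n * (3 * h ^ 2 + 3 * ε ^ 2)) ≤ 27 * (h + ε ^ 2) := by
    have := natCast_mul_step_le hn
    rw [← hh] at this
    have h4 : n * h * (3 * h ^ 2 + 3 * ε ^ 2) ≤ 2 * (3 * h ^ 2 + 3 * ε ^ 2) := by gcongr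
    nlinarith [sq_nonneg ε]
  calc _ ≤ h * (K ^ 2 * h ^ 4 * (24 + n * (3 * h ^ 2 + 3 * ε ^ 2))) := by gcongr
    _ = K ^ 2 * h ^ 4 * (h * (24 + n * (3 * h ^ 2 + 3 * ε ^ 2))) := by ring
    _ ≤ K ^ 2 * h ^ 4 * (27 * (h + ε ^ 2)) := by gcongr
    _ = _ := by ring

lemma errorNorm_le {T : ℝ} (hT : 0 ≤ T) {U V : ℝ → ℝ → ℝ} {n : ℕ} (hn : 4 ≤ n)
    {u v : ℝ → Fin n → ℝ} {B : ℝ}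
    (h : ∀ t ∈ Set.Icc 0 T,
      step n * ∑ j, ((U (node n j) t - u t j) ^ 2 + (V (node n j) t - v t j) ^ 2) ≤ B) :
    errorNorm T U V n u v ≤ √(B * T) := by
  refine Real.sqrt_le_sqrt ((le_abs_self _).trans ?_)
  have := intervalIntegral.norm_integral_le_of_norm_le_const (a := 0) (b := T) (C := B)
    (f := fun t => step n * ∑ j, ((U (node n j) t - u t j) ^ 2 + (V (node n j) t - v t j) ^ 2)) ?_
  · simpa [abs_of_nonneg hT] using this
  · intro t ht
    rw [Set.uIoc_of_le hT] at ht
    rw [Real.norm_of_nonneg]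
    · exact h t ⟨ht.1.le, ht.2⟩
    · exact mul_nonneg (step_pos hn).le (Finset.sum_nonneg fun i _ => by positivity)

/-! ### Taylor expansion and truncation error -/

/-- `F 0` is four times differentiable on `[a, b]`, with the derivatives `F 1, …, F 4`. -/
def HasJet (F : ℕ → ℝ → ℝ) (a b : ℝ) : Prop :=
  ∀ k < 4, ∀ x ∈ Set.Icc a b, HasDerivWithinAt (F k) (F (k + 1) x) (Set.Icc a b) x

/-- The mean value inequality between `y` and `x` raises the order by one; iterating it gives Taylor
bounds without the factorials. -/
lemma abs_le_of_hasDerivWithinAt {a b : ℝ} {G G' : ℝ → ℝ} {K : ℝ} (hK : 0 ≤ K) {k : ℕ} {x y : ℝ}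
    (hx : x ∈ Set.Icc a b) (hy : y ∈ Set.Icc a b)
    (hG : ∀ x ∈ Set.Icc a b, HasDerivWithinAt G (G' x) (Set.Icc a b) x) (hGy : G y = 0)
    (hG' : ∀ x ∈ Set.Icc a b, |G' x| ≤ K * |x - y| ^ k) : |G x| ≤ K * |x - y| ^ (k + 1) := by
  have hsub : Set.uIcc y x ⊆ Set.Icc a b := Set.uIcc_subset_Icc hy hx
  have := (convex_uIcc y x).norm_image_sub_le_of_norm_hasDerivWithin_le (f := G) (f' := G')
    (C := K * |x - y| ^ k) (fun z hz => (hG z (hsub hz)).mono hsub)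
    (fun z hz => (hG' z (hsub hz)).trans ?_) Set.left_mem_uIcc Set.right_mem_uIcc
  · rw [hGy, sub_zero, Real.norm_eq_abs, Real.norm_eq_abs] at this
    rw [pow_succ, ← mul_assoc]
    exact this
  · have := Set.abs_sub_left_of_mem_uIcc hz
    gcongr

lemma taylor_order_one {a b M : ℝ} (hM : 0 ≤ M) {f₀ f₁ f₂ : ℝ → ℝ}
    (h₀ : ∀ x ∈ Set.Icc a b, HasDerivWithinAt f₀ (f₁ x) (Set.Icc a b) x)
    (h₁ : ∀ x ∈ Set.Icc a b, HasDerivWithinAt f₁ (f₂ x) (Set.Icc a b) x)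
    (hb : ∀ x ∈ Set.Icc a b, |f₂ x| ≤ M) {x y : ℝ} (hx : x ∈ Set.Icc a b) (hy : y ∈ Set.Icc a b) :
    |f₀ x - f₀ y - f₁ y * (x - y)| ≤ M * |x - y| ^ 2 := by
  refine abs_le_of_hasDerivWithinAt (G := fun x => f₀ x - f₀ y - f₁ y * (x - y))
    (G' := fun x => f₁ x - f₁ y) hM hx hy (fun x hx => ?_) (by simp) (fun x hx => ?_)
  · refine (((h₀ x hx).sub_const _).fun_sub
      (((hasDerivWithinAt_id x _).sub_const y).const_mul (f₁ y))).congr_deriv ?_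
    ring
  · exact abs_le_of_hasDerivWithinAt (k := 0) (G := fun x => f₁ x - f₁ y) hM hx hy
      (fun x hx => (h₁ x hx).sub_const _) (by simp) (fun x hx => by simpa using hb x hx)

lemma taylor_order_two {a b M : ℝ} (hM : 0 ≤ M) {f₀ f₁ f₂ f₃ : ℝ → ℝ}
    (h₀ : ∀ x ∈ Set.Icc a b, HasDerivWithinAt f₀ (f₁ x) (Set.Icc a b) x)
    (h₁ : ∀ x ∈ Set.Icc a b, HasDerivWithinAt f₁ (f₂ x) (Set.Icc a b) x)
    (h₂ : ∀ x ∈ Set.Icc a b, HasDerivWithinAt f₂ (f₃ x) (Set.Icc a b) x)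
    (hb : ∀ x ∈ Set.Icc a b, |f₃ x| ≤ M) {x y : ℝ} (hx : x ∈ Set.Icc a b) (hy : y ∈ Set.Icc a b) :
    |f₀ x - f₀ y - f₁ y * (x - y) - f₂ y / 2 * (x - y) ^ 2| ≤ M * |x - y| ^ 3 := by
  refine abs_le_of_hasDerivWithinAt
    (G := fun x => f₀ x - f₀ y - f₁ y * (x - y) - f₂ y / 2 * (x - y) ^ 2)
    (G' := fun x => f₁ x - f₁ y - f₂ y * (x - y)) hM hx hy (fun x hx => ?_) (by simp)
    (fun x hx => taylor_order_one hM h₁ h₂ hb hx hy)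
  refine ((((h₀ x hx).sub_const _).fun_sub
    (((hasDerivWithinAt_id x _).sub_const y).const_mul (f₁ y))).fun_sub
    ((((hasDerivWithinAt_id x _).sub_const y).fun_pow 2).const_mul (f₂ y / 2))).congr_deriv ?_
  simp
  ring

lemma taylor_order_three {a b M : ℝ} (hM : 0 ≤ M) {f₀ f₁ f₂ f₃ f₄ : ℝ → ℝ}
    (h₀ : ∀ x ∈ Set.Icc a b, HasDerivWithinAt f₀ (f₁ x) (Set.Icc a b) x)
    (h₁ : ∀ x ∈ Set.Icc a b, HasDerivWithinAt f₁ (f₂ x) (Set.Icc a b) x)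
    (h₂ : ∀ x ∈ Set.Icc a b, HasDerivWithinAt f₂ (f₃ x) (Set.Icc a b) x)
    (h₃ : ∀ x ∈ Set.Icc a b, HasDerivWithinAt f₃ (f₄ x) (Set.Icc a b) x)
    (hb : ∀ x ∈ Set.Icc a b, |f₄ x| ≤ M) {x y : ℝ} (hx : x ∈ Set.Icc a b) (hy : y ∈ Set.Icc a b) :
    |f₀ x - f₀ y - f₁ y * (x - y) - f₂ y / 2 * (x - y) ^ 2 - f₃ y / 6 * (x - y) ^ 3| ≤
      M * |x - y| ^ 4 := by
  refine abs_le_of_hasDerivWithinAt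
    (G := fun x => f₀ x - f₀ y - f₁ y * (x - y) - f₂ y / 2 * (x - y) ^ 2 - f₃ y / 6 * (x - y) ^ 3)
    (G' := fun x => f₁ x - f₁ y - f₂ y * (x - y) - f₃ y / 2 * (x - y) ^ 2) hM hx hy
    (fun x hx => ?_) (by simp) (fun x hx => taylor_order_two hM h₁ h₂ h₃ hb hx hy)
  refine (((((h₀ x hx).sub_const _).fun_sub
    (((hasDerivWithinAt_id x _).sub_const y).const_mul (f₁ y))).fun_sub
    ((((hasDerivWithinAt_id x _).sub_const y).fun_pow 2).const_mul (f₂ y / 2))).fun_sub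
    ((((hasDerivWithinAt_id x _).sub_const y).fun_pow 3).const_mul (f₃ y / 6))).congr_deriv ?_
  simp
  ring

/-- The truncation error of `D_m`, up to terms of higher order. -/
lemma truncation_error {F : ℕ → ℝ → ℝ} {a b M : ℝ} (hF : HasJet F a b)
    (h3 : ∀ x ∈ Set.Icc a b, |F 3 x| ≤ M) (h4 : ∀ x ∈ Set.Icc a b, |F 4 x| ≤ M)
    {y : ℝ} (hy : y ∈ Set.Icc a b) (hy1 : y + 1 ∈ Set.Icc a b) {n : ℕ} (hn : 4 ≤ n) (i : Fin n) :
    |fluxM n (fun j => F 0 (y + j * step n)) i - weight n i * F 1 (y + i * step n) -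
      step n ^ 2 / 24 * (5 * F 2 y * patL n i - F 2 (y + 1) * patR n i)| ≤
      40 * M * (step n ^ 3 * (edge n i + step n)) := by
  have hM : 0 ≤ M := (abs_nonneg _).trans (h3 y hy)
  have hs := step_pos hn
  have hsm := step_mul hn
  set h := step n with hh
  have hz : ∀ j : ℕ, j < n → y + j * h ∈ Set.Icc a b := by
    intro j hj
    have h1 : (j : ℝ) + 1 ≤ n := by exact_mod_cast hj
    have h2 : (j : ℝ) * h ≤ 1 := by rw [← hsm]; gcongr; linarith
    have h3 : 0 ≤ (j : ℝ) * h := by positivity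
    exact ⟨by linarith [hy.1], by linarith [hy1.2]⟩
  have T2 : ∀ (j k : ℕ) (e : ℝ), j < n → k < n → (j : ℝ) = k + e →
      |F 0 (y + j * h) - F 0 (y + k * h) - F 1 (y + k * h) * (e * h) -
        F 2 (y + k * h) / 2 * (e * h) ^ 2| ≤ |e| ^ 3 * (M * h ^ 3) := by
    intro j k e hj hk hjk
    have := taylor_order_two hM (hF 0 (by norm_num)) (hF 1 (by norm_num)) (hF 2 (by norm_num)) h3
      (hz j hj) (hz k hk)
    rw [show y + j * h - (y + k * h) = e * h by rw [hjk]; ring, abs_mul, abs_of_pos hs] at this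
    refine this.trans_eq ?_
    ring
  have T1 : ∀ (j k : ℕ) (e : ℝ), j < n → k < n → (j : ℝ) = k + e →
      |F 1 (y + j * h) - F 1 (y + k * h) - F 2 (y + k * h) * (e * h)| ≤ |e| ^ 2 * (M * h ^ 2) := by
    intro j k e hj hk hjk
    have := taylor_order_one hM (hF 1 (by norm_num)) (hF 2 (by norm_num)) h3
      (hz j hj) (hz k hk)
    rw [show y + j * h - (y + k * h) = e * h by rw [hjk]; ring, abs_mul, abs_of_pos hs] at this
    refine this.trans_eq ?_
    ring
  have T3 : ∀ (j k : ℕ) (e : ℝ), j < n → k < n → (j : ℝ) = k + e →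
      |F 0 (y + j * h) - F 0 (y + k * h) - F 1 (y + k * h) * (e * h) -
        F 2 (y + k * h) / 2 * (e * h) ^ 2 - F 3 (y + k * h) / 6 * (e * h) ^ 3| ≤
        |e| ^ 4 * (M * h ^ 4) := by
    intro j k e hj hk hjk
    have := taylor_order_three hM (hF 0 (by norm_num)) (hF 1 (by norm_num)) (hF 2 (by norm_num))
      (hF 3 (by norm_num)) h4 (hz j hj) (hz k hk)
    rw [show y + j * h - (y + k * h) = e * h by rw [hjk]; ring, abs_mul, abs_of_pos hs] at this
    refine this.trans_eq ?_
    ring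
  obtain ⟨i, hi⟩ := i
  have hlast : ((n - 1 : ℕ) : ℝ) * h = 1 := by
    rw [Nat.cast_sub (by omega)]; push_cast; exact hsm
  have hMh3 : 0 ≤ M * h ^ 3 := by positivity
  have hMh4 : 0 ≤ M * h ^ 4 := by positivity
  have hbd : (1 / 2 ≤ edge n i) → 20 * (M * h ^ 3) ≤ 40 * M * (h ^ 3 * (edge n i + h)) := by
    intro he
    have : 40 * M * (h ^ 3 * (1 / 2)) ≤ 40 * M * (h ^ 3 * (edge n i + h)) := by
      gcongr; linarith
    linarith
  have hpos : ∀ k : ℕ, (0 : ℝ) < (1 / 2) ^ k := fun k => by positivity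
  rcases Nat.lt_or_ge i 2 with hi2 | hi2
  -- Closure rows: expand to second order about the end point. The `O(h³)` remainder is admissible
  -- because `edge ≥ 1/2` there.
  · refine le_trans ?_ (hbd ?_)
    · interval_cases i
      · have a1 := abs_le.1 (T2 1 0 1 (by omega) hi (by simp))
        simp [fluxM, weight, patL, patR, eFirst, eLast, show ¬ 1 = n by omega,
          show ¬ 2 = n by omega] at a1 ⊢
        rw [abs_le, ← hh]
        constructor <;> linarith
      · have a1 := abs_le.1 (T2 1 0 1 (by omega) (by omega) (by simp))
        have a2 := abs_le.1 (T2 2 0 2 (by omega) (by omega) (by simp))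
        have a3 := abs_le.1 (T1 1 0 1 (by omega) (by omega) (by simp))
        have b1 := mul_le_mul_of_nonneg_left a3.1 hs.le
        have b2 := mul_le_mul_of_nonneg_left a3.2 hs.le
        simp [fluxM, weight, patL, patR, eFirst, eLast, show ¬ 2 = n by omega,
          show ¬ 3 = n by omega] at a1 a2 b1 b2 ⊢
        rw [abs_le, ← hh]
        constructor <;> linarith
    · interval_cases i <;> simp [edge]
      · linarith [inv_pos.2 (pow_pos (two_pos (α := ℝ)) (n - 1))]
  · obtain ⟨k, rfl⟩ : ∃ k, i = k + 2 := ⟨i - 2, by omega⟩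
    by_cases hc : n ≤ k + 4
    · refine le_trans ?_ (hbd ?_)
      · rcases (show n = k + 4 ∨ n = k + 3 by omega) with rfl | rfl
        · have a0 := abs_le.1 (T2 k (k + 3) (-3) (by omega) (by omega) (by push_cast; ring))
          have a1 := abs_le.1 (T2 (k + 1) (k + 3) (-2) (by omega) (by omega) (by push_cast; ring))
          have a2 := abs_le.1 (T2 (k + 2) (k + 3) (-1) (by omega) (by omega) (by push_cast; ring))
          have a3 := abs_le.1 (T1 (k + 2) (k + 3) (-1) (by omega) (by omega) (by push_cast; ring))
          have b1 := mul_le_mul_of_nonneg_left a3.1 hs.le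
          have b2 := mul_le_mul_of_nonneg_left a3.2 hs.le
          have hw : y + 1 = y + ((k : ℝ) + 3) * h := by rw [← hlast]; push_cast; ring
          simp [fluxM, weight, patL, patR, eFirst, eLast, show k + 2 - 1 = k + 1 by omega]
          rw [← hh, hw]
          rw [show (k : ℝ) + 2 + 1 = k + 3 by ring]
          norm_num at a0 a1 a2 b1 b2 ⊢
          rw [abs_le]
          constructor <;> linarith
        · have a0 := abs_le.1 (T2 k (k + 2) (-2) (by omega) (by omega) (by push_cast; ring))
          have a1 := abs_le.1 (T2 (k + 1) (k + 2) (-1) (by omega) (by omega) (by push_cast; ring))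
          have hw : y + 1 = y + ((k : ℝ) + 2) * h := by rw [← hlast]; push_cast; ring
          simp [fluxM, weight, patL, patR, eFirst, eLast, show k + 2 - 1 = k + 1 by omega]
          rw [← hh, hw]
          norm_num at a0 a1 ⊢
          rw [abs_le]
          constructor <;> linarith
      · rcases (show n = k + 4 ∨ n = k + 3 by omega) with rfl | rfl
        · have := hpos (k + 2)
          simp only [edge, show k + 4 - 1 - (k + 2) = 1 by omega]
          linarith
        · have := hpos (k + 2)
          simp only [edge, show k + 3 - 1 - (k + 2) = 0 by omega]
          linarith
    -- Interior rows: the second and third moments of the stencil vanish, which leaves `O(h⁴)`.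
    · have a0 := abs_le.1 (T3 k (k + 2) (-2) (by omega) (by omega) (by push_cast; ring))
      have a1 := abs_le.1 (T3 (k + 1) (k + 2) (-1) (by omega) (by omega) (by push_cast; ring))
      have a2 := abs_le.1 (T3 (k + 3) (k + 2) 1 (by omega) (by omega) (by push_cast; ring))
      have he : 40 * (M * h ^ 4) ≤ 40 * M * (h ^ 3 * (edge n (k + 2) + h)) := by
        have := edge_pos n (k + 2)
        have : 0 ≤ M * h ^ 3 * edge n (k + 2) := by positivity
        linarith
      refine le_trans ?_ he
      simp [fluxM, weight, patL, patR, eFirst, eLast, show ¬ k + 2 + 1 = n by omega,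
        show ¬ k + 4 = n by omega, show k + 2 - 1 = k + 1 by omega, add_assoc]
      rw [← hh]
      norm_num at a0 a1 a2 ⊢
      rw [abs_le]
      constructor <;> linarith

/-! ### Travelling waves and the error equation -/

lemma exists_hasJet {f : ℝ → ℝ} {a b : ℝ} (hab : a < b)
    (hf : ContDiffOn ℝ ((4 : ℕ) : WithTop ℕ∞) f (Set.Icc a b)) :
    ∃ F : ℕ → ℝ → ℝ, F 0 = f ∧ HasJet F a b ∧ ∃ M, ∀ k ≤ 4, ∀ x ∈ Set.Icc a b, |F k x| ≤ M := by
  have hu := uniqueDiffOn_Icc hab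
  refine ⟨fun k => iteratedDerivWithin k f (Set.Icc a b), iteratedDerivWithin_zero, ?_, ?_⟩
  · intro k hk x hx
    have := (hf.differentiableOn_iteratedDerivWithin (m := k) (by exact_mod_cast hk) hu x
      hx).hasDerivWithinAt
    rwa [← iteratedDerivWithin_succ] at this
  · have hb : ∀ k ≤ 4, ∃ M, ∀ x ∈ Set.Icc a b, |iteratedDerivWithin k f (Set.Icc a b) x| ≤ M := by
      intro k hk
      exact isCompact_Icc.exists_bound_of_continuousOn
        (hf.continuousOn_iteratedDerivWithin (m := k) (by exact_mod_cast hk) hu)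
    choose! M hM using hb
    refine ⟨∑ k ∈ Finset.range 5, |M k|, fun k hk x hx => (hM k hk x hx).trans ?_⟩
    exact (le_abs_self _).trans (Finset.single_le_sum (f := fun k => |M k|)
      (fun i _ => abs_nonneg _) (Finset.mem_range.2 (by omega)))

/-- Constancy along characteristics: the segment from `p` to `q` stays in the convex set and is
parallel to `w`. -/
lemma eq_of_fderivWithin_eq_zero {E : Type*} [NormedAddCommGroup E] [NormedSpace ℝ E]
    {F : E → ℝ} {S : Set E} (hS : Convex ℝ S) (hF : DifferentiableOn ℝ F S) {w : E}
    (hw : ∀ p ∈ S, fderivWithin ℝ F S p w = 0) {p q : E} (hp : p ∈ S) (hq : q ∈ S) {r : ℝ}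
    (hr : q - p = r • w) : F p = F q := by
  have hmaps : Set.MapsTo (fun τ : ℝ => p + τ • (q - p)) (Set.Icc 0 1) S := fun τ hτ =>
    hS.add_smul_sub_mem hp hq hτ
  have hd : ∀ τ ∈ Set.Icc (0 : ℝ) 1,
      HasDerivWithinAt (fun τ : ℝ => F (p + τ • (q - p))) 0 (Set.Icc 0 1) τ := by
    intro τ hτ
    have h1 : HasDerivWithinAt (fun τ : ℝ => p + τ • (q - p)) (q - p) (Set.Icc 0 1) τ := by
      simpa using ((hasDerivWithinAt_id τ (Set.Icc 0 1)).smul_const (q - p)).const_add p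
    have h2 := (hF _ (hmaps hτ)).hasFDerivWithinAt.comp_hasDerivWithinAt τ h1 hmaps
    have h3 : fderivWithin ℝ F S (p + τ • (q - p)) (q - p) = 0 := by
      rw [hr, map_smul, ← hr, hw _ (hmaps hτ), smul_zero]
    rw [h3] at h2
    exact h2
  have := (convex_Icc (0 : ℝ) 1).norm_image_sub_le_of_norm_hasDerivWithin_le (C := 0) hd
    (fun _ _ => by simp) (Set.left_mem_Icc.2 zero_le_one) (Set.right_mem_Icc.2 zero_le_one)
  simp only [zero_smul, one_smul, add_zero, add_sub_cancel, zero_mul, norm_le_zero_iff] at this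
  exact (sub_eq_zero.1 this).symm

lemma derivWithin_fst {F : ℝ × ℝ → ℝ} {a b c d : ℝ} (hab : a < b)
    (hF : DifferentiableOn ℝ F (Set.Icc a b ×ˢ Set.Icc c d)) {x t : ℝ} (hx : x ∈ Set.Icc a b)
    (ht : t ∈ Set.Icc c d) : derivWithin (fun y => F (y, t)) (Set.Icc a b) x =
      fderivWithin ℝ F (Set.Icc a b ×ˢ Set.Icc c d) (x, t) (1, 0) := by
  have h1 : HasDerivWithinAt (fun y : ℝ => (y, t)) (1, 0) (Set.Icc a b) x :=
    (hasDerivWithinAt_id x _).prodMk (hasDerivWithinAt_const x _ t)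
  have h2 := (hF (x, t) ⟨hx, ht⟩).hasFDerivWithinAt.comp_hasDerivWithinAt x h1
    (fun y hy => Set.mk_mem_prod hy ht)
  exact h2.derivWithin (uniqueDiffOn_Icc hab x hx)

lemma derivWithin_snd {F : ℝ × ℝ → ℝ} {a b c d : ℝ} (hcd : c < d)
    (hF : DifferentiableOn ℝ F (Set.Icc a b ×ˢ Set.Icc c d)) {x t : ℝ} (hx : x ∈ Set.Icc a b)
    (ht : t ∈ Set.Icc c d) : derivWithin (fun s => F (x, s)) (Set.Icc c d) t =
      fderivWithin ℝ F (Set.Icc a b ×ˢ Set.Icc c d) (x, t) (0, 1) := by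
  have h1 : HasDerivWithinAt (fun s : ℝ => (x, s)) (0, 1) (Set.Icc c d) t :=
    (hasDerivWithinAt_const t _ x).prodMk (hasDerivWithinAt_id t _)
  have h2 := (hF (x, t) ⟨hx, ht⟩).hasFDerivWithinAt.comp_hasDerivWithinAt t h1
    (fun y hy => Set.mk_mem_prod hx hy)
  exact h2.derivWithin (uniqueDiffOn_Icc hcd t ht)

/-- The solution of the boundary value problem is a superposition of two travelling waves. -/
lemma IsExactSolution.exists_waves {P : Params} {T : ℝ} (hT : 0 < T) {g₁ gₙ : ℝ → ℝ}
    {U V : ℝ → ℝ → ℝ} (h : IsExactSolution P T (4 : ℕ) g₁ gₙ U V) :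
    ∃ (F G : ℕ → ℝ → ℝ) (M : ℝ), HasJet F (-T) 1 ∧ HasJet G (-T) 1 ∧
      (∀ k ≤ 4, ∀ x ∈ Set.Icc (-T) 1, |F k x| ≤ M) ∧
      (∀ k ≤ 4, ∀ x ∈ Set.Icc (-T) 1, |G k x| ≤ M) ∧
      ∀ x ∈ Set.Icc (0 : ℝ) 1, ∀ t ∈ Set.Icc (0 : ℝ) T,
        U x t = (F 0 (x - t) + G 0 (1 - x - t)) / 2 ∧
        V x t = (F 0 (x - t) - G 0 (1 - x - t)) / 2 := by
  set S := Set.Icc (0 : ℝ) 1 ×ˢ Set.Icc (0 : ℝ) T with hS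
  have hSc : Convex ℝ S := (convex_Icc _ _).prod (convex_Icc _ _)
  have hSu : UniqueDiffOn ℝ S := (uniqueDiffOn_Icc zero_lt_one).prod (uniqueDiffOn_Icc hT)
  set u : ℝ × ℝ → ℝ := fun p => U p.1 p.2 with hu
  set v : ℝ × ℝ → ℝ := fun p => V p.1 p.2 with hv
  have hud : DifferentiableOn ℝ u S := h.smooth_U.differentiableOn (by norm_num)
  have hvd : DifferentiableOn ℝ v S := h.smooth_V.differentiableOn (by norm_num)
  have e1 : ∀ p ∈ S, fderivWithin ℝ u S p (0, 1) + fderivWithin ℝ v S p (1, 0) = 0 := by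
    rintro ⟨x, t⟩ ⟨hx, ht⟩
    rw [hS, ← derivWithin_fst zero_lt_one hvd hx ht, ← derivWithin_snd hT hud hx ht]
    exact h.eq_U x hx t ht
  have e2 : ∀ p ∈ S, fderivWithin ℝ v S p (0, 1) + fderivWithin ℝ u S p (1, 0) = 0 := by
    rintro ⟨x, t⟩ ⟨hx, ht⟩
    rw [hS, ← derivWithin_fst zero_lt_one hud hx ht, ← derivWithin_snd hT hvd hx ht]
    exact h.eq_V x hx t ht
  have hP : ∀ p ∈ S, fderivWithin ℝ (u + v) S p (1, 1) = 0 := by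
    intro p hp
    rw [fderivWithin_add (hSu p hp) (hud p hp) (hvd p hp),
      show ((1 : ℝ), (1 : ℝ)) = (1, 0) + (0, 1) by simp, map_add,
      add_apply, add_apply]
    linarith [e1 p hp, e2 p hp]
  have hM : ∀ p ∈ S, fderivWithin ℝ (u - v) S p (-1, 1) = 0 := by
    intro p hp
    rw [fderivWithin_sub (hSu p hp) (hud p hp) (hvd p hp),
      show ((-1 : ℝ), (1 : ℝ)) = -(1, 0) + (0, 1) by simp, map_add, map_neg,
      sub_apply, sub_apply]
    linarith [e1 p hp, e2 p hp]
  -- `s ↦ (X s, Y s)` runs along the diagonal from `(0, T)` to `(1, 0)` and meets each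
  -- characteristic `x - t = s` once. Reading the wave off this one segment makes it smooth, with no
  -- matching of initial and boundary data.
  set X : ℝ → ℝ := fun s => (s + T) / (1 + T) with hX
  set Y : ℝ → ℝ := fun s => (1 - s) * T / (1 + T) with hY
  have hXY : ∀ s, X s - Y s = s := fun s => by
    simp only [hX, hY]
    field_simp
    ring
  have hXm : ∀ s ∈ Set.Icc (-T) 1, X s ∈ Set.Icc (0 : ℝ) 1 := by
    intro s hs
    refine ⟨div_nonneg (by linarith [hs.1]) (by linarith), ?_⟩
    rw [hX, div_le_one (by linarith)]
    linarith [hs.2]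
  have hYm : ∀ s ∈ Set.Icc (-T) 1, Y s ∈ Set.Icc (0 : ℝ) T := by
    intro s hs
    refine ⟨div_nonneg (mul_nonneg (by linarith [hs.2]) hT.le) (by linarith), ?_⟩
    rw [hY, div_le_iff₀ (by linarith)]
    nlinarith [hs.1]
  have hXs : ContDiff ℝ ((4 : ℕ) : WithTop ℕ∞) X := by
    simp only [hX]; fun_prop
  have hYs : ContDiff ℝ ((4 : ℕ) : WithTop ℕ∞) Y := by
    simp only [hY]; fun_prop
  have hF := exists_hasJet (f := fun s => (u + v) (X s, Y s)) (show -T < 1 by linarith)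
    ((h.smooth_U.add h.smooth_V).comp (hXs.prodMk hYs).contDiffOn
      fun s hs => ⟨hXm s hs, hYm s hs⟩)
  have hX1 : ∀ s ∈ Set.Icc (-T) 1, 1 - X s ∈ Set.Icc (0 : ℝ) 1 := fun s hs => by
    have := hXm s hs
    exact ⟨by linarith [this.2], by linarith [this.1]⟩
  -- The other diagonal, for the characteristics `1 - x - t = s`.
  have hG := exists_hasJet (f := fun s => (u - v) (1 - X s, Y s)) (show -T < 1 by linarith)
    ((h.smooth_U.sub h.smooth_V).comp ((contDiff_const.sub hXs).prodMk hYs).contDiffOn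
      fun s hs => ⟨hX1 s hs, hYm s hs⟩)
  obtain ⟨F, hF0, hFj, M, hFM⟩ := hF
  obtain ⟨G, hG0, hGj, M', hGM⟩ := hG
  refine ⟨F, G, max M M', hFj, hGj, fun k hk x hx => (hFM k hk x hx).trans (le_max_left _ _),
    fun k hk x hx => (hGM k hk x hx).trans (le_max_right _ _), ?_⟩
  intro x hx t ht
  have hs1 : x - t ∈ Set.Icc (-T) 1 := ⟨by linarith [hx.1, ht.2], by linarith [hx.2, ht.1]⟩
  have hs2 : 1 - x - t ∈ Set.Icc (-T) 1 := ⟨by linarith [hx.2, ht.2], by linarith [hx.1, ht.1]⟩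
  have h1 : U x t + V x t = F 0 (x - t) := by
    rw [hF0]
    refine eq_of_fderivWithin_eq_zero (F := u + v) hSc (hud.add hvd) hP (p := (x, t))
      (q := (X (x - t), Y (x - t))) ⟨hx, ht⟩ ⟨hXm _ hs1, hYm _ hs1⟩ (r := X (x - t) - x) ?_
    have := hXY (x - t)
    ext
    · simp
    · simp; linarith
  have h2 : U x t - V x t = G 0 (1 - x - t) := by
    rw [hG0]
    refine eq_of_fderivWithin_eq_zero (F := u - v) hSc (hud.sub hvd) hM (p := (x, t))
      (q := (1 - X (1 - x - t), Y (1 - x - t))) ⟨hx, ht⟩ ⟨hX1 _ hs2, hYm _ hs2⟩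
      (r := Y (1 - x - t) - t) ?_
    have := hXY (1 - x - t)
    ext
    · simp; linarith
    · simp
  constructor <;> linarith

/-- The equation for the error of the semidiscrete solution: the forcing is the truncation error. -/
lemma IsSemidiscreteSolution.error_equation {P : Params} {T : ℝ} {g₁ gₙ : ℝ → ℝ}
    {U V : ℝ → ℝ → ℝ} (hbl : ∀ t ∈ Set.Icc (0 : ℝ) T, U 0 t + P.α₀ * V 0 t = g₁ t)
    (hbr : ∀ t ∈ Set.Icc (0 : ℝ) T, U 1 t + P.α₁ * V 1 t = gₙ t)
    {F G : ℕ → ℝ → ℝ} {M : ℝ} (hF : HasJet F (-T) 1) (hG : HasJet G (-T) 1)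
    (hF3 : ∀ x ∈ Set.Icc (-T) 1, |F 3 x| ≤ M) (hF4 : ∀ x ∈ Set.Icc (-T) 1, |F 4 x| ≤ M)
    (hG3 : ∀ x ∈ Set.Icc (-T) 1, |G 3 x| ≤ M) (hG4 : ∀ x ∈ Set.Icc (-T) 1, |G 4 x| ≤ M)
    (hUV : ∀ x ∈ Set.Icc (0 : ℝ) 1, ∀ t ∈ Set.Icc (0 : ℝ) T,
        U x t = (F 0 (x - t) + G 0 (1 - x - t)) / 2 ∧
        V x t = (F 0 (x - t) - G 0 (1 - x - t)) / 2)
    {n : ℕ} (hn : 4 ≤ n) {u v : ℝ → Fin n → ℝ} (h : IsSemidiscreteSolution P T g₁ gₙ U V n u v) :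
    ∃ FU FV : ℝ → Fin n → ℝ, ∀ t ∈ Set.Icc (0 : ℝ) T,
      HasDerivWithinAt (fun t j => U (node n j) t - u t j)
        (rhsU P n 0 0 (fun j => U (node n j) t - u t j) (fun j => V (node n j) t - v t j) + FU t)
        (Set.Icc 0 T) t ∧
      HasDerivWithinAt (fun t j => V (node n j) t - v t j)
        (rhsV P n 0 0 (fun j => U (node n j) t - u t j) (fun j => V (node n j) t - v t j) + FV t)
        (Set.Icc 0 T) t ∧
      ∀ i, |weight n i * (FU t i + FV t i) -
          step n ^ 2 / 24 * (5 * F 2 (-t) * patL n i - F 2 (1 - t) * patR n i)| ≤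
            40 * M * (step n ^ 3 * (edge n i + step n)) ∧
        |weight n i * (FU t i - FV t i) -
          step n ^ 2 / 24 * (5 * G 2 (-t) * patR n i - G 2 (1 - t) * patL n i)| ≤
            40 * M * (step n ^ 3 * (edge n i + step n)) := by
  have hs := step_pos hn
  have hsm := step_mul hn
  have hnode : ∀ j : Fin n, node n j ∈ Set.Icc (0 : ℝ) 1 := by
    intro j
    have h1 : ((j : ℕ) : ℝ) + 1 ≤ n := by exact_mod_cast j.2
    refine ⟨by unfold node; positivity, ?_⟩
    rw [node, ← hsm]; gcongr; linarith
  set Ug : ℝ → Fin n → ℝ := fun t j => U (node n j) t with hUg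
  set Vg : ℝ → Fin n → ℝ := fun t j => V (node n j) t with hVg
  set Ut : ℝ → Fin n → ℝ := fun t j => (-F 1 (node n j - t) - G 1 (1 - node n j - t)) / 2 with hUt
  set Vt : ℝ → Fin n → ℝ := fun t j => (-F 1 (node n j - t) + G 1 (1 - node n j - t)) / 2 with hVt
  have hmem : ∀ (x t : ℝ), x ∈ Set.Icc (0 : ℝ) 1 → t ∈ Set.Icc 0 T → x - t ∈ Set.Icc (-T) 1 :=
    fun x t hx ht => ⟨by linarith [hx.1, ht.2], by linarith [hx.2, ht.1]⟩
  have hFt : ∀ {F : ℕ → ℝ → ℝ}, HasJet F (-T) 1 → ∀ x ∈ Set.Icc (0 : ℝ) 1, ∀ t ∈ Set.Icc 0 T,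
      HasDerivWithinAt (fun t => F 0 (x - t)) (-F 1 (x - t)) (Set.Icc 0 T) t := by
    intro F hF x hx t ht
    have h1 : HasDerivWithinAt (fun t : ℝ => x - t) (-1) (Set.Icc 0 T) t :=
      (hasDerivWithinAt_id t _).const_sub x
    have := (hF 0 (by norm_num) (x - t) (hmem x t hx ht)).comp t h1
      (fun s hs => hmem x s hx hs)
    exact this.congr_deriv (by ring)
  have hnode' : ∀ j : Fin n, 1 - node n j ∈ Set.Icc (0 : ℝ) 1 := fun j =>
    ⟨by linarith [(hnode j).2], by linarith [(hnode j).1]⟩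
  have hUd : ∀ t ∈ Set.Icc 0 T, HasDerivWithinAt Ug (Ut t) (Set.Icc 0 T) t := by
    intro t ht
    refine hasDerivWithinAt_pi.2 fun j => ?_
    refine ((((hFt hF _ (hnode j) t ht).fun_add (hFt hG _ (hnode' j) t ht)).div_const 2).congr
      (fun s hs => (hUV _ (hnode j) s hs).1) (hUV _ (hnode j) t ht).1).congr_deriv ?_
    simp only [hUt]; ring
  have hVd : ∀ t ∈ Set.Icc 0 T, HasDerivWithinAt Vg (Vt t) (Set.Icc 0 T) t := by
    intro t ht
    refine hasDerivWithinAt_pi.2 fun j => ?_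
    refine ((((hFt hF _ (hnode j) t ht).fun_sub (hFt hG _ (hnode' j) t ht)).div_const 2).congr
      (fun s hs => (hUV _ (hnode j) s hs).2) (hUV _ (hnode j) t ht).2).congr_deriv ?_
    simp only [hVt]; ring
  -- The forcing is the residual of the exact solution in the scheme. Its penalties vanish by the
  -- boundary conditions, which leaves the truncation errors of `D_m` and `D_p`.
  refine ⟨fun t => Ut t - rhsU P n (g₁ t) (gₙ t) (Ug t) (Vg t),
    fun t => Vt t - rhsV P n (g₁ t) (gₙ t) (Ug t) (Vg t), fun t ht => ⟨?_, ?_, fun i => ?_⟩⟩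
  · refine ((hUd t ht).sub (h.eq_u t ht)).congr_deriv ?_
    have := rhsU_sub_rhsU P n (g₁ t) (gₙ t) (Ug t) (Vg t) (u t) (v t)
    change _ = rhsU P n 0 0 (Ug t - u t) (Vg t - v t) + _
    rw [← this]; ext i; simp only [Pi.add_apply, Pi.sub_apply]; ring
  · refine ((hVd t ht).sub (h.eq_v t ht)).congr_deriv ?_
    have := rhsV_sub_rhsV P n (g₁ t) (gₙ t) (Ug t) (Vg t) (u t) (v t)
    change _ = rhsV P n 0 0 (Ug t - u t) (Vg t - v t) + _
    rw [← this]; ext i; simp only [Pi.add_apply, Pi.sub_apply]; ring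
  · have f1 : eFirst n ⬝ᵥ Ug t = U 0 t := by
      simpa [node, hUg] using eFirst_dotProduct hn (fun j => U (j * step n) t)
    have f2 : eFirst n ⬝ᵥ Vg t = V 0 t := by
      simpa [node, hVg] using eFirst_dotProduct hn (fun j => V (j * step n) t)
    have hlast : ((n - 1 : ℕ) : ℝ) * step n = 1 := by
      rw [Nat.cast_sub (by omega)]; push_cast; exact hsm
    have f3 : eLast n ⬝ᵥ Ug t = U 1 t := by
      have := eLast_dotProduct hn (fun j => U (j * step n) t)
      rwa [hlast] at this
    have f4 : eLast n ⬝ᵥ Vg t = V 1 t := by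
      have := eLast_dotProduct hn (fun j => V (j * step n) t)
      rwa [hlast] at this
    have ha := weight_mul_rhs_add hn P (g₁ t) (gₙ t) (Ug t) (Vg t) i
    have hb := weight_mul_rhs_sub hn P (g₁ t) (gₙ t) (Ug t) (Vg t) i
    rw [f1, f2, f3, f4, hbl t ht, hbr t ht, sub_self, sub_self, mul_zero, mul_zero, zero_mul,
      zero_mul, add_zero, add_zero] at ha hb
    have hT : 0 ≤ T := ht.1.trans ht.2
    have hy : -t ∈ Set.Icc (-T) 1 := ⟨by linarith [ht.2], by linarith [ht.1]⟩
    have hy1 : -t + 1 ∈ Set.Icc (-T) 1 := ⟨by linarith [ht.2], by linarith [ht.1]⟩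
    have hsum : Ug t + Vg t = fun j : Fin n => F 0 (-t + (j : ℕ) * step n) := by
      ext j
      have := hUV _ (hnode j) t ht
      simp only [Pi.add_apply, hUg, hVg]
      rw [this.1, this.2, show -t + (j : ℕ) * step n = node n j - t by unfold node; ring]
      ring
    have hrev : ∀ j : Fin n, 1 - node n j.rev = node n j := by
      intro j
      have h1 : (((j.rev : Fin n) : ℕ) : ℝ) = n - 1 - (j : ℕ) := by
        rw [Fin.val_rev, Nat.cast_sub (by omega)]; push_cast; ring
      rw [node, node, h1]
      linarith
    have hdiff : (fun j : Fin n => (Ug t - Vg t) j.rev) =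
        fun j : Fin n => G 0 (-t + (j : ℕ) * step n) := by
      ext j
      have := hUV _ (hnode j.rev) t ht
      simp only [Pi.sub_apply, hUg, hVg]
      rw [this.1, this.2, hrev, show -t + (j : ℕ) * step n = node n j - t by unfold node; ring]
      ring
    constructor
    · have := truncation_error hF hF3 hF4 hy hy1 hn i
      rw [hsum, weight_mul_Dm hn (fun j => F 0 (-t + j * step n))] at ha
      rw [show -t + 1 = 1 - t by ring] at this
      convert this using 2
      simp only [Pi.sub_apply, hUt, hVt]
      rw [show -t + (i : ℕ) * step n = node n i - t by unfold node; ring]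
      linear_combination -ha
    -- On the reversed grid the left-going wave is sampled like a right-going one, and `D_p` becomes
    -- `-D_m`.
    · have := truncation_error hG hG3 hG4 hy hy1 hn i.rev
      have hD := Dm_mulVec_rev hn (Ug t - Vg t) i.rev
      rw [hdiff, Fin.rev_rev] at hD
      have hD2 := weight_mul_Dm hn (fun j => G 0 (-t + j * step n)) i.rev
      rw [hD, weight_rev] at hD2
      rw [edge_rev, weight_rev, patL_rev, patR_rev, show -t + 1 = 1 - t by ring, ← hD2] at this
      convert this using 2
      simp only [Pi.sub_apply, hUt, hVt]
      rw [show -t + ((i.rev : Fin n) : ℕ) * step n = node n i.rev - t by unfold node; ring,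
        ← hrev i.rev, Fin.rev_rev]
      linear_combination -hb

/-! ### Upper bound for the error -/

/-- The leading truncation errors of the right-going component (up to their amplitudes). -/
def truncP (n : ℕ) (i : Fin n) : Fin 4 → ℝ := ![5 / 24 * patL n i, 0, -(1 / 24) * patR n i, 0]

/-- The leading truncation errors of the left-going component (up to their amplitudes). -/
def truncM (n : ℕ) (i : Fin n) : Fin 4 → ℝ := ![0, -(1 / 24) * patL n i, 0, 5 / 24 * patR n i]

/-- One corrector for each end and each component. Energy stability supplies the nonzero
denominators `τ₁ + τ₂` and `τ₃ - τ₄`. -/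
lemma exists_correctors {P : Params} (hα₀ : 0 ≤ P.α₀) (hα₁ : P.α₁ ≤ 0) (hP : EnergyStable P)
    {ε : ℝ} (hε0 : 0 ≤ ε) (hεl : P.α₀ * P.τ₁ + P.τ₂ + 1 ≠ 0 → 1 ≤ ε)
    (hεr : P.α₁ * P.τ₃ + P.τ₄ - 1 ≠ 0 → 1 ≤ ε) :
    ∃ K, 0 ≤ K ∧ ∀ n, 4 ≤ n → ∃ u v : Fin 4 → Fin n → ℝ, ∀ k i,
      |u k i| ≤ K * (edge n i + ε) ∧ |v k i| ≤ K * (edge n i + ε) ∧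
      |weight n i * (rhsU P n 0 0 (u k) (v k) i + rhsV P n 0 0 (u k) (v k) i) + truncP n i k| ≤
        K * (step n * (edge n i + ε)) ∧
      |weight n i * (rhsU P n 0 0 (u k) (v k) i - rhsV P n 0 0 (u k) (v k) i) + truncM n i k| ≤
        K * (step n * (edge n i + ε)) := by
  have hσ : P.τ₁ + P.τ₂ ≠ 0 := by
    intro h
    have := hP.penalty_left
    rw [h] at this
    linarith
  have hσ' : P.τ₃ - P.τ₄ ≠ 0 := by
    intro h
    have := hP.penalty_right
    rw [h] at this
    linarith
  have key : ∀ k : Fin 4, ∃ K, 0 ≤ K ∧ ∀ n, 4 ≤ n → ∃ u v : Fin n → ℝ, ∀ i,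
      |u i| ≤ K * (edge n i + ε) ∧ |v i| ≤ K * (edge n i + ε) ∧
      |weight n i * (rhsU P n 0 0 u v i + rhsV P n 0 0 u v i) + truncP n i k| ≤
        K * (step n * (edge n i + ε)) ∧
      |weight n i * (rhsU P n 0 0 u v i - rhsV P n 0 0 u v i) + truncM n i k| ≤
        K * (step n * (edge n i + ε)) := by
    intro k
    fin_cases k
    · simpa [truncP, truncM] using exists_corrector_left P hα₀ hσ ε hε0 hεl (5 / 24) 0
    · simpa [truncP, truncM] using exists_corrector_left P hα₀ hσ ε hε0 hεl 0 (-(1 / 24))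
    · simpa [truncP, truncM] using exists_corrector_right P hα₁ hσ' ε hε0 hεr (-(1 / 24)) 0
    · simpa [truncP, truncM] using exists_corrector_right P hα₁ hσ' ε hε0 hεr 0 (5 / 24)
  choose K hK h using key
  refine ⟨∑ k, K k, Finset.sum_nonneg fun k _ => hK k, fun n hn => ?_⟩
  choose u v huv using fun k => h k n hn
  refine ⟨u, v, fun k i => ?_⟩
  have hle : K k ≤ ∑ k, K k := Finset.single_le_sum (fun k _ => hK k) (Finset.mem_univ k)
  obtain ⟨h1, h2, h3, h4⟩ := huv k i
  have he := edge_pos n i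
  have hs := step_pos hn
  exact ⟨h1.trans (by gcongr), h2.trans (by gcongr), h3.trans (by gcongr), h4.trans (by gcongr)⟩

lemma abs_sum_four_mul_le {a b : Fin 4 → ℝ} {A B : ℝ} (ha : ∀ k, |a k| ≤ A) (hb : ∀ k, |b k| ≤ B) :
    |∑ k, a k * b k| ≤ 4 * (A * B) := by
  have hA : 0 ≤ A := (abs_nonneg _).trans (ha 0)
  calc |∑ k, a k * b k| ≤ ∑ k : Fin 4, |a k * b k| := Finset.abs_sum_le_sum_abs _ _
    _ ≤ ∑ _k : Fin 4, A * B := by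
      refine Finset.sum_le_sum fun k _ => ?_
      rw [abs_mul]
      exact mul_le_mul (ha k) (hb k) (abs_nonneg _) hA
    _ = 4 * (A * B) := by simp

lemma rhsU_sum {P : Params} {n : ℕ} (c : Fin 4 → ℝ) (u v : Fin 4 → Fin n → ℝ) (i : Fin n) :
    rhsU P n 0 0 (fun i => ∑ k, c k * u k i) (fun i => ∑ k, c k * v k i) i =
        ∑ k, c k * rhsU P n 0 0 (u k) (v k) i ∧
      rhsV P n 0 0 (fun i => ∑ k, c k * u k i) (fun i => ∑ k, c k * v k i) i =
        ∑ k, c k * rhsV P n 0 0 (u k) (v k) i := by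
  have h := map_sum (rhsLin P n) (fun k => c k • (u k, v k)) Finset.univ
  have h0 : ∑ k, c k • (u k, v k) =
      ((fun i => ∑ k, c k * u k i), (fun i => ∑ k, c k * v k i)) := by
    ext i <;> simp [Prod.fst_sum, Prod.snd_sum, Finset.sum_apply]
  simp only [map_smul] at h
  rw [h0] at h
  constructor
  · have := congrFun (congrArg Prod.fst h) i
    simpa [rhsLin, Prod.fst_sum, Finset.sum_apply] using this
  · have := congrFun (congrArg Prod.snd h) i
    simpa [rhsLin, Prod.snd_sum, Finset.sum_apply] using this

lemma abs_le_of_weight_mul {n : ℕ} (hn : 4 ≤ n) {i : Fin n} {x y B : ℝ}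
    (ha : |weight n i * (x + y)| ≤ B * step n) (hb : |weight n i * (x - y)| ≤ B * step n) :
    |x| ≤ 3 * B ∧ |y| ≤ 3 * B := by
  have hs := step_pos hn
  have hw := weight_ge hn i
  have hw0 := weight_pos hn i
  have hB : 0 ≤ B := by
    by_contra hB
    have : B * step n < 0 := mul_neg_of_neg_of_pos (not_le.1 hB) hs
    linarith [abs_nonneg (weight n i * (x + y))]
  have hB2 : B * step n ≤ 3 * B * weight n i := by nlinarith
  have a := abs_le.1 ha
  have b := abs_le.1 hb
  constructor
  · have : |weight n i * x| ≤ 3 * B * weight n i := by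
      rw [abs_le]; constructor <;> linarith
    rw [abs_mul, abs_of_pos hw0, mul_comm] at this
    exact le_of_mul_le_mul_right this hw0
  · have : |weight n i * y| ≤ 3 * B * weight n i := by
      rw [abs_le]; constructor <;> linarith
    rw [abs_mul, abs_of_pos hw0, mul_comm] at this
    exact le_of_mul_le_mul_right this hw0

/-- The leading truncation error `p` cancels against the image `r` of the correctors. What remains
is of higher order, including the time derivative of the amplitudes, which is multiplied by a weight
of order `h`. -/
lemma abs_residual_le {n : ℕ} (hn : 4 ≤ n) (i : Fin n) {f : ℝ} {M K ε : ℝ} (hM : 0 ≤ M)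
    (hK : 0 ≤ K) (hε : 0 ≤ ε) {a a' r p w : Fin 4 → ℝ} (ha : ∀ k, |a k| ≤ M)
    (ha' : ∀ k, |a' k| ≤ M) (hf : |f - step n ^ 2 * ∑ k, a k * p k| ≤
      40 * M * (step n ^ 3 * (edge n i + step n)))
    (hr : ∀ k, |r k + p k| ≤ K * (step n * (edge n i + ε)))
    (hw : ∀ k, |w k| ≤ 2 * (K * (edge n i + ε))) :
    |f + step n ^ 2 * ∑ k, a k * r k - weight n i * (step n ^ 2 * ∑ k, a' k * w k)| ≤
      (40 * M + 13 * (M * K)) * (step n ^ 2 * (edge n i + step n + ε)) * step n := by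
  have hs := step_pos hn
  have he := edge_pos n i
  have h1 := abs_sum_four_mul_le ha hr
  have h2 := abs_sum_four_mul_le ha' hw
  have h3 : ∑ k, a k * (r k + p k) = ∑ k, a k * r k + ∑ k, a k * p k := by
    rw [← Finset.sum_add_distrib]; exact Finset.sum_congr rfl fun k _ => by ring
  set S := ∑ k, a k * (r k + p k) with hS
  set S' := ∑ k, a' k * w k with hS'
  have h4 : f + step n ^ 2 * ∑ k, a k * r k - weight n i * (step n ^ 2 * S') =
      (f - step n ^ 2 * ∑ k, a k * p k) + step n ^ 2 * S - weight n i * (step n ^ 2 * S') := by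
    rw [h3]; ring
  have h5 : |step n ^ 2 * S| ≤ step n ^ 2 * (4 * (M * (K * (step n * (edge n i + ε))))) := by
    rw [abs_mul, abs_of_nonneg (sq_nonneg _)]; gcongr
  have h6 : |weight n i * (step n ^ 2 * S')| ≤
      13 / 12 * step n * (step n ^ 2 * (4 * (M * (2 * (K * (edge n i + ε)))))) := by
    rw [abs_mul, abs_mul, abs_of_nonneg (sq_nonneg (step n)), abs_of_pos (weight_pos hn i)]
    have := weight_le hn i
    gcongr
  rw [h4]
  refine (abs_sub _ _).trans ((add_le_add ((abs_add_le _ _).trans (add_le_add hf h5)) h6).trans ?_)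
  have q1 : 0 ≤ M * step n ^ 3 * ε := by positivity
  have q2 : 0 ≤ M * K * step n ^ 3 * edge n i := by positivity
  have q3 : 0 ≤ M * K * step n ^ 3 * ε := by positivity
  have q4 : 0 ≤ M * K * step n ^ 3 * step n := by positivity
  linarith

/-- The squared error at any time, for stable schemes. -/
lemma exists_error_bound {P : Params} (hα₀ : 0 ≤ P.α₀) (hα₁ : P.α₁ ≤ 0) (hP : EnergyStable P)
    {ε : ℝ} (hε0 : 0 ≤ ε) (hεl : P.α₀ * P.τ₁ + P.τ₂ + 1 ≠ 0 → 1 ≤ ε)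
    (hεr : P.α₁ * P.τ₃ + P.τ₄ - 1 ≠ 0 → 1 ≤ ε) {T : ℝ} (hT : 0 < T) {g₁ gₙ : ℝ → ℝ}
    {U V : ℝ → ℝ → ℝ} (h : IsExactSolution P T (4 : ℕ) g₁ gₙ U V) :
    ∃ C, 0 ≤ C ∧ ∀ n, 4 ≤ n → ∀ u v : ℝ → Fin n → ℝ, IsSemidiscreteSolution P T g₁ gₙ U V n u v →
      ∀ t ∈ Set.Icc 0 T,
        step n * ∑ j, ((U (node n j) t - u t j) ^ 2 + (V (node n j) t - v t j) ^ 2) ≤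
          C * (step n ^ 4 * (step n + ε ^ 2)) := by
  obtain ⟨F, G, M, hF, hG, hFM, hGM, hUV⟩ := h.exists_waves hT
  obtain ⟨K, hK, hcorr⟩ := exists_correctors hα₀ hα₁ hP hε0 hεl hεr
  have hM : 0 ≤ M := (abs_nonneg _).trans (hFM 0 (by norm_num) 1 ⟨by linarith, le_rfl⟩)
  set C₁ := 120 * M + 39 * (M * K) with hC₁
  have hC₁0 : 0 ≤ C₁ := by positivity
  refine ⟨2 * (12 * Real.exp T * (27 * C₁ ^ 2)) + 4 * (27 * C₁ ^ 2), by positivity, ?_⟩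
  intro n hn u v huv
  have hs := step_pos hn
  obtain ⟨FU, FV, hE⟩ := huv.error_equation h.bc_left h.bc_right hF hG (hFM 3 (by norm_num))
    (hFM 4 le_rfl) (hGM 3 (by norm_num)) (hGM 4 le_rfl) hUV hn
  obtain ⟨wu, wv, hw⟩ := hcorr n hn
  -- Second derivatives of the two waves at the left and then at the right end, in the order of
  -- `truncP` and `truncM`.
  set a : ℝ → Fin 4 → ℝ := fun t => ![F 2 (-t), G 2 (1 - t), F 2 (1 - t), G 2 (-t)] with ha
  set a' : ℝ → Fin 4 → ℝ := fun t => ![-F 3 (-t), -G 3 (1 - t), -F 3 (1 - t), -G 3 (-t)] with ha'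
  have hm1 : ∀ t ∈ Set.Icc 0 T, -t ∈ Set.Icc (-T) 1 := fun t ht =>
    ⟨by linarith [ht.2], by linarith [ht.1]⟩
  have hm2 : ∀ t ∈ Set.Icc 0 T, 1 - t ∈ Set.Icc (-T) 1 := fun t ht =>
    ⟨by linarith [ht.2], by linarith [ht.1]⟩
  have haM : ∀ t ∈ Set.Icc 0 T, ∀ k, |a t k| ≤ M := by
    intro t ht k
    have h2 : 2 ≤ 4 := by norm_num
    fin_cases k
    · exact hFM 2 h2 _ (hm1 t ht)
    · exact hGM 2 h2 _ (hm2 t ht)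
    · exact hFM 2 h2 _ (hm2 t ht)
    · exact hGM 2 h2 _ (hm1 t ht)
  have haM' : ∀ t ∈ Set.Icc 0 T, ∀ k, |a' t k| ≤ M := by
    intro t ht k
    have h2 : 3 ≤ 4 := by norm_num
    fin_cases k <;> simp only [ha']
    · exact (abs_neg _).trans_le (hFM 3 h2 _ (hm1 t ht))
    · exact (abs_neg _).trans_le (hGM 3 h2 _ (hm2 t ht))
    · exact (abs_neg _).trans_le (hFM 3 h2 _ (hm2 t ht))
    · exact (abs_neg _).trans_le (hGM 3 h2 _ (hm1 t ht))
  have had : ∀ t ∈ Set.Icc 0 T, ∀ k, HasDerivWithinAt (fun t => a t k) (a' t k) (Set.Icc 0 T) t := by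
    have h1 : ∀ {F : ℕ → ℝ → ℝ}, HasJet F (-T) 1 → ∀ t ∈ Set.Icc 0 T,
        HasDerivWithinAt (fun t => F 2 (-t)) (-F 3 (-t)) (Set.Icc 0 T) t := by
      intro F hF t ht
      have := (hF 2 (by norm_num) _ (hm1 t ht)).comp t (hasDerivWithinAt_id t (Set.Icc 0 T)).fun_neg
        hm1
      exact this.congr_deriv (by simp)
    have h2 : ∀ {F : ℕ → ℝ → ℝ}, HasJet F (-T) 1 → ∀ t ∈ Set.Icc 0 T,
        HasDerivWithinAt (fun t => F 2 (1 - t)) (-F 3 (1 - t)) (Set.Icc 0 T) t := by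
      intro F hF t ht
      have := (hF 2 (by norm_num) _ (hm2 t ht)).comp t
        ((hasDerivWithinAt_id t (Set.Icc 0 T)).const_sub 1) hm2
      exact this.congr_deriv (by simp)
    intro t ht k
    fin_cases k
    · exact h1 hF t ht
    · exact h2 hG t ht
    · exact h2 hF t ht
    · exact h1 hG t ht
  set eu : ℝ → Fin n → ℝ := fun t j => U (node n j) t - u t j with heu
  set ev : ℝ → Fin n → ℝ := fun t j => V (node n j) t - v t j with hev
  have hwd : ∀ (w : Fin 4 → Fin n → ℝ), ∀ t ∈ Set.Icc 0 T, HasDerivWithinAt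
      (fun t i => step n ^ 2 * ∑ k, a t k * w k i)
      (fun i => step n ^ 2 * ∑ k, a' t k * w k i) (Set.Icc 0 T) t := by
    intro w t ht
    refine hasDerivWithinAt_pi.2 fun i => ?_
    exact (HasDerivWithinAt.fun_sum (u := Finset.univ) fun k _ =>
      (had t ht k).mul_const (w k i)).const_mul _
  have hwb : ∀ (w : Fin 4 → Fin n → ℝ), (∀ k i, |w k i| ≤ K * (edge n i + ε)) →
      ∀ t ∈ Set.Icc 0 T, ∀ i, |step n ^ 2 * ∑ k, a t k * w k i| ≤
        C₁ * (step n ^ 2 * (edge n i + step n + ε)) := by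
    intro w hw t ht i
    have he := edge_pos n i
    have h1 := abs_sum_four_mul_le (haM t ht) (fun k => hw k i)
    rw [abs_mul, abs_of_nonneg (sq_nonneg (step n))]
    calc _ ≤ step n ^ 2 * (4 * (M * (K * (edge n i + ε)))) := by gcongr
      _ ≤ step n ^ 2 * ((120 * M + 39 * (M * K)) * (edge n i + step n + ε)) := by
        refine mul_le_mul_of_nonneg_left ?_ (sq_nonneg _)
        have q1 : 0 ≤ M * (edge n i + step n + ε) := by positivity
        have q2 : 0 ≤ M * K * (edge n i + ε) := by positivity
        have q3 : 0 ≤ M * K * step n := by positivity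
        linarith
      _ = _ := by rw [hC₁]; ring
  have hRU := fun t i => rhsU_sum (P := P) (fun k => step n ^ 2 * a t k) wu wv i
  have hws : ∀ (w : Fin 4 → Fin n → ℝ) t, (fun i => ∑ k, step n ^ 2 * a t k * w k i) =
      fun i => step n ^ 2 * ∑ k, a t k * w k i := by
    intro w t; ext i; rw [Finset.mul_sum]; exact Finset.sum_congr rfl fun k _ => by ring
  set cu : ℝ → Fin n → ℝ := fun t i => step n ^ 2 * ∑ k, a t k * wu k i with hcu
  set cv : ℝ → Fin n → ℝ := fun t i => step n ^ 2 * ∑ k, a t k * wv k i with hcv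
  simp only [hws] at hRU
  have hLU : ∀ t i, rhsU P n 0 0 (cu t) (cv t) i =
    ∑ k, step n ^ 2 * a t k * rhsU P n 0 0 (wu k) (wv k) i := fun t i => (hRU t i).1
  have hLV : ∀ t i, rhsV P n 0 0 (cu t) (cv t) i =
    ∑ k, step n ^ 2 * a t k * rhsV P n 0 0 (wu k) (wv k) i := fun t i => (hRU t i).2
  -- The forcing in the equation for the error minus the corrector.
  set Ru : ℝ → Fin n → ℝ := fun t i => FU t i + rhsU P n 0 0 (cu t) (cv t) i -
    step n ^ 2 * ∑ k, a' t k * wu k i with hRu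
  set Rv : ℝ → Fin n → ℝ := fun t i => FV t i + rhsV P n 0 0 (cu t) (cv t) i -
    step n ^ 2 * ∑ k, a' t k * wv k i with hRv
  have hR : ∀ t ∈ Set.Icc 0 T, ∀ i, |Ru t i| ≤ C₁ * (step n ^ 2 * (edge n i + step n + ε)) ∧
      |Rv t i| ≤ C₁ * (step n ^ 2 * (edge n i + step n + ε)) := by
    intro t ht i
    obtain ⟨-, -, hb⟩ := hE t ht
    obtain ⟨b1, b2⟩ := hb i
    have c1 : step n ^ 2 / 24 * (5 * F 2 (-t) * patL n i - F 2 (1 - t) * patR n i) =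
        step n ^ 2 * ∑ k, a t k * truncP n i k := by
      simp [Fin.sum_univ_four, ha, truncP]; ring
    have c2 : step n ^ 2 / 24 * (5 * G 2 (-t) * patR n i - G 2 (1 - t) * patL n i) =
        step n ^ 2 * ∑ k, a t k * truncM n i k := by
      simp [Fin.sum_univ_four, ha, truncM]; ring
    rw [c1] at b1
    rw [c2] at b2
    have r1 := abs_residual_le hn i hM hK hε0 (haM t ht) (haM' t ht) b1 (fun k => (hw k i).2.2.1)
      (w := fun k => wu k i + wv k i) (fun k => (abs_add_le _ _).trans (by
        linarith [(hw k i).1, (hw k i).2.1]))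
    have r2 := abs_residual_le hn i hM hK hε0 (haM t ht) (haM' t ht) b2 (fun k => (hw k i).2.2.2)
      (w := fun k => wu k i - wv k i) (fun k => (abs_sub _ _).trans (by
        linarith [(hw k i).1, (hw k i).2.1]))
    have := abs_le_of_weight_mul hn (i := i) (x := Ru t i) (y := Rv t i)
      (B := (40 * M + 13 * (M * K)) * (step n ^ 2 * (edge n i + step n + ε))) ?_ ?_
    · have e : 3 * ((40 * M + 13 * (M * K)) * (step n ^ 2 * (edge n i + step n + ε))) =
        C₁ * (step n ^ 2 * (edge n i + step n + ε)) := by rw [hC₁]; ring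
      rwa [e] at this
    · refine le_of_eq_of_le (congrArg _ ?_) r1
      simp only [hRu, hRv, hLU, hLV, Fin.sum_univ_four]
      ring
    · refine le_of_eq_of_le (congrArg _ ?_) r2
      simp only [hRu, hRv, hLU, hLV, Fin.sum_univ_four]
      ring
  have h0 : (0 : ℝ) ∈ Set.Icc 0 T := ⟨le_rfl, hT.le⟩
  have hwu := hwb wu fun k i => (hw k i).1
  have hwv := hwb wv fun k i => (hw k i).2.1
  -- The error starts from zero, so the initial value here is minus the corrector, which obeys the
  -- same bound as the forcing.
  have hen := hP.energy_estimate hn (T := T) (du := fun t => eu t - cu t)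
    (dv := fun t => ev t - cv t) (Ru := Ru) (Rv := Rv)
    (s := fun i => C₁ * (step n ^ 2 * (edge n i + step n + ε)))
    (fun t ht => by
      refine ((hE t ht).1.sub (hwd wu t ht)).congr_deriv ?_
      rw [← rhsU_sub_rhsU P n 0 0 (eu t) (ev t)]
      ext i
      simp only [hRu, Pi.add_apply, Pi.sub_apply]
      ring)
    (fun t ht => by
      refine ((hE t ht).2.1.sub (hwd wv t ht)).congr_deriv ?_
      rw [← rhsV_sub_rhsV P n 0 0 (eu t) (ev t)]
      ext i
      simp only [hRv, Pi.add_apply, Pi.sub_apply]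
      ring)
    (fun t ht i => (hR t ht i).1) (fun t ht i => (hR t ht i).2)
    (fun i => by
      have h1 : eu 0 i = 0 := by simp only [heu, huv.init_u, sub_self]
      rw [Pi.sub_apply, h1, zero_sub, abs_neg]
      exact hwu 0 h0 i)
    (fun i => by
      have h1 : ev 0 i = 0 := by simp only [hev, huv.init_v, sub_self]
      rw [Pi.sub_apply, h1, zero_sub, abs_neg]
      exact hwv 0 h0 i)
  intro t ht
  have h1 := hen t ht
  have h2 := step_mul_sum_sq_le hn C₁ ε
  have hsq : ∀ {x y : ℝ}, |x| ≤ y → x ^ 2 ≤ y ^ 2 := fun {x y} h => by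
    rw [← sq_abs]; gcongr
  have h3 : step n * ∑ i, (eu t i ^ 2 + ev t i ^ 2) ≤
      2 * (step n * ∑ i, ((eu t - cu t) i ^ 2 + (ev t - cv t) i ^ 2)) +
      4 * (step n * ∑ i : Fin n, (C₁ * (step n ^ 2 * (edge n i + step n + ε))) ^ 2) := by
    have : ∀ i, eu t i ^ 2 + ev t i ^ 2 ≤ 2 * ((eu t - cu t) i ^ 2 + (ev t - cv t) i ^ 2) +
        4 * (C₁ * (step n ^ 2 * (edge n i + step n + ε))) ^ 2 := by
      intro i
      have q1 := hsq (hwu t ht i)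
      have q2 := hsq (hwv t ht i)
      simp only [Pi.sub_apply]
      nlinarith [sq_nonneg (eu t i - 2 * cu t i), sq_nonneg (ev t i - 2 * cv t i)]
    calc _ ≤ step n * ∑ i, (2 * ((eu t - cu t) i ^ 2 + (ev t - cv t) i ^ 2) +
        4 * (C₁ * (step n ^ 2 * (edge n i + step n + ε))) ^ 2) := by
          exact mul_le_mul_of_nonneg_left (Finset.sum_le_sum fun i _ => this i) hs.le
      _ = _ := by rw [Finset.sum_add_distrib, ← Finset.mul_sum, ← Finset.mul_sum]; ring
  have hexp := Real.exp_pos T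
  have h4 : 12 * Real.exp T * (step n * ∑ i : Fin n,
      (C₁ * (step n ^ 2 * (edge n i + step n + ε))) ^ 2) ≤
      12 * Real.exp T * (27 * C₁ ^ 2 * step n ^ 4 * (step n + ε ^ 2)) := by gcongr
  calc _ ≤ 2 * (12 * Real.exp T * (27 * C₁ ^ 2 * step n ^ 4 * (step n + ε ^ 2))) +
        4 * (27 * C₁ ^ 2 * step n ^ 4 * (step n + ε ^ 2)) := by linarith
    _ = _ := by ring

/-! ### Lower bound by duality -/

/-- A linear functional of the grid functions, given by its Riesz representation in the variables
`u + v` and `u - v`. -/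
def pairing (n : ℕ) (ψp ψm u v : Fin n → ℝ) : ℝ :=
  ∑ i, weight n i * (ψp i * (u i + v i) + ψm i * (u i - v i))

/-- The squared discrete norm. -/
def normSq (n : ℕ) (u v : Fin n → ℝ) : ℝ := step n * ∑ i, (u i ^ 2 + v i ^ 2)

/-- The functional `pairing n ψp ψm` and its composition with the semidiscretization are bounded
with constant `√κ`. -/
def IsDual (P : Params) (n : ℕ) (ψp ψm : Fin n → ℝ) (κ : ℝ) : Prop :=
  ∀ u v : Fin n → ℝ, pairing n ψp ψm u v ^ 2 ≤ κ * normSq n u v ∧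
    pairing n ψp ψm (rhsU P n 0 0 u v) (rhsV P n 0 0 u v) ^ 2 ≤ κ * normSq n u v

lemma pairing_add (n : ℕ) (ψp ψm u v u' v' : Fin n → ℝ) :
    pairing n ψp ψm (u + u') (v + v') = pairing n ψp ψm u v + pairing n ψp ψm u' v' := by
  simp only [pairing, ← Finset.sum_add_distrib, Pi.add_apply]
  exact Finset.sum_congr rfl fun i _ => by ring

/-- With `y` the functional of the error and `z` that of its image, `y' = z + a` and `y 0 = 0`.
Integrating against `T - t` gives `a T² / 2 = ∫ (y - (T - t) z)`, and the right-hand side is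
controlled by the norm of the error. -/
lemma IsDual.le_integral {P : Params} {n : ℕ} {ψp ψm : Fin n → ℝ} {κ : ℝ}
    (h : IsDual P n ψp ψm κ) (hκ : 0 < κ) {T : ℝ} (hT : 0 < T) {eu ev FU FV : ℝ → Fin n → ℝ}
    (heu : ∀ t ∈ Set.Icc 0 T,
      HasDerivWithinAt eu (rhsU P n 0 0 (eu t) (ev t) + FU t) (Set.Icc 0 T) t)
    (hev : ∀ t ∈ Set.Icc 0 T,
      HasDerivWithinAt ev (rhsV P n 0 0 (eu t) (ev t) + FV t) (Set.Icc 0 T) t)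
    (h0u : eu 0 = 0) (h0v : ev 0 = 0) {a : ℝ} (ha : 0 < a)
    (hF : ∀ t ∈ Set.Icc 0 T, pairing n ψp ψm (FU t) (FV t) = a) :
    T ^ 3 * a ^ 2 / (4 * κ * (1 + T) ^ 2) ≤ ∫ t in (0 : ℝ)..T, normSq n (eu t) (ev t) := by
  set y : ℝ → ℝ := fun t => pairing n ψp ψm (eu t) (ev t) with hy
  set z : ℝ → ℝ := fun t => pairing n ψp ψm (rhsU P n 0 0 (eu t) (ev t))
    (rhsV P n 0 0 (eu t) (ev t)) with hz
  have hyd : ∀ t ∈ Set.Icc 0 T, HasDerivWithinAt y (z t + a) (Set.Icc 0 T) t := by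
    intro t ht
    have h1 := hasDerivWithinAt_pi.1 (heu t ht)
    have h2 := hasDerivWithinAt_pi.1 (hev t ht)
    have := HasDerivWithinAt.fun_sum (u := Finset.univ) fun i _ =>
      ((((h1 i).fun_add (h2 i)).const_mul (ψp i)).fun_add
        (((h1 i).fun_sub (h2 i)).const_mul (ψm i))).const_mul (weight n i)
    refine this.congr_deriv ?_
    rw [← hF t ht, hz, ← pairing_add]
    rfl
  have hNc : ContinuousOn (fun t => normSq n (eu t) (ev t)) (Set.Icc 0 T) := by
    have c1 : ContinuousOn eu (Set.Icc 0 T) := fun t ht => (heu t ht).continuousWithinAt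
    have c2 : ContinuousOn ev (Set.Icc 0 T) := fun t ht => (hev t ht).continuousWithinAt
    rw [continuousOn_pi] at c1 c2
    refine continuousOn_const.mul (continuousOn_finsetSum _ fun i _ => ?_)
    exact ((c1 i).pow 2).add ((c2 i).pow 2)
  -- The parameter of Young's inequality: its constant part then integrates to `a T² / 4`, half of
  -- the left-hand side.
  set θ := T * a / (2 * (1 + T)) with hθ
  have hθ0 : 0 < θ := by positivity
  have habs : ∀ {x N : ℝ}, x ^ 2 ≤ κ * N → |x| ≤ θ / 2 + κ / (2 * θ) * N := by
    intro x N hx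
    have h1 : |x| ≤ θ / 2 + x ^ 2 / (2 * θ) := by
      rw [← sq_abs, ← sub_nonneg]
      have : θ / 2 + |x| ^ 2 / (2 * θ) - |x| = (|x| - θ) ^ 2 / (2 * θ) := by
        field_simp; ring
      rw [this]; positivity
    have h2 : x ^ 2 / (2 * θ) ≤ κ * N / (2 * θ) := by gcongr
    calc |x| ≤ _ := h1.trans (add_le_add le_rfl h2)
      _ = _ := by ring
  set φ : ℝ → ℝ := fun t => (1 + T) * (θ / 2) +
    (1 + T) * (κ / (2 * θ)) * normSq n (eu t) (ev t) with hφ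
  have hφc : ContinuousOn φ (Set.Icc 0 T) := continuousOn_const.add (continuousOn_const.mul hNc)
  -- A primitive of `y - (T - t) z`.
  set G : ℝ → ℝ := fun t => -((T - t) * y t) - a / 2 * (T - t) ^ 2 with hG
  have hGd : ∀ t ∈ Set.Icc 0 T, HasDerivWithinAt G (y t - (T - t) * z t) (Set.Icc 0 T) t := by
    intro t ht
    have h1 := (hasDerivWithinAt_id t (Set.Icc 0 T)).const_sub T
    refine ((h1.fun_mul (hyd t ht)).fun_neg.fun_sub ((h1.fun_pow 2).const_mul (a / 2))).congr_deriv
      ?_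
    simp
    ring
  have hle := intervalIntegral.sub_le_integral_of_hasDeriv_right_of_le (g := G)
    (g' := fun t => y t - (T - t) * z t) (φ := φ) hT.le
    (fun t ht => (hGd t ht).continuousWithinAt)
    (fun t ht => ((hGd t ⟨ht.1.le, ht.2.le⟩).hasDerivAt (Icc_mem_nhds ht.1 ht.2)).hasDerivWithinAt)
    (hφc.integrableOn_Icc) (fun t ht => by
      have h1 := habs (h (eu t) (ev t)).1
      have h2 := habs (h (eu t) (ev t)).2
      have h3 : |(T - t) * z t| ≤ T * (θ / 2 + κ / (2 * θ) * normSq n (eu t) (ev t)) := by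
        rw [abs_mul, abs_of_nonneg (by linarith [ht.2])]
        exact mul_le_mul (by linarith [ht.1]) h2 (abs_nonneg _) hT.le
      have h4 := (abs_le.1 h3).1
      have h5 := (abs_le.1 h1).2
      have h6 : y t ≤ θ / 2 + κ / (2 * θ) * normSq n (eu t) (ev t) := h5
      simp only [hφ]
      linarith)
  have hI : ∫ t in (0 : ℝ)..T, φ t = T * ((1 + T) * (θ / 2)) +
      (1 + T) * (κ / (2 * θ)) * ∫ t in (0 : ℝ)..T, normSq n (eu t) (ev t) := by
    rw [hφ, intervalIntegral.integral_add intervalIntegrable_const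
      ((hNc.intervalIntegrable_of_Icc hT.le).const_mul _), intervalIntegral.integral_const,
      intervalIntegral.integral_const_mul]
    simp
  rw [hI] at hle
  have hy0 : y 0 = 0 := by simp [hy, h0u, h0v, pairing]
  have hG0 : G T - G 0 = a / 2 * T ^ 2 := by simp [hG, hy0]
  rw [hG0] at hle
  set I := ∫ t in (0 : ℝ)..T, normSq n (eu t) (ev t) with hIdef
  have e1 : T * ((1 + T) * (θ / 2)) = T ^ 2 * a / 4 := by rw [hθ]; field_simp; ring
  have e2 : (1 + T) * (κ / (2 * θ)) * I = (1 + T) ^ 2 * κ / (T * a) * I := by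
    rw [hθ]; field_simp
  rw [e1, e2] at hle
  have h7 : T ^ 2 * a / 4 ≤ (1 + T) ^ 2 * κ / (T * a) * I := by linarith
  rw [div_le_iff₀ (by positivity)]
  have h8 : T ^ 2 * a / 4 * (T * a) ≤ (1 + T) ^ 2 * κ / (T * a) * I * (T * a) := by gcongr
  have h9 : (1 + T) ^ 2 * κ / (T * a) * I * (T * a) = (1 + T) ^ 2 * κ * I := by field_simp
  rw [h9] at h8
  linarith

lemma sum_mul_add_unit {n : ℕ} (y X : Fin n → ℝ) (c₁ c₂ : ℝ) :
    ∑ i, y i * (X i + c₁ * eFirst n i + c₂ * eLast n i) =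
      ∑ i, y i * X i + c₁ * (eFirst n ⬝ᵥ y) + c₂ * (eLast n ⬝ᵥ y) := by
  simp only [dotProduct, Finset.mul_sum, ← Finset.sum_add_distrib]
  exact Finset.sum_congr rfl fun i _ => by ring

/-- The adjoint of the scheme, by summation by parts. `Θ₀` and `Θ₁` are the weights with which the
dual function sees the two penalties. -/
lemma pairing_rhs {n : ℕ} (hn : 4 ≤ n) (P : Params) (ψp ψm u v : Fin n → ℝ) {Θ₀ Θ₁ : ℝ}
    (hΘ₀ : Θ₀ = (P.τ₁ + P.τ₂) * (eFirst n ⬝ᵥ ψp) + (P.τ₁ - P.τ₂) * (eFirst n ⬝ᵥ ψm))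
    (hΘ₁ : Θ₁ = (P.τ₃ + P.τ₄) * (eLast n ⬝ᵥ ψp) + (P.τ₃ - P.τ₄) * (eLast n ⬝ᵥ ψm)) :
    pairing n ψp ψm (rhsU P n 0 0 u v) (rhsV P n 0 0 u v) =
      ∑ i, (u + v) i * (weight n i * (Dp n *ᵥ ψp) i - (eLast n i - eFirst n i) * ψp i
        + (1 + P.α₀) / 2 * Θ₀ * eFirst n i + (1 + P.α₁) / 2 * Θ₁ * eLast n i) +
      ∑ i, (u - v) i * (-(weight n i * (Dm n *ᵥ ψm) i - (eLast n i - eFirst n i) * ψm i)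
        + (1 - P.α₀) / 2 * Θ₀ * eFirst n i + (1 - P.α₁) / 2 * Θ₁ * eLast n i) := by
  have h1 : pairing n ψp ψm (rhsU P n 0 0 u v) (rhsV P n 0 0 u v) =
      ∑ i, ψp i * (weight n i * (rhsU P n 0 0 u v i + rhsV P n 0 0 u v i)) +
      ∑ i, ψm i * (weight n i * (rhsU P n 0 0 u v i - rhsV P n 0 0 u v i)) := by
    rw [pairing, ← Finset.sum_add_distrib]
    exact Finset.sum_congr rfl fun i _ => by ring
  have h2 := dotProduct_weight_mul_Dm hn (u + v) ψp
  have h3 := dotProduct_weight_mul_Dm hn ψm (u - v)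
  have h4 : ∑ i, (u - v) i * -(weight n i * (Dm n *ᵥ ψm) i - (eLast n i - eFirst n i) * ψm i) =
      ∑ i, ψm i * (weight n i * (Dp n *ᵥ (u - v)) i) := by
    have : ∀ i, (u - v) i * -(weight n i * (Dm n *ᵥ ψm) i - (eLast n i - eFirst n i) * ψm i) =
      -((u - v) i * (weight n i * (Dm n *ᵥ ψm) i)) + (u - v) i * ((eLast n i - eFirst n i) * ψm i)
      := fun i => by ring
    simp only [this]
    rw [Finset.sum_add_distrib, Finset.sum_neg_distrib, h3, neg_neg, ← Finset.sum_add_distrib]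
    exact Finset.sum_congr rfl fun i _ => by ring
  have h5 : ∑ i, ψp i * -(weight n i * (Dm n *ᵥ (u + v)) i) =
      -∑ i, ψp i * (weight n i * (Dm n *ᵥ (u + v)) i) := by
    rw [← Finset.sum_neg_distrib]; exact Finset.sum_congr rfl fun i _ => by ring
  simp only [h1, weight_mul_rhs_add hn, weight_mul_rhs_sub hn, sum_mul_add_unit, h4, h5, h2,
    neg_neg, dotProduct_add, dotProduct_sub, hΘ₀, hΘ₁]
  ring

lemma sq_sum_add_sum_le {n : ℕ} (hn : 4 ≤ n) {rp rm r : Fin n → ℝ} (hp : ∀ i, |rp i| ≤ r i)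
    (hm : ∀ i, |rm i| ≤ r i) (u v : Fin n → ℝ) :
    (∑ i, (u + v) i * rp i + ∑ i, (u - v) i * rm i) ^ 2 ≤
      4 * (∑ i, r i ^ 2) / step n * normSq n u v := by
  have hs := step_pos hn
  have key : ∀ (x y : Fin n → ℝ), (∀ i, |y i| ≤ r i) →
      (∑ i, x i * y i) ^ 2 ≤ (∑ i, x i ^ 2) * ∑ i, r i ^ 2 := by
    intro x y hy
    refine (Finset.sum_mul_sq_le_sq_mul_sq _ _ _).trans ?_
    refine mul_le_mul_of_nonneg_left (Finset.sum_le_sum fun i _ => ?_)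
      (Finset.sum_nonneg fun i _ => sq_nonneg _)
    rw [← sq_abs]
    have := hy i
    gcongr
  have h1 := key (u + v) rp hp
  have h2 := key (u - v) rm hm
  have h3 : ∑ i, (u + v) i ^ 2 + ∑ i, (u - v) i ^ 2 = 2 * ∑ i, (u i ^ 2 + v i ^ 2) := by
    rw [← Finset.sum_add_distrib, Finset.mul_sum]
    exact Finset.sum_congr rfl fun i _ => by simp only [Pi.add_apply, Pi.sub_apply]; ring
  have h4 : 4 * (∑ i, r i ^ 2) / step n * normSq n u v =
      4 * (∑ i, r i ^ 2) * ∑ i, (u i ^ 2 + v i ^ 2) := by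
    rw [normSq]; field_simp
  rw [h4]
  calc _ ≤ 2 * (∑ i, (u + v) i * rp i) ^ 2 + 2 * (∑ i, (u - v) i * rm i) ^ 2 := by
        nlinarith [sq_nonneg (∑ i, (u + v) i * rp i - ∑ i, (u - v) i * rm i)]
    _ ≤ 2 * ((∑ i, (u + v) i ^ 2 + ∑ i, (u - v) i ^ 2) * ∑ i, r i ^ 2) := by linarith
    _ = _ := by rw [h3]; ring

lemma pairing_eq (n : ℕ) (ψp ψm u v : Fin n → ℝ) : pairing n ψp ψm u v =
    ∑ i, (u + v) i * (weight n i * ψp i) + ∑ i, (u - v) i * (weight n i * ψm i) := by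
  rw [pairing, ← Finset.sum_add_distrib]
  exact Finset.sum_congr rfl fun i _ => by simp only [Pi.add_apply, Pi.sub_apply]; ring

/-- The pairing with the leading truncation error of a solution with second derivatives `2`. -/
def truncPairing (n : ℕ) (ψp ψm : Fin n → ℝ) : ℝ :=
  ∑ i, (ψp i * (10 * patL n i - 2 * patR n i) + ψm i * (10 * patR n i - 2 * patL n i))

/-- The functional supported at the second grid point is not touched by the penalties, yet sees `e₁
- e₂`. A bounded number of rows contribute, hence `κ ~ 1/h`; the constant `600` covers `4 · 16 · 8`
from `sum_edge_sq_le`. -/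
lemma isDual_second {n : ℕ} (hn : 4 ≤ n) (P : Params) :
    IsDual P n (fun i => if i.val = 1 then -1 else 0) 0 (600 / step n) ∧
      truncPairing n (fun i => if i.val = 1 then -1 else 0) 0 = 10 := by
  have hs := step_pos hn
  have hs3 := step_le hn
  set q : ℕ → ℝ := fun j => if j = 1 then -1 else 0 with hq
  have f1 : eFirst n ⬝ᵥ (fun j : Fin n => q j) = 0 := by
    rw [eFirst_dotProduct hn]; simp [hq]
  have f2 : eLast n ⬝ᵥ (fun j : Fin n => q j) = 0 := by
    rw [eLast_dotProduct hn]; simp [hq]; omega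
  have hed : ∀ i : ℕ, 0 ≤ (1 / 2 : ℝ) ^ (n - 1 - i) := fun i => by positivity
  have hN : ∀ u v : Fin n → ℝ, 0 ≤ normSq n u v := fun u v =>
    mul_nonneg hs.le (Finset.sum_nonneg fun i _ => by positivity)
  have h8 := sum_edge_sq_le n
  have hqe : ∀ i : Fin n, |weight n i * q i| ≤ 4 * edge n i := by
    intro i
    have hw := weight_le hn i
    have hw0 := weight_pos hn i
    simp only [hq]
    split_ifs with h
    · rw [mul_neg_one, abs_neg, abs_of_pos hw0, edge, h]
      have := hed 1
      linarith
    · simpa using (edge_pos n i).le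
  have hsum : 4 * (∑ i : Fin n, (4 * edge n i) ^ 2) / step n ≤ 600 / step n := by
    simp only [mul_pow, ← Finset.mul_sum]
    gcongr
    linarith
  constructor
  · intro u v
    constructor
    · rw [pairing_eq]
      refine (sq_sum_add_sum_le hn (r := fun i => 4 * edge n i) hqe ?_ u v).trans
        (mul_le_mul_of_nonneg_right hsum (hN u v))
      intro i
      simpa using (edge_pos n i).le
    · rw [pairing_rhs hn P (fun j : Fin n => q j) 0 u v (Θ₀ := 0) (Θ₁ := 0) (by rw [f1]; simp)
        (by rw [f2]; simp)]
      refine (sq_sum_add_sum_le hn (r := fun i => 4 * edge n i) ?_ ?_ u v).trans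
        (mul_le_mul_of_nonneg_right hsum (hN u v))
      · intro i
        have hB : (eLast n i - eFirst n i) * q i = 0 := by
          obtain ⟨i, hi⟩ := i
          simp only [eLast, eFirst, hq]
          by_cases h : i = 1
          · simp [h, show ¬ 2 = n by omega]
          · simp [h]
        rw [weight_mul_Dp hn q, hB]
        simp only [mul_zero, zero_mul, sub_zero, add_zero]
        obtain ⟨i, hi⟩ := i
        rcases Nat.lt_or_ge i 3 with h3 | h3
        · have he0 : (0 : ℝ) ≤ (1 / 2) ^ (n - 1) := by positivity
          have he1 := hed 1
          have he2 := hed 2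
          simp only [edge, fluxP, hq]
          interval_cases i
          · norm_num; linarith
          · norm_num; linarith
          · norm_num
            split_ifs <;> first | omega | (norm_num; linarith)
        · have : fluxP n q i = 0 := by
            simp only [fluxP, hq]
            split_ifs <;> first | omega | norm_num
          simpa [this] using (edge_pos n i).le
      · intro i
        simpa using (edge_pos n i).le
  · have h := sum_fin_eq_sum_of_support (n := n) {1} (by simp; omega) (fun i => q i *
      (10 * ((if i = 0 then 1 else 0) - (if i = 1 then 1 else 0)) - 2 *
        ((if i + 1 = n then 1 else 0) - (if i + 2 = n then 1 else 0))))
      (by intro j hj h; simp at h; simp [hq, h])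
    have h2 : truncPairing n (fun i => if i.val = 1 then -1 else 0) 0 = ∑ i : Fin n, q i *
      (10 * ((if i.val = 0 then 1 else 0) - (if i.val = 1 then 1 else 0)) - 2 *
        ((if i.val + 1 = n then 1 else 0) - (if i.val + 2 = n then 1 else 0))) := by
      simp [truncPairing, patL, patR, eFirst, eLast, hq]
    rw [h2, h]
    simp [hq, show ¬ 2 = n by omega, show ¬ 3 = n by omega]

lemma IsDual.smul {P : Params} {n : ℕ} {ψp ψm : Fin n → ℝ} {κ : ℝ} (h : IsDual P n ψp ψm κ)
    (s : ℝ) : IsDual P n (fun i => s * ψp i) (fun i => s * ψm i) (s ^ 2 * κ) := by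
  have hs : ∀ u v, pairing n (fun i => s * ψp i) (fun i => s * ψm i) u v =
      s * pairing n ψp ψm u v := by
    intro u v
    rw [pairing, pairing, Finset.mul_sum]
    exact Finset.sum_congr rfl fun i _ => by ring
  intro u v
  rw [hs, hs, mul_pow, mul_pow, mul_assoc]
  exact ⟨mul_le_mul_of_nonneg_left (h u v).1 (sq_nonneg s),
    mul_le_mul_of_nonneg_left (h u v).2 (sq_nonneg s)⟩

lemma truncPairing_smul (n : ℕ) (ψp ψm : Fin n → ℝ) (s : ℝ) :
    truncPairing n (fun i => s * ψp i) (fun i => s * ψm i) = s * truncPairing n ψp ψm := by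
  rw [truncPairing, truncPairing, Finset.mul_sum]
  exact Finset.sum_congr rfl fun i _ => by ring

lemma patL_dotProduct {n : ℕ} (hn : 4 ≤ n) (φ : ℕ → ℝ) :
    ∑ i : Fin n, φ i * patL n i = φ 0 - φ 1 := by
  have h := sum_fin_eq_sum_of_support (n := n) {0, 1} (by simp; omega)
    (fun j => φ j * ((if j = 0 then 1 else 0) - (if j = 1 then 1 else 0)))
    (by intro j _ h; simp at h; simp [h])
  simp only [patL, eFirst]
  rw [h]
  simp
  ring

lemma patR_dotProduct {n : ℕ} (hn : 4 ≤ n) (φ : ℕ → ℝ) :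
    ∑ i : Fin n, φ i * patR n i = φ (n - 1) - φ (n - 2) := by
  rw [← Equiv.sum_comp Fin.revPerm]
  simp only [Fin.revPerm_apply, patR_rev, Fin.val_rev]
  rw [patL_dotProduct hn (fun j => φ (n - (j + 1)))]

lemma truncPairing_eq {n : ℕ} (hn : 4 ≤ n) (p m : ℕ → ℝ) :
    truncPairing n (fun i => p i) (fun i => m i) =
      10 * (p 0 - p 1) - 2 * (p (n - 1) - p (n - 2)) + 10 * (m (n - 1) - m (n - 2)) -
        2 * (m 0 - m 1) := by
  rw [← patL_dotProduct hn p, ← patL_dotProduct hn m, ← patR_dotProduct hn p,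
    ← patR_dotProduct hn m, truncPairing]
  simp only [Finset.mul_sum, ← Finset.sum_sub_distrib, ← Finset.sum_add_distrib]
  exact Finset.sum_congr rfl fun i _ => by ring

/-- The dual grid functions of a penalty that violates the rate condition: linear profiles with
amplitudes `-a` and `d`, corrected by the boundary layer `q`. -/
lemma isDual_layer {P : Params} {q : ℕ → ℝ} {K z σ C a d : ℝ} (hq0 : q 0 = z)
    (hK : 0 ≤ K) (hqK : ∀ j, |q j| ≤ K * (1 / 2) ^ j)
    (hq : ∀ n, 4 ≤ n → ∀ i, i < n →
      |fluxP n q i - ((-0 - z) * (if i = 0 then 1 else 0) + 0 * (if i = 1 then 1 else 0))| ≤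
        K * (step n * (1 / 2) ^ (n - 1 - i)))
    (hzσ : (P.τ₁ + P.τ₂) * z = P.α₀ * P.τ₁ + P.τ₂ + 1)
    (ha : a = (1 + P.α₀) / 2) (hd : d = (1 - P.α₀) / 2) (hσ : σ = P.τ₃ + P.τ₄)
    (hC : C = 1 + 4 * (K + |a| + |d|) +
      2 * K * |σ| * (|(1 + P.α₁) / 2| + |(1 - P.α₁) / 2|)) {n : ℕ} (hn : 4 ≤ n) :
    IsDual P n (fun i => (-a) * ramp n i + q i) (fun i => d * ramp n i + 0) (8 * C ^ 2) := by
  -- The profiles are chosen to cancel the left boundary terms of the adjoint equations once `Θ₀ =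
  -- 1`.
  set p : ℕ → ℕ → ℝ := fun n j => (-a) * ramp n j + q j with hp
  set m : ℕ → ℕ → ℝ := fun n j => d * ramp n j + 0 with hm
  change IsDual P n (fun i => p n i) (fun i => m n i) (8 * C ^ 2)
  have hqn : ∀ {n}, 4 ≤ n → |q (n - 1)| ≤ 2 * K * step n := fun {n} hn => by
    have := mul_le_mul_of_nonneg_left (half_pow_pred_le hn) hK
    linarith [hqK (n - 1)]
  have hqj : ∀ j, |q j| ≤ K := fun j =>
    (hqK j).trans (mul_le_of_le_one_right hK (pow_le_one₀ (by norm_num) (by norm_num)))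
  intro u v
  have hs := step_pos hn
  have hsum : 4 * (∑ i : Fin n, (C * step n) ^ 2) / step n * normSq n u v ≤
      8 * C ^ 2 * normSq n u v := by
    refine mul_le_mul_of_nonneg_right ?_
      (mul_nonneg hs.le (Finset.sum_nonneg fun i _ => by positivity))
    rw [div_le_iff₀ hs, Finset.sum_const, Finset.card_univ, Fintype.card_fin, nsmul_eq_mul]
    have h2 := mul_le_mul_of_nonneg_right (natCast_mul_step_le hn)
      (show 0 ≤ 4 * C ^ 2 * step n by positivity)
    nlinarith [h2]
  have hw : ∀ i : Fin n, |weight n i| ≤ 13 / 12 * step n := fun i => by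
    rw [abs_of_pos (weight_pos hn i)]; exact weight_le hn i
  have hE : ∀ i : Fin n, |eLast n i| ≤ 1 := fun i => by
    unfold eLast; split_ifs <;> simp
  have hramp0 : ramp n 0 = 1 := by simp [ramp]
  have f1 : eFirst n ⬝ᵥ (fun j : Fin n => p n j) = z - a := by
    rw [eFirst_dotProduct hn]; simp only [hp, hramp0, hq0]; ring
  have f2 : eLast n ⬝ᵥ (fun j : Fin n => p n j) = q (n - 1) := by
    rw [eLast_dotProduct hn]; simp only [hp, ramp_last hn]; ring
  have f3 : eFirst n ⬝ᵥ (fun j : Fin n => m n j) = d := by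
    rw [eFirst_dotProduct hn]; simp only [hm, hramp0]; ring
  have f4 : eLast n ⬝ᵥ (fun j : Fin n => m n j) = 0 := by
    rw [eLast_dotProduct hn]; simp only [hm, ramp_last hn]; ring
  have hB : ∀ (i : Fin n) (φ : ℕ → ℝ), (eLast n i - eFirst n i) * φ i =
      eLast n i * φ (n - 1) - eFirst n i * φ 0 := by
    intro i φ
    have := i.2
    by_cases h0 : i.val = 0
    · simp [eLast, eFirst, h0, show ¬ 1 = n by omega]
    · by_cases h1 : i.val + 1 = n
      · simp [eLast, eFirst, h0, h1, show n - 1 = i.val by omega]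
      · simp [eLast, eFirst, h0, h1]
  set X := K * step n with hX
  have hX0 : 0 ≤ X := by positivity
  have hqn' : |q (n - 1)| ≤ 2 * X := by have := hqn hn; rw [hX]; linarith
  have hσX : ∀ (b : ℝ) (i : Fin n), |b * (σ * q (n - 1)) * eLast n i| ≤
      2 * K * |σ| * |b| * step n := by
    intro b i
    rw [abs_mul, abs_mul, abs_mul]
    calc _ ≤ |b| * (|σ| * (2 * X)) * 1 := by
          have := hE i
          gcongr
      _ = _ := by rw [hX]; ring
  have e1 : C * step n = step n + 4 * X + 4 * (|a| * step n) + 4 * (|d| * step n) +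
      2 * K * |σ| * |(1 + P.α₁) / 2| * step n + 2 * K * |σ| * |(1 - P.α₁) / 2| * step n := by
    rw [hC, hX]; ring
  have p1 : 0 ≤ |a| * step n := by positivity
  have p2 : 0 ≤ |d| * step n := by positivity
  have p3 : 0 ≤ 2 * K * |σ| * |(1 + P.α₁) / 2| * step n := by positivity
  have p4 : 0 ≤ 2 * K * |σ| * |(1 - P.α₁) / 2| * step n := by positivity
  have hwb : ∀ (b : ℝ) (i : Fin n), |b * weight n i| ≤ 13 / 12 * (|b| * step n) := by
    intro b i
    rw [abs_mul]
    have := mul_le_mul_of_nonneg_left (hw i) (abs_nonneg b)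
    linarith
  constructor
  · rw [pairing_eq]
    refine (sq_sum_add_sum_le hn (r := fun _ => C * step n) ?_ ?_ u v).trans hsum
    · intro i
      have hr := ramp_bound hn i.2
      have : |p n i| ≤ |a| + K := by
        simp only [hp]
        refine (abs_add_le _ _).trans (add_le_add ?_ (hqj i))
        rw [abs_mul, abs_neg]
        exact mul_le_of_le_one_right (abs_nonneg _) hr
      have h3 : |weight n i * p n i| ≤ 13 / 12 * step n * (|a| + K) := by
        rw [abs_mul]
        exact mul_le_mul (hw i) this (abs_nonneg _) (by positivity)
      rw [e1]
      have : 13 / 12 * step n * (|a| + K) = 13 / 12 * (|a| * step n) + 13 / 12 * X := by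
        rw [hX]; ring
      linarith
    · intro i
      have hr := ramp_bound hn i.2
      have : |m n i| ≤ |d| := by
        simp only [hm, add_zero]
        rw [abs_mul]
        exact mul_le_of_le_one_right (abs_nonneg _) hr
      have h3 : |weight n i * m n i| ≤ 13 / 12 * step n * |d| := by
        rw [abs_mul]
        exact mul_le_mul (hw i) this (abs_nonneg _) (by positivity)
      rw [e1]
      linarith
  -- The normalization `Θ₀ = 1` amounts to `(τ₁ + τ₂) z = α₀ τ₁ + τ₂ + 1`. At the right end only the
  -- tail of `q` is seen.
  · rw [pairing_rhs hn P _ _ u v (Θ₀ := 1) (Θ₁ := σ * q (n - 1))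
      (by rw [f1, f3, mul_sub, hzσ, ha, hd]; ring) (by rw [f2, f4, hσ]; ring), ← ha, ← hd]
    refine (sq_sum_add_sum_le hn (r := fun _ => C * step n) ?_ ?_ u v).trans hsum
    · intro i
      rw [weight_mul_Dp hn, hB i (p n)]
      have hfl : fluxP n (p n) i = (-a) * (-weight n i) + fluxP n q i := by
        rw [← fluxP_ramp hn]; exact fluxP_linear n (-a) (ramp n) q i
      have hqi := hq n hn i i.2
      set ρ := fluxP n q i - ((-0 - z) * (if i.val = 0 then 1 else 0) +
        0 * (if i.val = 1 then 1 else 0)) with hρ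
      have hρ1 : fluxP n q i = ρ - z * eFirst n i := by rw [hρ, eFirst]; ring
      have hρ2 : |ρ| ≤ X := by
        refine hqi.trans ?_
        rw [← mul_assoc]
        exact mul_le_of_le_one_right hX0 (pow_le_one₀ (by norm_num) (by norm_num))
      have hp0 : p n 0 = z - a := by simp only [hp, hramp0, hq0]; ring
      have hpn : p n (n - 1) = q (n - 1) := by simp only [hp, ramp_last hn]; ring
      rw [hfl, hρ1, hp0, hpn]
      have : -a * -weight n i + (ρ - z * eFirst n i) -
          (eLast n i * q (n - 1) - eFirst n i * (z - a)) + a * 1 * eFirst n i +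
          (1 + P.α₁) / 2 * (σ * q (n - 1)) * eLast n i = a * weight n i + ρ +
          -(eLast n i * q (n - 1)) + (1 + P.α₁) / 2 * (σ * q (n - 1)) * eLast n i := by ring
      have h4 : |-(eLast n i * q (n - 1))| ≤ 2 * X := by
        rw [abs_neg, abs_mul]
        exact (mul_le_of_le_one_left (abs_nonneg _) (hE i)).trans hqn'
      rw [this, e1]
      refine (abs_add_le _ _).trans ?_
      have t1 := abs_add_le (a * weight n i + ρ) (-(eLast n i * q (n - 1)))
      have t2 := abs_add_le (a * weight n i) ρ
      linarith [hwb a i, hσX ((1 + P.α₁) / 2) i]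
    · intro i
      rw [weight_mul_Dm hn, hB i (m n)]
      have hfl : fluxM n (m n) i = d * (-weight n i) + 0 := by
        rw [← fluxM_ramp hn]
        refine (fluxM_linear n d (ramp n) (fun _ => 0) i).trans ?_
        congr 1
        unfold fluxM; split_ifs <;> ring
      have hm0 : m n 0 = d := by simp only [hm, hramp0]; ring
      have hmn : m n (n - 1) = 0 := by simp only [hm, ramp_last hn]; ring
      rw [hfl, hm0, hmn]
      have : -(d * -weight n i + 0 - (eLast n i * 0 - eFirst n i * d)) + d * 1 * eFirst n i +
          (1 - P.α₁) / 2 * (σ * q (n - 1)) * eLast n i =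
          d * weight n i + (1 - P.α₁) / 2 * (σ * q (n - 1)) * eLast n i := by ring
      rw [this, e1]
      refine (abs_add_le _ _).trans ?_
      linarith [hwb d i, hσX ((1 - P.α₁) / 2) i]

/-- Neighbouring values of the ramps differ by `O(h)` and the layer is `O(h)` at the far end, so
only its first jump `q 0 - q 1` survives. -/
lemma le_truncPairing_layer {q : ℕ → ℝ} {K a d : ℝ} (hK : 0 ≤ K)
    (hqK : ∀ j, |q j| ≤ K * (1 / 2) ^ j) {n : ℕ} (hn : 4 ≤ n) :
    |truncPairing n (fun i => (-a) * ramp n i + q i) (fun i => d * ramp n i + 0) -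
      10 * (q 0 - q 1)| ≤ 12 * (|a| + |d| + K) * step n := by
  have hs := step_pos hn
  have h3 := mul_le_mul_of_nonneg_left (half_pow_pred_le hn) hK
  have hqn : |q (n - 1)| ≤ 2 * K * step n := by linarith [hqK (n - 1)]
  have hlast : ramp n (n - 2) = step n := by
    have := step_mul hn
    rw [ramp, Nat.cast_sub (by omega)]
    push_cast
    linarith
  have hq2 : |q (n - 2)| ≤ 4 * K * step n := by
    have h1 := hqK (n - 2)
    have h2 : (1 / 2 : ℝ) ^ (n - 2) = 2 * (1 / 2) ^ (n - 1) := by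
      obtain ⟨k, rfl⟩ : ∃ k, n = k + 2 := ⟨n - 2, by omega⟩
      rw [Nat.add_sub_cancel, show k + 2 - 1 = k + 1 by omega, pow_succ]; ring
    rw [h2] at h1
    linarith
  rw [truncPairing_eq hn (fun i => (-a) * ramp n i + q i) (fun i => d * ramp n i + 0)]
  have hval : 10 * ((-a * ramp n 0 + q 0) - (-a * ramp n 1 + q 1)) -
      2 * ((-a * ramp n (n - 1) + q (n - 1)) - (-a * ramp n (n - 2) + q (n - 2))) +
      10 * ((d * ramp n (n - 1) + 0) - (d * ramp n (n - 2) + 0)) -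
      2 * ((d * ramp n 0 + 0) - (d * ramp n 1 + 0)) - 10 * (q 0 - q 1) =
      -12 * (a + d) * step n + -2 * q (n - 1) + 2 * q (n - 2) := by
    rw [hlast, ramp_last hn]
    simp only [ramp]
    push_cast
    ring
  rw [hval]
  refine (abs_add_three _ _ _).trans ?_
  have e1 : |-12 * (a + d) * step n| ≤ 12 * (|a| + |d|) * step n := by
    rw [abs_mul, abs_mul, abs_of_pos hs, show |(-12 : ℝ)| = 12 by norm_num]
    gcongr
    exact abs_add_le a d
  have e2 : |-2 * q (n - 1)| = 2 * |q (n - 1)| := by rw [abs_mul]; norm_num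
  have e3 : |2 * q (n - 2)| = 2 * |q (n - 2)| := by rw [abs_mul]; norm_num
  rw [e2, e3]
  linarith

/-- When the rate condition fails, `z ≠ 0`, so the layer is nontrivial with `q 0 ≠ q 1`. The dual
function then has bounded `κ` and still detects the leading truncation error. -/
lemma exists_dual_left {P : Params} (hc : P.α₀ * P.τ₁ + P.τ₂ + 1 ≠ 0) (hσ : P.τ₁ + P.τ₂ ≠ 0) :
    ∃ κ c : ℝ, 0 < κ ∧ 0 < c ∧ ∃ N, ∀ n, 4 ≤ n → N ≤ n → ∃ ψp ψm : Fin n → ℝ,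
      IsDual P n ψp ψm κ ∧ c ≤ truncPairing n ψp ψm := by
  set z := (P.α₀ * P.τ₁ + P.τ₂ + 1) / (P.τ₁ + P.τ₂) with hz
  have hz0 : z ≠ 0 := div_ne_zero hc hσ
  have hzσ : (P.τ₁ + P.τ₂) * z = P.α₀ * P.τ₁ + P.τ₂ + 1 := by rw [hz]; field_simp
  obtain ⟨q, K, hq0, hq1, hqK, hq⟩ := exists_layerP z 0
  have hS : q 0 - q 1 ≠ 0 := sub_ne_zero.2 (hq1 rfl hz0).symm
  set S := q 0 - q 1 with hSdef
  have hK : 0 ≤ K := by simpa using (abs_nonneg _).trans (hqK 0)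
  have hdual := fun n (hn : 4 ≤ n) => isDual_layer hq0 hK hqK hq hzσ rfl rfl rfl rfl hn
  set a := (1 + P.α₀) / 2
  set d := (1 - P.α₀) / 2
  set C := 1 + 4 * (K + |a| + |d|) +
    2 * K * |P.τ₃ + P.τ₄| * (|(1 + P.α₁) / 2| + |(1 - P.α₁) / 2|)
  have hC0 : 0 < C := by positivity
  set L := 12 * (|a| + |d| + K)
  have hL0 : 0 ≤ L := by positivity
  have hS0 : 0 < |S| := abs_pos.2 hS
  obtain ⟨N, hN⟩ := exists_nat_gt (1 + L / (5 * |S|))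
  -- Scaling by `S` gives the pairing a positive sign: its limit is `10 S²`, and `N` is so large
  -- that at most half of it is lost.
  refine ⟨S ^ 2 * (8 * C ^ 2), 5 * S ^ 2, by positivity, by positivity, N, fun n hn hNn => ?_⟩
  refine ⟨_, _, (hdual n hn).smul S, ?_⟩
  have hs := step_pos hn
  have hsmall : L * step n ≤ 5 * |S| := by
    have h1 : (N : ℝ) ≤ n := by exact_mod_cast hNn
    have h2 : L / (5 * |S|) ≤ n - 1 := by linarith
    rw [div_le_iff₀ (by positivity)] at h2
    calc L * step n ≤ ((n - 1) * (5 * |S|)) * step n := by gcongr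
      _ = (((n : ℝ) - 1) * step n) * (5 * |S|) := by ring
      _ = _ := by rw [step_mul hn, one_mul]
  have hR := (le_truncPairing_layer (a := a) (d := d) hK hqK hn).trans hsmall
  rw [truncPairing_smul]
  set t := truncPairing n (fun i => (-a) * ramp n i + q i) (fun i => d * ramp n i + 0)
  have h7 : |S * (t - 10 * S)| ≤ |S| * (5 * |S|) := by
    rw [abs_mul]; exact mul_le_mul_of_nonneg_left hR hS0.le
  have h8 : |S| * (5 * |S|) = 5 * S ^ 2 := by rw [← sq_abs S]; ring
  rw [h8] at h7
  linarith [(abs_le.1 h7).1]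

lemma sum_rev {n : ℕ} (f : Fin n → ℝ) : ∑ i : Fin n, f i.rev = ∑ i, f i :=
  Equiv.sum_comp Fin.revPerm f

lemma normSq_reflect (n : ℕ) (u v : Fin n → ℝ) :
    normSq n (fun j => u j.rev) (fun j => -v j.rev) = normSq n u v := by
  rw [normSq, normSq, ← sum_rev fun i => u i ^ 2 + v i ^ 2]
  simp

lemma pairing_reflect (n : ℕ) (ψp ψm u v : Fin n → ℝ) :
    pairing n (fun j => ψm j.rev) (fun j => ψp j.rev) u v =
      pairing n ψp ψm (fun j => u j.rev) (fun j => -v j.rev) := by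
  rw [pairing, ← sum_rev, pairing]
  refine Finset.sum_congr rfl fun i _ => ?_
  rw [weight_rev, Fin.rev_rev]
  ring

lemma IsDual.reflect {P : Params} {n : ℕ} (hn : 4 ≤ n) {ψp ψm : Fin n → ℝ} {κ : ℝ}
    (h : IsDual P.reflect n ψp ψm κ) :
    IsDual P n (fun j => ψm j.rev) (fun j => ψp j.rev) κ := by
  intro u v
  have h1 := h (fun j => u j.rev) (fun j => -v j.rev)
  have e1 : (fun j : Fin n => rhsU P n 0 0 u v j.rev) =
      rhsU P.reflect n 0 0 (fun j => u j.rev) (fun j => -v j.rev) := by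
    funext i
    have := (rhs_reflect hn P (fun j => u j.rev) (fun j => -v j.rev) i.rev).1
    simpa [Fin.rev_rev] using this
  have e2 : (fun j : Fin n => -rhsV P n 0 0 u v j.rev) =
      rhsV P.reflect n 0 0 (fun j => u j.rev) (fun j => -v j.rev) := by
    funext i
    have := (rhs_reflect hn P (fun j => u j.rev) (fun j => -v j.rev) i.rev).2
    simp [Fin.rev_rev] at this
    linarith
  rw [pairing_reflect, pairing_reflect, e1, e2, ← normSq_reflect n u v]
  exact h1

lemma truncPairing_reflect (n : ℕ) (ψp ψm : Fin n → ℝ) :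
    truncPairing n (fun j => ψm j.rev) (fun j => ψp j.rev) = truncPairing n ψp ψm := by
  rw [truncPairing, ← sum_rev, truncPairing]
  refine Finset.sum_congr rfl fun i _ => ?_
  rw [patL_rev, patR_rev, Fin.rev_rev]
  ring

lemma exists_dual {P : Params} (hP : EnergyStable P)
    (hc : ¬ (P.α₀ * P.τ₁ + P.τ₂ + 1 = 0 ∧ P.α₁ * P.τ₃ + P.τ₄ - 1 = 0)) :
    ∃ κ c : ℝ, 0 < κ ∧ 0 < c ∧ ∃ N, ∀ n, 4 ≤ n → N ≤ n → ∃ ψp ψm : Fin n → ℝ,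
      IsDual P n ψp ψm κ ∧ c ≤ truncPairing n ψp ψm := by
  by_cases hl : P.α₀ * P.τ₁ + P.τ₂ + 1 = 0
  · have hr : P.α₁ * P.τ₃ + P.τ₄ - 1 ≠ 0 := fun h => hc ⟨hl, h⟩
    obtain ⟨κ, c, hκ, hc', N, h⟩ := exists_dual_left (P := P.reflect)
      (by intro h; apply hr; simp only [Params.reflect] at h; linarith)
      (by
        intro h
        have := hP.penalty_right
        simp only [Params.reflect] at h
        rw [show P.τ₃ - P.τ₄ = P.τ₃ + -P.τ₄ by ring, h] at this
        linarith)
    refine ⟨κ, c, hκ, hc', N, fun n hn hN => ?_⟩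
    obtain ⟨ψp, ψm, h1, h2⟩ := h n hn hN
    exact ⟨_, _, h1.reflect hn, by rwa [truncPairing_reflect]⟩
  · exact exists_dual_left hl fun h => by
      have := hP.penalty_left
      rw [h] at this
      linarith

/-! ### Existence of semidiscrete solutions and the extremal exact solution -/

/-- Variation of constants. Sharpness needs actual semidiscrete solutions, not only bounds on them.
-/
lemma exists_linear_ode_solution {E : Type*} [NormedAddCommGroup E] [NormedSpace ℝ E]
    [CompleteSpace E] (A : E →L[ℝ] E) {b : ℝ → E} (hb : Continuous b) (w₀ : E) :
    ∃ w : ℝ → E, w 0 = w₀ ∧ ∀ t, HasDerivAt w (A (w t) + b t) t := by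
  set S : ℝ → (E →L[ℝ] E) := fun t => NormedSpace.exp (t • A) with hS
  have hSd : ∀ t, HasDerivAt S (A * S t) t := fun t => hasDerivAt_exp_smul_const' A t
  have hSc : Continuous S := continuous_iff_continuousAt.2 fun t => (hSd t).continuousAt
  have hSinv : ∀ t x, S t (S (-t) x) = x := by
    intro t x
    have h : S t * S (-t) = 1 := by
      let _ : NormedAlgebra ℚ (E →L[ℝ] E) := NormedAlgebra.restrictScalars ℚ ℝ _
      rw [hS]
      simp only
      rw [← NormedSpace.exp_add_of_commute (((Commute.refl A).smul_left t).smul_right (-t)),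
        ← add_smul, add_neg_cancel, zero_smul, NormedSpace.exp_zero]
    exact congrArg (fun B : E →L[ℝ] E => B x) h
  have hf : Continuous fun s => S (-s) (b s) := (hSc.comp continuous_neg).clm_apply hb
  refine ⟨fun t => S t (w₀ + ∫ s in (0 : ℝ)..t, S (-s) (b s)), ?_, fun t => ?_⟩
  · simp [hS]
  · have h1 := ((hf.integral_hasStrictDerivAt 0 t).hasDerivAt).const_add w₀
    have h2 := (hSd t).clm_apply h1
    rw [hSinv] at h2
    exact h2

lemma exists_isSemidiscreteSolution (P : Params) (T : ℝ) {g₁ gₙ : ℝ → ℝ} (h₁ : Continuous g₁)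
    (hₙ : Continuous gₙ) (U V : ℝ → ℝ → ℝ) (n : ℕ) :
    ∃ u v, IsSemidiscreteSolution P T g₁ gₙ U V n u v := by
  obtain ⟨w, hw0, hw⟩ := exists_linear_ode_solution
    (LinearMap.toContinuousLinearMap (rhsLin P n))
    (b := fun t => (rhsU P n (g₁ t) (gₙ t) 0 0, rhsV P n (g₁ t) (gₙ t) 0 0))
    (by
      unfold rhsU rhsV
      fun_prop)
    ((fun j => U (node n j) 0), (fun j => V (node n j) 0))
  refine ⟨fun t => (w t).1, fun t => (w t).2, fun j => by simp [hw0], fun j => by simp [hw0],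
    fun t _ => ?_, fun t _ => ?_⟩
  · refine ((hasFDerivAt_fst.comp_hasDerivAt t (hw t)).hasDerivWithinAt).congr_deriv ?_
    have h := rhsU_sub_rhsU P n (g₁ t) (gₙ t) (w t).1 (w t).2 0 0
    rw [sub_zero, sub_zero] at h
    exact (eq_add_of_sub_eq h).symm
  · refine ((hasFDerivAt_snd.comp_hasDerivAt t (hw t)).hasDerivWithinAt).congr_deriv ?_
    have h := rhsV_sub_rhsV P n (g₁ t) (gₙ t) (w t).1 (w t).2 0 0
    rw [sub_zero, sub_zero] at h
    exact (eq_add_of_sub_eq h).symm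

/-- The waves are `s²` and `(1 - s)²`: second derivatives `2`, third derivatives `0`. -/
lemma isExactSolution_quadratic (P : Params) {T : ℝ} (hT : 0 < T) :
    IsExactSolution P T ∞ (fun t => t ^ 2) (fun t => 1 + t ^ 2 + P.α₁ * (-2 * t))
      (fun x t => x ^ 2 + t ^ 2) (fun x t => -2 * x * t) where
  smooth_U := by
    apply ContDiff.contDiffOn
    fun_prop
  smooth_V := by
    apply ContDiff.contDiffOn
    fun_prop
  eq_U x hx t ht := by
    have h1 : HasDerivAt (fun s : ℝ => x ^ 2 + s ^ 2) (2 * t) t := by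
      simpa using (hasDerivAt_pow 2 t).const_add (x ^ 2)
    have h2 : HasDerivAt (fun y : ℝ => -2 * y * t) (-2 * t) x := by
      simpa using ((hasDerivAt_id x).const_mul (-2 : ℝ)).mul_const t
    rw [h1.hasDerivWithinAt.derivWithin (uniqueDiffOn_Icc hT t ht),
      h2.hasDerivWithinAt.derivWithin (uniqueDiffOn_Icc zero_lt_one x hx)]
    ring
  eq_V x hx t ht := by
    have h1 : HasDerivAt (fun s : ℝ => -2 * x * s) (-2 * x) t := by
      simpa using (hasDerivAt_id t).const_mul (-2 * x)
    have h2 : HasDerivAt (fun y : ℝ => y ^ 2 + t ^ 2) (2 * x) x := by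
      simpa using (hasDerivAt_pow 2 x).add_const (t ^ 2)
    rw [h1.hasDerivWithinAt.derivWithin (uniqueDiffOn_Icc hT t ht),
      h2.hasDerivWithinAt.derivWithin (uniqueDiffOn_Icc zero_lt_one x hx)]
    ring
  bc_left t _ := by ring
  bc_right t _ := by ring

lemma le_errorNorm_quadratic {P : Params} {T : ℝ} (hT : 0 < T) {n : ℕ} (hn : 4 ≤ n)
    {u v : ℝ → Fin n → ℝ}
    (h : IsSemidiscreteSolution P T (fun t => t ^ 2) (fun t => 1 + t ^ 2 + P.α₁ * (-2 * t))
      (fun x t => x ^ 2 + t ^ 2) (fun x t => -2 * x * t) n u v)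
    {ψp ψm : Fin n → ℝ} {κ : ℝ} (hκ : 0 < κ) (hψ : IsDual P n ψp ψm κ)
    (ht : 0 < truncPairing n ψp ψm) :
    √(T ^ 3 * (step n ^ 2 / 24 * truncPairing n ψp ψm) ^ 2 / (4 * κ * (1 + T) ^ 2)) ≤
      errorNorm T (fun x t => x ^ 2 + t ^ 2) (fun x t => -2 * x * t) n u v := by
  have hs := step_pos hn
  have hex := isExactSolution_quadratic P hT
  set F : ℕ → ℝ → ℝ := fun k s =>
    if k = 0 then s ^ 2 else if k = 1 then 2 * s else if k = 2 then 2 else 0 with hF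
  set G : ℕ → ℝ → ℝ := fun k s =>
    if k = 0 then (1 - s) ^ 2 else if k = 1 then -2 * (1 - s) else if k = 2 then 2 else 0 with hG
  have hFj : HasJet F (-T) 1 := by
    intro k hk x _
    apply HasDerivAt.hasDerivWithinAt
    interval_cases k
    · simpa [hF] using hasDerivAt_pow 2 x
    · simpa [hF] using (hasDerivAt_id x).const_mul (2 : ℝ)
    · simpa [hF] using hasDerivAt_const x (2 : ℝ)
    · simpa [hF] using hasDerivAt_const x (0 : ℝ)
  have hGj : HasJet G (-T) 1 := by
    intro k hk x _
    apply HasDerivAt.hasDerivWithinAt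
    have h1 := (hasDerivAt_id x).const_sub (1 : ℝ)
    interval_cases k
    · have := h1.fun_pow 2
      simp [hG] at this ⊢
      exact this
    · simpa [hG] using h1.const_mul (-2 : ℝ)
    · simpa [hG] using hasDerivAt_const x (2 : ℝ)
    · simpa [hG] using hasDerivAt_const x (0 : ℝ)
  -- With `M = 0` the leading truncation error is the whole forcing, constant in time.
  obtain ⟨FU, FV, hE⟩ := IsSemidiscreteSolution.error_equation (M := 0) hex.bc_left hex.bc_right
    hFj hGj (fun x _ => by simp [hF]) (fun x _ => by simp [hF]) (fun x _ => by simp [hG])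
    (fun x _ => by simp [hG]) (fun x _ t _ => by
      simp only [hF, hG, if_true]
      constructor <;> ring) hn h
  rw [errorNorm]
  apply Real.sqrt_le_sqrt
  refine hψ.le_integral hκ hT (FU := FU) (FV := FV) (fun t ht => (hE t ht).1)
    (fun t ht => (hE t ht).2.1) ?_ ?_ (by positivity) fun t ht => ?_
  · funext j; simp [h.init_u j]
  · funext j; simp [h.init_v j]
  · rw [pairing, truncPairing, Finset.mul_sum]
    refine Finset.sum_congr rfl fun i _ => ?_
    obtain ⟨h1, h2⟩ := (hE t ht).2.2 i
    rw [mul_zero, zero_mul] at h1 h2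
    have h1' := abs_nonpos_iff.1 h1
    have h2' := abs_nonpos_iff.1 h2
    simp [hF] at h1'
    simp [hG] at h2'
    linear_combination ψp i * h1' + ψm i * h2'

/-! ### From bounds on the squared error to the rate -/

lemma sqrt_pow_eq_rpow {h : ℝ} (hh : 0 ≤ h) (m : ℕ) : √(h ^ m) = h ^ ((m : ℝ) / 2) := by
  rw [Real.sqrt_eq_rpow, ← Real.rpow_natCast, ← Real.rpow_mul hh]
  congr 1
  ring

/-- Both rates at once: `m = 1` for `5/2` and `m = 0` for `2`. The functional takes a value of size
`h²` times `truncPairing` on the truncation error, so the squared error is at least of order `h⁴ ·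
truncPairing² / κ`. -/
lemma hasConvergenceRate_of_bounds {P : Params} {T : ℝ} (hT : 0 < T) (m : ℕ)
    (hup : ∀ (g₁ gₙ : ℝ → ℝ) (U V : ℝ → ℝ → ℝ), IsExactSolution P T (4 : ℕ) g₁ gₙ U V →
      ∃ C, 0 ≤ C ∧ ∀ n, 4 ≤ n → ∀ u v, IsSemidiscreteSolution P T g₁ gₙ U V n u v →
        ∀ t ∈ Set.Icc 0 T,
          step n * ∑ j, ((U (node n j) t - u t j) ^ 2 + (V (node n j) t - v t j) ^ 2) ≤
            C * step n ^ (4 + m))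
    (hdual : ∃ c : ℝ, 0 < c ∧ ∃ N, ∀ n, 4 ≤ n → N ≤ n → ∃ (ψp ψm : Fin n → ℝ) (κ : ℝ),
      0 < κ ∧ IsDual P n ψp ψm κ ∧ 0 < truncPairing n ψp ψm ∧
        c * step n ^ m * κ ≤ truncPairing n ψp ψm ^ 2) :
    HasConvergenceRate P T (((4 + m : ℕ) : ℝ) / 2) := by
  refine ⟨⟨4, fun g₁ gₙ U V h => ?_⟩, ?_⟩
  · obtain ⟨C, hC, hb⟩ := hup g₁ gₙ U V h
    refine ⟨√(C * T), fun n hn u v huv => ?_⟩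
    refine (errorNorm_le hT.le hn (hb n hn u v huv)).trans_eq ?_
    rw [← sqrt_pow_eq_rpow (step_pos hn).le, ← Real.sqrt_mul (by positivity)]
    congr 1
    ring
  · obtain ⟨c, hc, N, hψ⟩ := hdual
    have hsol := fun n => exists_isSemidiscreteSolution P T (g₁ := fun t => t ^ 2)
      (gₙ := fun t => 1 + t ^ 2 + P.α₁ * (-2 * t)) (by fun_prop) (by fun_prop)
      (fun x t => x ^ 2 + t ^ 2) (fun x t => -2 * x * t) n
    choose u v huv using hsol
    refine ⟨_, _, _, _, isExactSolution_quadratic P hT, u, v, fun n _ => huv n,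
      √(T ^ 3 * c / (4 * 24 ^ 2 * (1 + T) ^ 2)), Real.sqrt_pos.2 (by positivity), max 4 N,
      fun n hn => ?_⟩
    have hn4 : 4 ≤ n := (le_max_left _ _).trans hn
    obtain ⟨ψp, ψm, κ, hκ, hd, ht, hcκ⟩ := hψ n hn4 ((le_max_right _ _).trans hn)
    have hs := step_pos hn4
    refine le_trans ?_ (le_errorNorm_quadratic hT hn4 (huv n) hκ hd ht)
    rw [← sqrt_pow_eq_rpow hs.le, ← Real.sqrt_mul (by positivity)]
    apply Real.sqrt_le_sqrt
    rw [le_div_iff₀ (by positivity)]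
    calc _ = T ^ 3 * (step n ^ 4 / 24 ^ 2) * (c * step n ^ m * κ) := by
          field_simp; ring
      _ ≤ T ^ 3 * (step n ^ 4 / 24 ^ 2) * truncPairing n ψp ψm ^ 2 := by gcongr
      _ = _ := by ring

end UpwindSBP

end

theorem theorem6 (P : UpwindSBP.Params) (T : ℝ) (hT : 0 < T)
    (hα₀ : 0 ≤ P.α₀) (hα₁ : P.α₁ ≤ 0) (hstable : UpwindSBP.EnergyStable P) :
    ((P.α₀ * P.τ₁ + P.τ₂ + 1 = 0 ∧ P.α₁ * P.τ₃ + P.τ₄ - 1 = 0) →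
      UpwindSBP.HasConvergenceRate P T (5 / 2)) ∧
    (¬ (P.α₀ * P.τ₁ + P.τ₂ + 1 = 0 ∧ P.α₁ * P.τ₃ + P.τ₄ - 1 = 0) →
      UpwindSBP.HasConvergenceRate P T 2) := by
  constructor
  · intro hc
    have h := UpwindSBP.hasConvergenceRate_of_bounds (P := P) hT 1 (fun g₁ gₙ U V hUV => by
        -- Here `ε = 0`: neither end needs a linear profile.
        obtain ⟨C, hC, hb⟩ := UpwindSBP.exists_error_bound hα₀ hα₁ hstable le_rfl
          (fun h => absurd hc.1 h) (fun h => absurd hc.2 h) hT hUV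
        refine ⟨C, hC, fun n hn u v huv t ht => (hb n hn u v huv t ht).trans_eq ?_⟩
        ring)
      -- `1/6 = 10² / 600`, from the pairing and the bound in `isDual_second`.
      ⟨1 / 6, by norm_num, 4, fun n hn _ => by
        obtain ⟨h1, h2⟩ := UpwindSBP.isDual_second hn P
        have hs := UpwindSBP.step_pos hn
        refine ⟨_, _, _, by positivity, h1, by rw [h2]; norm_num, ?_⟩
        rw [h2]
        field_simp
        norm_num⟩
    norm_num at h
    exact h
  · intro hc
    have h := UpwindSBP.hasConvergenceRate_of_bounds (P := P) hT 0 (fun g₁ gₙ U V hUV => by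
        -- Here `ε = 1`, which admits linear profiles at both ends.
        obtain ⟨C, hC, hb⟩ := UpwindSBP.exists_error_bound hα₀ hα₁ hstable zero_le_one
          (fun _ => le_rfl) (fun _ => le_rfl) hT hUV
        refine ⟨2 * C, by positivity, fun n hn u v huv t ht => (hb n hn u v huv t ht).trans ?_⟩
        have hs := UpwindSBP.step_pos hn
        have hs1 := UpwindSBP.step_le hn
        have : C * UpwindSBP.step n ^ 4 * (UpwindSBP.step n + 1) ≤
            C * UpwindSBP.step n ^ 4 * 2 := by gcongr; linarith
        rw [add_zero]
        linarith)
      (by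
        obtain ⟨κ, c, hκ, hc0, N, hd⟩ := UpwindSBP.exists_dual hstable hc
        refine ⟨c ^ 2 / κ, by positivity, N, fun n hn hN => ?_⟩
        obtain ⟨ψp, ψm, h1, h2⟩ := hd n hn hN
        refine ⟨ψp, ψm, κ, hκ, h1, hc0.trans_le h2, ?_⟩
        rw [pow_zero, mul_one, div_mul_cancel₀ _ hκ.ne']
        gcongr)
    norm_num at h
    exact h
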